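/- **Theorem.** **Event structures.** An event structure is $\mathcal E=(E,\le,\#)$, where $(E,\le)$ is a partially ordered set in which every $\downarrow e$ is finite, and $\#$ is an irreflexive symmetric relation such that $e\# e'$ and $e'\le e''$ imply $e\# e''$. A configuration is a finite, conflict-free, downward-closed set $c\subseteq E$. The domain $\mathcal D(\mathcal E)$ is the set of configurations ordered by inclusion. An event $e\notin c$ is enabled at $c$ if $c\cup\{e\}$ is a configuration. Two events are co-initial if they are enabled at a common configuration, and $e\#_\mu e'$ means that $e\# e'$ and there is no $e''\ne e,e'$ with ($e''\le e$ and $e''\#e'$) or ($e''\le e'$ and $e''\# e$). The event structure $\mathcal E\backslash c$ is the restriction of $\mathcal E$ to the events that are neither in $c$ nor in conflict with an event of $c$. $\mathcal E$ is *regular* if the $\mathcal E\backslash c$ have finitely many isomorphism types and the number of events enabled at a configuration is bounded. A *regular nice labeling* is a map $\lambda:E\to\Sigma$ to a finite set, with distinct co-initial events labeled differently, such that the labeled event structures $(\mathcal E\backslash c,\lambda)$ have finitely many isomorphism types. $\mathcal E$ is a *regular trace event structure* if, up to isomorphism, it has a labeling $\lambda$ by a finite non-empty set $\Sigma$ with an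 irreflexive symmetric relation $I$ such that (1) $e\#_\mu e'$ implies $\lambda(e)\neq\lambda(e')$; (2) if $e'$ covers $e$ in $\le$, or $e\#_\mu e'$, then $(\lambda(e),\lambda(e'))\notin I$; (3) if $(\lambda(e),\lambda(e'))\notin I$, then $e\le e'$ or $e'\le e$ or $e\# e'$; and the $(\mathcal E\backslash c,\lambda)$ have finitely many isomorphism types. **Petri nets.** A Petri net (arc weights one) consists of places, transitions $t$ with sets ${}^\bullet t,t^\bullet$ of places, and an initial marking in $\mathbb N^{\text{places}}$; $t$ may fire at a marking $M$ if $M\ge 1$ on ${}^\bullet t$, and leads to $M-\mathbf 1_{{}^\bullet t}+\mathbf 1_{t^\bullet}$. The net is 1-safe if all its reachable markings are at most $1$ on every place. Two distinct transitions $t,t'$ are independent if $({}^\bullet t\cup t^\bullet)\cap({}^\bullet t'\cup t'^\bullet)=\varnothing$; traces are the classes of words of transitions under exchange of adjacent independent letters. The events of $\mathcal E_N$ are the traces of firing sequences all of whose representatives end with the same letter; $\le$ is the prefix order of traces, and two events are in conflict if no trace of a firing sequence extends both. **Wise's event domain.** $\mathbf X$ is the directed square complex with one vertex, three vertical loops $a,b,c$,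 two horizontal loops $x,y$, and six squares, listed as (left, bottom; top, right): $(a,x;y,a)$, $(a,y;x,b)$, $(b,x;x,c)$, $(b,y;y,c)$, $(c,x;y,b)$, $(c,y;x,a)$, with horizontal edges directed from left to right and vertical ones from bottom to top. Let $r:\{a,b,c,x,y\}\to\{1,2,3,4,5\}$ be any bijection. The directed square complex $W$ is the first barycentric subdivision of $\mathbf X$ (halves of edges directed as the edges, and the four edges at the centre of a square directed from left to right and from bottom to top), with a path of $r(\alpha)$ edges, directed away from its root, attached at the midpoint of the edge $\alpha$ (this midpoint is the root), for each $\alpha\in\{a,b,c,x,y\}$. Let $\widetilde W$ be a universal cover of $W$ (a simply connected covering complex; it exists), with the lifted directions, let $\tilde v$ be any vertex of $\widetilde W$ over the vertex of $\mathbf X$, and let $\widetilde W_{\tilde v}$ be the set of vertices that can be reached from $\tilde v$ by directed paths of the 1-skeleton, ordered by reachability $\prec_{\tilde o^*}$. **Claim.** $(\widetilde W_{\tilde v},\prec_{\tilde o^*})$ is isomorphic to the domain of an event structure, and every event structure with this domain is regular but admits no regular nice labeling; it is neither a regular trace event structure nor isomorphic to $\mathcal E_N$ for a finite 1-safe Petri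 net $N$. Consequently both forms of Thiagarajan's conjecture are false: it is not true that the event structures isomorphic to some $\mathcal E_N$ with $N$ a finite 1-safe Petri net are exactly the regular ones, and it is not true that the regular event structures are exactly the regular trace event structures. -/

import Mathlib

/-! ## Event structures -/

/-- A (prime) event structure: causal dependency is the partial order, conflict is binary. -/
structure EventStructure where
  Event : Type
  [order : PartialOrder Event]
  conflict : Event → Event → Prop
  conflict_irrefl : ∀ e, ¬ conflict e e
  conflict_symm : ∀ e e', conflict e e' → conflict e' e
  finite_down : ∀ e : Event, (Set.Iic e).Finite
  conflict_inherit : ∀ e e' e'', conflict e e' → e' ≤ e'' → conflict e e''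

namespace EventStructure

attribute [instance] EventStructure.order

/-- Configurations: finite, conflict-free, downward-closed sets of events. -/
def IsConfiguration (E : EventStructure) (c : Set E.Event) : Prop :=
  c.Finite ∧ (∀ e ∈ c, ∀ e' ∈ c, ¬ E.conflict e e') ∧ IsLowerSet c

/-- The domain of an event structure: all configurations, ordered by inclusion
(the order is the one that a subtype of `Set E.Event` inherits). -/
abbrev Domain (E : EventStructure) : Type := {c : Set E.Event // E.IsConfiguration c}

/-- The set of events enabled at a set of events. -/
def enabled (E : EventStructure) (c : Set E.Event) : Set E.Event :=
  {e | e ∉ c ∧ E.IsConfiguration (insert e c)}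

/-- Two events are co-initial if both are enabled at some configuration. -/
def CoInitial (E : EventStructure) (e e' : E.Event) : Prop :=
  ∃ c : E.Domain, e ∈ E.enabled c ∧ e' ∈ E.enabled c

/-- Minimal conflict. -/
def MinConflict (E : EventStructure) (e' e'' : E.Event) : Prop :=
  E.conflict e' e'' ∧
    ¬ ∃ e, e ≠ e' ∧ e ≠ e'' ∧
      ((e ≤ e' ∧ E.conflict e e'') ∨ (e ≤ e'' ∧ E.conflict e e'))

/-- Finite degree: the number of events enabled at a configuration is bounded. -/
def FiniteDegree (E : EventStructure) : Prop :=
  ∃ d : ℕ, ∀ c : E.Domain, (E.enabled c).encard ≤ d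

/-- Isomorphisms of event structures: bijections that preserve and reflect order and conflict. -/
structure Iso (E₁ E₂ : EventStructure) extends E₁.Event ≃o E₂.Event where
  map_conflict_iff : ∀ e e', E₂.conflict (toFun e) (toFun e') ↔ E₁.conflict e e'

/-- The event structure rooted at the configuration `c`: delete the events of `c` and the events
in conflict with an event of `c`. -/
def residual (E : EventStructure) (c : E.Domain) : EventStructure where
  Event := {e : E.Event // e ∉ c.1 ∧ ¬ ∃ e₀ ∈ c.1, E.conflict e₀ e}
  conflict e e' := E.conflict e.1 e'.1
  conflict_irrefl e := E.conflict_irrefl e.1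
  conflict_symm e e' := E.conflict_symm e.1 e'.1
  finite_down e := ((E.finite_down e.1).preimage Subtype.val_injective.injOn).subset
    (fun _ h => h)
  conflict_inherit e e' e'' h h' := E.conflict_inherit e.1 e'.1 e''.1 h h'

/-- Two configurations are future-equivalent if the event structures rooted at them are
isomorphic. -/
def FutureEquiv (E : EventStructure) (c c' : E.Domain) : Prop :=
  Nonempty (Iso (E.residual c) (E.residual c'))

/-- Label-preserving version of `FutureEquiv`. -/
def LabeledFutureEquiv (E : EventStructure) {A : Type} (lab : E.Event → A)
    (c c' : E.Domain) : Prop :=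
  ∃ f : Iso (E.residual c) (E.residual c'),
    ∀ e : (E.residual c).Event, lab (f.toFun e).1 = lab e.1

/-- The index is finite: future-equivalence has finitely many classes. -/
def FiniteIndex (E : EventStructure) : Prop := Finite (Quot E.FutureEquiv)

/-- The labeled index is finite. -/
def FiniteLabeledIndex (E : EventStructure) {A : Type} (lab : E.Event → A) : Prop :=
  Finite (Quot (E.LabeledFutureEquiv lab))

/-- Regular event structures. -/
def Regular (E : EventStructure) : Prop := E.FiniteIndex ∧ E.FiniteDegree

/-- Nice labelings: distinct co-initial events have distinct labels. -/
def IsNice (E : EventStructure) {A : Type} (lab : E.Event → A) : Prop :=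
  ∀ e e', e ≠ e' → E.CoInitial e e' → lab e ≠ lab e'

/-- `E` has a nice labeling with a finite alphabet for which the labeled index is finite. -/
def AdmitsRegularNiceLabeling (E : EventStructure) : Prop :=
  ∃ (A : Type) (lab : E.Event → A), Finite A ∧ E.IsNice lab ∧ E.FiniteLabeledIndex lab

/-- Trace labelings with respect to an independence relation `I`;
dependence is the complement of `I`. -/
def IsTraceLabeling (E : EventStructure) {A : Type} (I : A → A → Prop)
    (lab : E.Event → A) : Prop :=
  (∀ e e', E.MinConflict e e' → lab e ≠ lab e') ∧
  (∀ e e', (e ⋖ e' ∨ E.MinConflict e e') → ¬ I (lab e) (lab e')) ∧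
  (∀ e e', ¬ I (lab e) (lab e') → e ≤ e' ∨ e' ≤ e ∨ E.conflict e e')

/-- `E` is isomorphic to the underlying event structure of a regular event structure labeled by
a finite non-empty Mazurkiewicz trace alphabet `(A, I)`. -/
def IsRegularTrace (E : EventStructure) : Prop :=
  ∃ (A : Type) (I : A → A → Prop) (E' : EventStructure) (lab : E'.Event → A),
    Finite A ∧ Nonempty A ∧ (∀ a, ¬ I a a) ∧ (∀ a b, I a b → I b a) ∧
    E'.IsTraceLabeling I lab ∧ E'.FiniteLabeledIndex lab ∧ Nonempty (Iso E E')

/-- The ordered set `P` is (isomorphic to) the domain of `E`. -/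
def HasDomain (E : EventStructure) (P : Type) [LE P] : Prop := Nonempty (E.Domain ≃o P)

end EventStructure

/-! ## 1-safe Petri nets and their event structures -/

/-- A Petri net (with arc weights one) together with an initial marking. -/
structure PetriNet where
  Place : Type
  Transition : Type
  pre : Transition → Set Place
  post : Transition → Set Place
  init : Place → ℕ

namespace PetriNet

/-- `N.Fire M t M'`: at the marking `M` the transition `t` may fire, and leads to `M'`. -/
def Fire (N : PetriNet) (M : N.Place → ℕ) (t : N.Transition) (M' : N.Place → ℕ) : Prop :=
  ∀ s, (N.pre t).indicator 1 s ≤ M s ∧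
    M' s + (N.pre t).indicator 1 s = M s + (N.post t).indicator 1 s

/-- `N.FireSeq M σ M'`: the word `σ` of transitions can be fired from `M`, leading to `M'`. -/
def FireSeq (N : PetriNet) : (N.Place → ℕ) → List N.Transition → (N.Place → ℕ) → Prop
  | M, [], M' => M' = M
  | M, t :: σ, M' => ∃ M₁, N.Fire M t M₁ ∧ N.FireSeq M₁ σ M'

/-- The firing sequences of the net. -/
def IsFiringSequence (N : PetriNet) (σ : List N.Transition) : Prop :=
  ∃ M, N.FireSeq N.init σ M

/-- Every reachable marking puts at most one token on each place. -/
def OneSafe (N : PetriNet) : Prop :=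
  ∀ σ M, N.FireSeq N.init σ M → ∀ s, M s ≤ 1

/-- Finite nets. -/
def IsFinite (N : PetriNet) : Prop := Finite N.Place ∧ Finite N.Transition

/-- Two distinct transitions are independent if their neighbourhoods are disjoint. -/
def Indep (N : PetriNet) (t t' : N.Transition) : Prop :=
  t ≠ t' ∧ Disjoint (N.pre t ∪ N.post t) (N.pre t' ∪ N.post t')

/-- Exchange of two adjacent independent letters. -/
def Swap (N : PetriNet) (σ τ : List N.Transition) : Prop :=
  ∃ u v a b, N.Indep a b ∧ σ = u ++ a :: b :: v ∧ τ = u ++ b :: a :: v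

/-- Trace equivalence of words. -/
def TraceEquiv (N : PetriNet) : List N.Transition → List N.Transition → Prop :=
  Relation.EqvGen N.Swap

/-- Mazurkiewicz traces over the transitions of the net. -/
abbrev Trace (N : PetriNet) : Type := Quotient (Relation.EqvGen.setoid N.Swap)

/-- The trace of a word. -/
def traceOf (N : PetriNet) (σ : List N.Transition) : N.Trace :=
  Quotient.mk (Relation.EqvGen.setoid N.Swap) σ

/-- The prefix order on traces. -/
def Prefix (N : PetriNet) (τ τ' : N.Trace) : Prop :=
  ∃ σ ρ, N.traceOf σ = τ ∧ N.traceOf (σ ++ ρ) = τ'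

/-- Traces of firing sequences. -/
def IsFiringTrace (N : PetriNet) (τ : N.Trace) : Prop :=
  ∃ σ, N.IsFiringSequence σ ∧ N.traceOf σ = τ

/-- Prime traces: all representatives end with one and the same letter. -/
def IsPrime (N : PetriNet) (τ : N.Trace) : Prop :=
  ∃ t, ∀ σ, N.traceOf σ = τ → ∃ ρ, σ = ρ ++ [t]

lemma traceEquiv_append_right (N : PetriNet) {σ τ : List N.Transition} (h : N.TraceEquiv σ τ)
    (ρ : List N.Transition) : N.TraceEquiv (σ ++ ρ) (τ ++ ρ) := by
  induction h with
  | rel x y h =>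
    obtain ⟨u, v, a, b, hab, rfl, rfl⟩ := h
    exact Relation.EqvGen.rel _ _ ⟨u, v ++ ρ, a, b, hab, by simp, by simp⟩
  | refl x => exact Relation.EqvGen.refl _
  | symm x y _ ih => exact Relation.EqvGen.symm _ _ ih
  | trans x y z _ _ ih₁ ih₂ => exact Relation.EqvGen.trans _ _ _ ih₁ ih₂

lemma traceEquiv_perm (N : PetriNet) {σ τ : List N.Transition} (h : N.TraceEquiv σ τ) :
    σ.Perm τ := by
  induction h with
  | rel x y h =>
    obtain ⟨u, v, a, b, -, rfl, rfl⟩ := h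
    exact List.Perm.append_left u (List.Perm.swap b a v)
  | refl x => exact List.Perm.refl _
  | symm x y _ ih => exact ih.symm
  | trans x y z _ _ ih₁ ih₂ => exact ih₁.trans ih₂

lemma traceOf_eq_iff (N : PetriNet) {σ τ : List N.Transition} :
    N.traceOf σ = N.traceOf τ ↔ N.TraceEquiv σ τ :=
  Quotient.eq (r := Relation.EqvGen.setoid N.Swap)

lemma prefix_refl (N : PetriNet) (τ : N.Trace) : N.Prefix τ τ := by
  obtain ⟨σ, rfl⟩ := Quotient.exists_rep τ
  exact ⟨σ, [], rfl, by rw [List.append_nil]; rfl⟩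

lemma prefix_trans (N : PetriNet) {τ₁ τ₂ τ₃ : N.Trace} (h : N.Prefix τ₁ τ₂)
    (h' : N.Prefix τ₂ τ₃) : N.Prefix τ₁ τ₃ := by
  obtain ⟨σ, ρ, rfl, rfl⟩ := h
  obtain ⟨σ', ρ', h, rfl⟩ := h'
  refine ⟨σ, ρ ++ ρ', rfl, ?_⟩
  rw [← List.append_assoc, N.traceOf_eq_iff]
  exact N.traceEquiv_append_right (N.traceOf_eq_iff.1 h.symm) ρ'

lemma prefix_antisymm (N : PetriNet) {τ₁ τ₂ : N.Trace} (h : N.Prefix τ₁ τ₂)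
    (h' : N.Prefix τ₂ τ₁) : τ₁ = τ₂ := by
  obtain ⟨σ, ρ, rfl, rfl⟩ := h
  obtain ⟨σ', ρ', h, h'⟩ := h'
  have h₁ := (N.traceEquiv_perm (N.traceOf_eq_iff.1 h)).length_eq
  have h₂ := (N.traceEquiv_perm (N.traceOf_eq_iff.1 h')).length_eq
  simp only [List.length_append] at h₁ h₂
  have : ρ = [] := List.length_eq_zero_iff.1 (by omega)
  simp [this]

lemma finite_prefixes (N : PetriNet) (τ : N.Trace) : {τ' | N.Prefix τ' τ}.Finite := by
  obtain ⟨w, rfl⟩ := Quotient.exists_rep τ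
  have hfin : {σ : List N.Transition | ∃ ρ, (σ ++ ρ).Perm w}.Finite := by
    have h₁ : {l : List N.Transition | l.Perm w}.Finite := by
      classical
      refine (List.finite_toSet w.permutations).subset ?_
      intro l hl
      exact List.mem_permutations.2 hl
    refine (h₁.biUnion (fun l _ => List.finite_toSet l.inits)).subset ?_
    rintro σ ⟨ρ, h⟩
    simp only [Set.mem_iUnion]
    exact ⟨σ ++ ρ, h, List.mem_inits _ _ |>.2 ⟨ρ, rfl⟩⟩
  refine (hfin.image N.traceOf).subset ?_
  rintro τ' ⟨σ, ρ, rfl, h⟩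
  exact ⟨σ, ⟨ρ, N.traceEquiv_perm (N.traceOf_eq_iff.1 h)⟩, rfl⟩

/-- The event structure of a net: events are the prime firing traces, ordered by prefix; two events
are in conflict if no firing trace extends both. -/
def eventStructure (N : PetriNet) : EventStructure where
  Event := {τ : N.Trace // N.IsFiringTrace τ ∧ N.IsPrime τ}
  order :=
    { le := fun e e' => N.Prefix e.1 e'.1
      le_refl := fun e => N.prefix_refl e.1
      le_trans := fun _ _ _ h h' => N.prefix_trans h h'
      le_antisymm := fun _ _ h h' => Subtype.ext (N.prefix_antisymm h h') }
  conflict e e' := ¬ ∃ τ, N.IsFiringTrace τ ∧ N.Prefix e.1 τ ∧ N.Prefix e'.1 τ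
  conflict_irrefl e h := h ⟨e.1, e.2.1, N.prefix_refl _, N.prefix_refl _⟩
  conflict_symm _ _ h := fun ⟨τ, h₀, h₁, h₂⟩ => h ⟨τ, h₀, h₂, h₁⟩
  finite_down e := ((N.finite_prefixes e.1).preimage Subtype.val_injective.injOn).subset
    (fun _ h => h)
  conflict_inherit _ _ _ h h' := fun ⟨τ, h₀, h₁, h₂⟩ => h ⟨τ, h₀, h₁, N.prefix_trans h' h₂⟩

end PetriNet

/-- `E` is isomorphic to the event structure of a finite 1-safe Petri net. -/
def EventStructure.IsOfFiniteOneSafeNet (E : EventStructure) : Prop :=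
  ∃ N : PetriNet, N.IsFinite ∧ N.OneSafe ∧ Nonempty (EventStructure.Iso E N.eventStructure)

/-- Thiagarajan's conjecture, in terms of Petri nets. -/
def ThiagarajanConjecturePetri : Prop :=
  ∀ E : EventStructure, E.IsOfFiniteOneSafeNet ↔ E.Regular

/-- Thiagarajan's conjecture, in terms of trace labelings. -/
def ThiagarajanConjectureTrace : Prop :=
  ∀ E : EventStructure, E.Regular ↔ E.IsRegularTrace

/-! ## Directed square complexes and universal covers -/

/-- A square complex with edges directed so that opposite edges of every square have the same
direction. Multiple edges and loops are allowed. The boundary of a square is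
```
     top
    s → r
left↑   ↑right
    p → q
     bot
```
-/
structure DirectedSquareComplex where
  V : Type
  E : Type
  Q : Type
  src : E → V
  tgt : E → V
  bot : Q → E
  right : Q → E
  top : Q → E
  left : Q → E
  src_bot : ∀ q, src (bot q) = src (left q)
  tgt_bot : ∀ q, tgt (bot q) = src (right q)
  tgt_left : ∀ q, tgt (left q) = src (top q)
  tgt_top : ∀ q, tgt (top q) = tgt (right q)

namespace DirectedSquareComplex

/-- An edge traversed along (`true`) or against (`false`) its direction. -/
abbrev Step (K : DirectedSquareComplex) : Type := K.E × Bool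

/-- The vertex at which a step starts. -/
def Step.start {K : DirectedSquareComplex} : K.Step → K.V
  | (e, true) => K.src e
  | (e, false) => K.tgt e

/-- The vertex at which a step ends. -/
def Step.finish {K : DirectedSquareComplex} : K.Step → K.V
  | (e, true) => K.tgt e
  | (e, false) => K.src e

/-- The reversed step. -/
def Step.rev {K : DirectedSquareComplex} : K.Step → K.Step
  | (e, b) => (e, !b)

/-- `K.IsPath u l v`: the list `l` of steps is a path of the 1-skeleton from `u` to `v`. -/
def IsPath (K : DirectedSquareComplex) : K.V → List K.Step → K.V → Prop
  | u, [], v => u = v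
  | u, s :: l, v => Step.start s = u ∧ K.IsPath (Step.finish s) l v

/-- Removal of a backtrack, or replacement of two consecutive sides of a square by the other
two. -/
def Move (K : DirectedSquareComplex) (l l' : List K.Step) : Prop :=
  (∃ l₁ l₂ s, l = l₁ ++ s :: Step.rev s :: l₂ ∧ l' = l₁ ++ l₂) ∨
  (∃ l₁ l₂ q, l = l₁ ++ (K.bot q, true) :: (K.right q, true) :: l₂ ∧
    l' = l₁ ++ (K.left q, true) :: (K.top q, true) :: l₂)

/-- Elementary homotopies between paths from `u` to `v`. -/
def ElementaryHomotopy (K : DirectedSquareComplex) (u v : K.V) (l l' : List K.Step) : Prop :=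
  K.IsPath u l v ∧ K.IsPath u l' v ∧ K.Move l l'

/-- Homotopy of paths from `u` to `v`. -/
def Homotopic (K : DirectedSquareComplex) (u v : K.V) : List K.Step → List K.Step → Prop :=
  Relation.EqvGen (K.ElementaryHomotopy u v)

/-- Connected, and every closed path of the 1-skeleton is null-homotopic. -/
def SimplyConnected (K : DirectedSquareComplex) : Prop :=
  Nonempty K.V ∧ (∀ u v, ∃ l, K.IsPath u l v) ∧
    ∀ u l, K.IsPath u l u → K.Homotopic u u l []

/-- Maps of directed square complexes. -/
structure Hom (K L : DirectedSquareComplex) where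
  onV : K.V → L.V
  onE : K.E → L.E
  onQ : K.Q → L.Q
  map_src : ∀ e, onV (K.src e) = L.src (onE e)
  map_tgt : ∀ e, onV (K.tgt e) = L.tgt (onE e)
  map_bot : ∀ q, onE (K.bot q) = L.bot (onQ q)
  map_right : ∀ q, onE (K.right q) = L.right (onQ q)
  map_top : ∀ q, onE (K.top q) = L.top (onQ q)
  map_left : ∀ q, onE (K.left q) = L.left (onQ q)

/-- Covering maps: surjective, and at every vertex a bijection between the outgoing edges,
the incoming edges, and the squares with a given corner at that vertex. -/
structure Hom.IsCovering {K L : DirectedSquareComplex} (p : Hom K L) : Prop where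
  surjective : Function.Surjective p.onV
  lift_out : ∀ v e, L.src e = p.onV v → ∃! e', K.src e' = v ∧ p.onE e' = e
  lift_in : ∀ v e, L.tgt e = p.onV v → ∃! e', K.tgt e' = v ∧ p.onE e' = e
  lift_corner_bot_left : ∀ v q, L.src (L.bot q) = p.onV v →
    ∃! q', K.src (K.bot q') = v ∧ p.onQ q' = q
  lift_corner_bot_right : ∀ v q, L.tgt (L.bot q) = p.onV v →
    ∃! q', K.tgt (K.bot q') = v ∧ p.onQ q' = q
  lift_corner_top_left : ∀ v q, L.src (L.top q) = p.onV v →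
    ∃! q', K.src (K.top q') = v ∧ p.onQ q' = q
  lift_corner_top_right : ∀ v q, L.tgt (L.top q) = p.onV v →
    ∃! q', K.tgt (K.top q') = v ∧ p.onQ q' = q

/-- Universal covers: simply connected covers. -/
def Hom.IsUniversalCover {K L : DirectedSquareComplex} (p : Hom K L) : Prop :=
  p.IsCovering ∧ K.SimplyConnected

/-- There is a directed path from `u` to `v`. -/
def Reach (K : DirectedSquareComplex) : K.V → K.V → Prop :=
  Relation.ReflTransGen (fun u v => ∃ e, K.src e = u ∧ K.tgt e = v)

/-- The principal filter of `v`: all vertices that can be reached from `v`. -/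
def PrincipalFilter (K : DirectedSquareComplex) (v : K.V) : Type := {x : K.V // K.Reach v x}

/-- The order on a principal filter is reachability. -/
instance (K : DirectedSquareComplex) (v : K.V) : LE (K.PrincipalFilter v) :=
  ⟨fun x y => K.Reach x.1 y.1⟩

/-- Edges of the barycentric subdivision: the two halves of each edge, and for each square the
four edges between its centre and the midpoints of its sides. -/
inductive BaryEdge (K : DirectedSquareComplex) : Type
  | first (e : K.E)
  | second (e : K.E)
  | botToCentre (q : K.Q)
  | leftToCentre (q : K.Q)
  | centreToTop (q : K.Q)
  | centreToRight (q : K.Q)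

/-- Vertices of the barycentric subdivision. -/
inductive BaryVertex (K : DirectedSquareComplex) : Type
  | vertex (v : K.V)
  | mid (e : K.E)
  | centre (q : K.Q)

/-- Squares of the barycentric subdivision: the four quarters of each square. -/
inductive BarySquare (K : DirectedSquareComplex) : Type
  | botLeft (q : K.Q)
  | botRight (q : K.Q)
  | topLeft (q : K.Q)
  | topRight (q : K.Q)

/-- The first barycentric subdivision, directed from left to right and from bottom to top. -/
def bary (K : DirectedSquareComplex) : DirectedSquareComplex where
  V := K.BaryVertex
  E := K.BaryEdge
  Q := K.BarySquare
  src
    | .first e => .vertex (K.src e)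
    | .second e => .mid e
    | .botToCentre q => .mid (K.bot q)
    | .leftToCentre q => .mid (K.left q)
    | .centreToTop q => .centre q
    | .centreToRight q => .centre q
  tgt
    | .first e => .mid e
    | .second e => .vertex (K.tgt e)
    | .botToCentre q => .centre q
    | .leftToCentre q => .centre q
    | .centreToTop q => .mid (K.top q)
    | .centreToRight q => .mid (K.right q)
  bot
    | .botLeft q => .first (K.bot q)
    | .botRight q => .second (K.bot q)
    | .topLeft q => .leftToCentre q
    | .topRight q => .centreToRight q
  right
    | .botLeft q => .botToCentre q
    | .botRight q => .first (K.right q)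
    | .topLeft q => .centreToTop q
    | .topRight q => .second (K.right q)
  top
    | .botLeft q => .leftToCentre q
    | .botRight q => .centreToRight q
    | .topLeft q => .first (K.top q)
    | .topRight q => .second (K.top q)
  left
    | .botLeft q => .first (K.left q)
    | .botRight q => .botToCentre q
    | .topLeft q => .second (K.left q)
    | .topRight q => .centreToTop q
  src_bot q := by cases q <;> simp [K.src_bot]
  tgt_bot q := by cases q <;> simp [K.tgt_bot]
  tgt_left q := by cases q <;> simp [K.tgt_left]
  tgt_top q := by cases q <;> simp [K.tgt_top]

/-- Attach to the vertex `root i`, for every `i`, a path (tip) with `len i` edges,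
directed away from `root i`. The new vertices of the tip `i` are `⟨i, 0⟩, …, ⟨i, len i - 1⟩`. -/
def attachTips (K : DirectedSquareComplex) {ι : Type} (root : ι → K.V) (len : ι → ℕ) :
    DirectedSquareComplex where
  V := K.V ⊕ (Σ i, Fin (len i))
  E := K.E ⊕ (Σ i, Fin (len i))
  Q := K.Q
  src
    | .inl e => .inl (K.src e)
    | .inr ⟨i, ⟨0, _⟩⟩ => .inl (root i)
    | .inr ⟨i, ⟨j + 1, h⟩⟩ => .inr ⟨i, ⟨j, Nat.lt_of_succ_lt h⟩⟩
  tgt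
    | .inl e => .inl (K.tgt e)
    | .inr x => .inr x
  bot q := .inl (K.bot q)
  right q := .inl (K.right q)
  top q := .inl (K.top q)
  left q := .inl (K.left q)
  src_bot q := by simp [K.src_bot]
  tgt_bot q := by simp [K.tgt_bot]
  tgt_left q := by simp [K.tgt_left]
  tgt_top q := by simp [K.tgt_top]

end DirectedSquareComplex

/-! ## Wise's complexes -/

/-- The colours of the vertical edges `a, b, c` and of the horizontal edges `x, y`. -/
inductive WiseColor : Type
  | a | b | c | x | y
  deriving DecidableEq

/-- The six squares of Wise's complex, named by their left and bottom sides. -/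
inductive WiseSquare : Type
  | a_x | a_y | b_x | b_y | c_x | c_y
  deriving DecidableEq

/-- Wise's complex: one vertex, five directed loops, six squares. -/
def wiseX : DirectedSquareComplex where
  V := Unit
  E := WiseColor
  Q := WiseSquare
  src _ := ()
  tgt _ := ()
  left
    | .a_x => .a | .a_y => .a | .b_x => .b | .b_y => .b | .c_x => .c | .c_y => .c
  bot
    | .a_x => .x | .a_y => .y | .b_x => .x | .b_y => .y | .c_x => .x | .c_y => .y
  top
    | .a_x => .y | .a_y => .x | .b_x => .x | .b_y => .y | .c_x => .y | .c_y => .x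
  right
    | .a_x => .a | .a_y => .b | .b_x => .c | .b_y => .c | .c_x => .b | .c_y => .a
  src_bot _ := rfl
  tgt_bot _ := rfl
  tgt_left _ := rfl
  tgt_top _ := rfl

/-- The complex `W`: the barycentric subdivision of Wise's complex, with a tip of length `r α`
attached to the midpoint of the edge of colour `α`. -/
def wiseW (r : WiseColor → ℕ) : DirectedSquareComplex :=
  wiseX.bary.attachTips (fun α : WiseColor => DirectedSquareComplex.BaryVertex.mid α) r

/-- The vertex of `W` that is the unique vertex of Wise's complex. -/
def wiseZero (r : WiseColor → ℕ) : (wiseW r).V :=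
  Sum.inl (DirectedSquareComplex.BaryVertex.vertex ())

/-! In Wise's complex the left and bottom sides of a square can be chosen freely and determine the
square, so every directed path from the base point is homotopic to a vertical word followed by a
horizontal one. The filter of the base vertex is therefore a product of two subdivided trees of
words, with tips attached over the midpoints of edges (`Wise.nonempty_tips_orderIso`). That
different pairs of words end at different vertices is detected by two actions of the colours, on the
free groups over the vertical and over the horizontal letters: letters of the group's own kind act
by left multiplication, the others as states of an automaton, which fix `1`. The squares are
relations of both actions, so products along paths are homotopy invariants, and evaluating them at
`1` recovers the words (`Wise.letters_eq_of_prod_eq`).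

A product of rooted trees with tips is the domain of an event structure whose events are the points
of the axes and of the tips (`TipProduct.exists_hasDomain`). It is regular because the filter of a
vertex of a universal cover depends only on the image of the vertex in the finite complex `W`
(`nonempty_filter_orderIso`), an event structure is determined by its domain
(`nonempty_iso_of_domain`), and the events enabled at a configuration inject into the edges of `W`.

Now take a nice labeling. Parallel edges of the product add the same event, so every horizontal line
carries the labels of the horizontal axis; niceness means that a label determines the next
configuration. Hence a label-preserving isomorphism from the filter of `(c^m, ⊥)` to that of `(c^n,
⊥)` sends `(c^m, q)` to `(c^n, q)` for every `q`. The length of the tip at a point is visible in the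
order, and since `r` is injective it reveals the colour of the edge below. So the rectangles with
left sides `c^m` and `c^n` have the same top word over every bottom word. This forces `m = n`,
because the automaton state `c` has infinite order (`Wise.row_replicate_injective`), and a finite
index is impossible (`Wise.not_exists_finite_invariant`).

The other two negative statements reduce to this contradiction. Trace labelings are nice
(`IsTraceLabeling.isNice`). The configurations of a net are its firing traces
(`PetriNet.exists_domain_orderIso`), the last letter is a nice labeling, and the marking determines
the labeled filter; a finite 1-safe net has finitely many markings. -/

namespace EventStructure

/-! ### Configurations and domains -/

variable {E E₁ E₂ : EventStructure}

lemma isConfiguration_Iic (E : EventStructure) (e : E.Event) : E.IsConfiguration (Set.Iic e) := by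
  refine ⟨E.finite_down e, fun a ha b hb h => ?_, isLowerSet_Iic e⟩
  have h₁ := E.conflict_inherit a b e h hb
  exact E.conflict_irrefl e (E.conflict_inherit e a e (E.conflict_symm _ _ h₁) ha)

lemma IsConfiguration.subset {c d : Set E.Event} (hc : E.IsConfiguration c) (hd : IsLowerSet d)
    (h : d ⊆ c) : E.IsConfiguration d :=
  ⟨hc.1.subset h, fun a ha b hb => hc.2.1 a (h ha) b (h hb), hd⟩

lemma IsConfiguration.Iic_subset {c : Set E.Event} (hc : E.IsConfiguration c) {e : E.Event}
    (he : e ∈ c) : Set.Iic e ⊆ c :=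
  fun _ h => hc.2.2 h he

/-- The configuration generated by an event. -/
def down (E : EventStructure) (e : E.Event) : E.Domain := ⟨Set.Iic e, E.isConfiguration_Iic e⟩

lemma down_le_down {e e' : E.Event} : E.down e ≤ E.down e' ↔ e ≤ e' :=
  Set.Iic_subset_Iic

lemma down_le {e : E.Event} {c : E.Domain} : E.down e ≤ c ↔ e ∈ c.1 :=
  ⟨fun h => h (Set.mem_Iic.2 le_rfl), fun h => c.2.Iic_subset h⟩

/-- A conflict between elements below `e` and `e'` is inherited upwards on both sides, so without
one between `e` and `e'` the union of the two down-sets is a configuration. Conflict thus becomes a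
property of the order of the domain. -/
lemma conflict_iff_not_bounded (e e' : E.Event) :
    E.conflict e e' ↔ ¬ ∃ c : E.Domain, E.down e ≤ c ∧ E.down e' ≤ c := by
  constructor
  · rintro h ⟨c, h₁, h₂⟩
    exact c.2.2.1 _ (down_le.1 h₁) _ (down_le.1 h₂) h
  · intro h
    by_contra hc
    refine h ⟨⟨Set.Iic e ∪ Set.Iic e', (E.finite_down e).union (E.finite_down e'), ?_,
      (isLowerSet_Iic e).union (isLowerSet_Iic e')⟩, Set.subset_union_left, Set.subset_union_right⟩
    have key : ∀ a ≤ e, ∀ b ≤ e', ¬ E.conflict a b := fun a ha b hb hab =>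
      hc (E.conflict_symm _ _ (E.conflict_inherit _ _ _
        (E.conflict_symm _ _ (E.conflict_inherit _ _ _ hab hb)) ha))
    rintro a (ha | ha) b (hb | hb)
    · exact (E.isConfiguration_Iic e).2.1 a ha b hb
    · exact key a ha b hb
    · exact fun h => key b hb a ha (E.conflict_symm _ _ h)
    · exact (E.isConfiguration_Iic e').2.1 a ha b hb

/-- An element of an order that has a greatest strictly smaller element. -/
def HasUniquePredecessor {P : Type} [Preorder P] (x : P) : Prop :=
  ∃ d < x, ∀ d' < x, d' ≤ d

/-- This recognizes events inside the ordered set of configurations. If `d` is the predecessor of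
`c` and `e` is in `c` but not in `d`, then `↓e` cannot be smaller than `c`, since it would lie in
`d`. -/
lemma hasUniquePredecessor_iff (c : E.Domain) :
    HasUniquePredecessor c ↔ ∃ e, c = E.down e := by
  constructor
  · rintro ⟨d, hd, h⟩
    obtain ⟨e, he, hed⟩ := Set.exists_of_ssubset (show d.1 ⊂ c.1 from hd)
    refine ⟨e, ?_⟩
    by_contra hne
    have : E.down e < c := lt_of_le_of_ne (down_le.2 he) (Ne.symm hne)
    exact hed (down_le.1 (h _ this))
  · rintro ⟨e, rfl⟩
    refine ⟨⟨Set.Iio e, (E.isConfiguration_Iic e).subset (isLowerSet_Iio e)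
      Set.Iio_subset_Iic_self⟩, lt_of_le_of_ne Set.Iio_subset_Iic_self ?_, ?_⟩
    · intro h
      have : e ∈ Set.Iio e := by
        have h' : Set.Iio e = Set.Iic e := congrArg Subtype.val h
        rw [h']; exact Set.mem_Iic.2 le_rfl
      exact lt_irrefl _ this
    · intro d' hd' x hx
      refine lt_of_le_of_ne (hd'.le hx) ?_
      rintro rfl
      exact hd'.not_ge (down_le.2 hx)

lemma HasUniquePredecessor.map {P Q : Type} [Preorder P] [Preorder Q] (f : P ≃o Q) {x : P}
    (h : HasUniquePredecessor x) : HasUniquePredecessor (f x) := by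
  obtain ⟨d, hd, h⟩ := h
  refine ⟨f d, f.lt_iff_lt.2 hd, fun d' hd' => ?_⟩
  have := h (f.symm d') (by rw [← f.lt_iff_lt]; simpa using hd')
  rw [← f.le_iff_le] at this
  simpa using this

lemma down_injective : Function.Injective E.down := fun _ _ h =>
  le_antisymm (down_le_down.1 h.le) (down_le_down.1 h.ge)

lemma exists_map_down (f : E₁.Domain ≃o E₂.Domain) (e : E₁.Event) :
    ∃ e', f (E₁.down e) = E₂.down e' :=
  (hasUniquePredecessor_iff _).1 (((hasUniquePredecessor_iff _).2 ⟨e, rfl⟩).map f)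

/-- An event structure is determined by its domain. -/
theorem nonempty_iso_of_domain (f : E₁.Domain ≃o E₂.Domain) : Nonempty (Iso E₁ E₂) := by
  choose g hg using exists_map_down f
  choose g' hg' using exists_map_down f.symm
  refine ⟨{ toFun := g, invFun := g', left_inv := fun e => ?_, right_inv := fun e => ?_,
            map_rel_iff' := ?_, map_conflict_iff := ?_ }⟩
  · apply down_injective
    rw [← hg', ← hg, OrderIso.symm_apply_apply]
  · apply down_injective
    rw [← hg, ← hg', OrderIso.apply_symm_apply]
  · intro a b
    change g a ≤ g b ↔ _
    rw [← down_le_down, ← hg, ← hg, f.le_iff_le, down_le_down]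
  · intro a b
    rw [conflict_iff_not_bounded, conflict_iff_not_bounded, ← hg, ← hg, not_iff_not]
    constructor
    · rintro ⟨c, h₁, h₂⟩
      exact ⟨f.symm c, by rwa [← f.le_symm_apply] at h₁, by rwa [← f.le_symm_apply] at h₂⟩
    · rintro ⟨c, h₁, h₂⟩
      exact ⟨f c, f.le_iff_le.2 h₁, f.le_iff_le.2 h₂⟩

namespace Iso

lemma map_le_iff (f : Iso E₁ E₂) {a b : E₁.Event} :
    f.toEquiv a ≤ f.toEquiv b ↔ a ≤ b := f.map_rel_iff'

lemma conflict_iff (f : Iso E₁ E₂) {a b : E₁.Event} :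
    E₂.conflict (f.toEquiv a) (f.toEquiv b) ↔ E₁.conflict a b := f.map_conflict_iff a b

/-- The identity. -/
def refl (E : EventStructure) : Iso E E := ⟨OrderIso.refl _, fun _ _ => Iff.rfl⟩

/-- The inverse isomorphism. -/
def symm (f : Iso E₁ E₂) : Iso E₂ E₁ :=
  ⟨f.toRelIso.symm, fun a b => by
    have := f.map_conflict_iff (f.toEquiv.symm a) (f.toEquiv.symm b)
    change E₂.conflict (f.toEquiv (f.toEquiv.symm a)) (f.toEquiv (f.toEquiv.symm b)) ↔ _ at this
    rw [Equiv.apply_symm_apply, Equiv.apply_symm_apply] at this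
    exact this.symm⟩

/-- Composition of isomorphisms. -/
def trans {E₃ : EventStructure} (f : Iso E₁ E₂) (g : Iso E₂ E₃) : Iso E₁ E₃ :=
  ⟨f.toRelIso.trans g.toRelIso, fun a b =>
    (g.map_conflict_iff (f.toFun a) (f.toFun b)).trans (f.map_conflict_iff a b)⟩

lemma isConfiguration_image (f : Iso E₁ E₂) {c : Set E₁.Event} (hc : E₁.IsConfiguration c) :
    E₂.IsConfiguration (f.toEquiv '' c) := by
  refine ⟨hc.1.image _, ?_, ?_⟩
  · rintro _ ⟨a, ha, rfl⟩ _ ⟨b, hb, rfl⟩ h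
    exact hc.2.1 a ha b hb (f.conflict_iff.1 h)
  · rintro _ b hb ⟨a, ha, rfl⟩
    refine ⟨f.toEquiv.symm b, hc.2.2 ?_ ha, f.toEquiv.apply_symm_apply b⟩
    rw [← f.map_le_iff, f.toEquiv.apply_symm_apply]
    exact hb

/-- An isomorphism of event structures induces one of the domains. -/
def domain (f : Iso E₁ E₂) : E₁.Domain ≃o E₂.Domain where
  toFun c := ⟨f.toEquiv '' c.1, f.isConfiguration_image c.2⟩
  invFun c := ⟨f.symm.toEquiv '' c.1, f.symm.isConfiguration_image c.2⟩
  left_inv c := Subtype.ext (f.toEquiv.symm_image_image c.1)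
  right_inv c := Subtype.ext (f.toEquiv.image_symm_image c.1)
  map_rel_iff' := Set.image_subset_image_iff f.toEquiv.injective

end Iso

lemma HasDomain.of_iso {P : Type} [LE P] (h : E₁.HasDomain P) (f : Iso E₁ E₂) :
    E₂.HasDomain P :=
  h.map fun g => f.domain.symm.trans g

/-- The part of the configuration `c'` that lies in the residual of `c`. -/
def restrictResidual {c : E.Domain} (c' : Set.Ici c) : (E.residual c).Domain :=
  ⟨{e | e.1 ∈ c'.1.1}, (c'.1.2.1.preimage Subtype.val_injective.injOn),
    fun a ha b hb => c'.1.2.2.1 a.1 ha b.1 hb, fun _ _ h ha => c'.1.2.2.2 h ha⟩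

/-- The domain of a residual is a principal filter of the domain. -/
def residualDomain (E : EventStructure) (c : E.Domain) : Set.Ici c ≃o (E.residual c).Domain where
  toFun := restrictResidual
  invFun d := ⟨⟨c.1 ∪ Subtype.val '' d.1, by
      refine ⟨c.2.1.union (d.2.1.image _), ?_, ?_⟩
      · rintro a (ha | ⟨a, ha, rfl⟩) b (hb | ⟨b, hb, rfl⟩)
        · exact c.2.2.1 a ha b hb
        · exact fun h => b.2.2 ⟨a, ha, h⟩
        · exact fun h => a.2.2 ⟨b, hb, E.conflict_symm _ _ h⟩
        · exact d.2.2.1 a ha b hb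
      · rintro a b hb (ha | ⟨a, ha, rfl⟩)
        · exact Or.inl (c.2.2.2 hb ha)
        · by_cases hbc : b ∈ c.1
          · exact Or.inl hbc
          · refine Or.inr ⟨⟨b, hbc, ?_⟩, (show IsLowerSet d.1 from d.2.2.2) (a := a) hb ha, rfl⟩
            rintro ⟨e₀, he₀, h⟩
            exact a.2.2 ⟨e₀, he₀, E.conflict_inherit _ _ _ h hb⟩⟩, Set.subset_union_left⟩
  left_inv c' := by
    apply Subtype.ext
    apply Subtype.ext
    ext e
    constructor
    · rintro (h | ⟨e, h, rfl⟩)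
      · exact c'.2 h
      · exact h
    · intro h
      by_cases he : e ∈ c.1
      · exact Or.inl he
      · exact Or.inr ⟨⟨e, he, fun ⟨e₀, h₀, h'⟩ => c'.1.2.2.1 _ (c'.2 h₀) _ h h'⟩, h, rfl⟩
  right_inv d := by
    apply Subtype.ext
    ext e
    constructor
    · rintro (h | ⟨e', h, h'⟩)
      · exact absurd h e.2.1
      · rwa [← Subtype.ext h']
    · exact fun h => Or.inr ⟨e, h, rfl⟩
  map_rel_iff' := by
    intro c₁ c₂
    constructor
    · intro h e he
      by_cases hec : e ∈ c.1
      · exact c₂.2 hec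
      · exact h (a := ⟨e, hec, fun ⟨e₀, h₀, h'⟩ => c₁.1.2.2.1 _ (c₁.2 h₀) _ he h'⟩) he
    · exact fun h e he => h he

/-! ### Labelings -/

/-- `y` is obtained from `x` by adding one event, and that event is labeled `a`. -/
def LStep (E : EventStructure) {A : Type} (lab : E.Event → A) (x y : E.Domain) (a : A) : Prop :=
  ∃ e, e ∉ x.1 ∧ y.1 = insert e x.1 ∧ lab e = a

/-- The filters of two configurations are isomorphic as ordered sets with labeled covers. -/
def FilterEquiv (E : EventStructure) {A : Type} (lab : E.Event → A) (c c' : E.Domain) : Prop :=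
  ∃ F : Set.Ici c ≃o Set.Ici c', ∀ x y a, E.LStep lab x.1 y.1 a → E.LStep lab (F x).1 (F y).1 a

/-- `FilterEquiv` is the form that the final contradiction consumes; for nets it will come directly
from markings, without residuals. -/
lemma LabeledFutureEquiv.filterEquiv {A : Type} {lab : E.Event → A} {c c' : E.Domain}
    (h : E.LabeledFutureEquiv lab c c') : E.FilterEquiv lab c c' := by
  obtain ⟨f, hf⟩ := h
  let F := ((E.residualDomain c).trans f.domain).trans (E.residualDomain c').symm
  have hF : ∀ x : Set.Ici c, (F x).1.1 =
      c'.1 ∪ Subtype.val '' (f.toEquiv '' {e | e.1 ∈ x.1.1}) := fun x => rfl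
  refine ⟨F, ?_⟩
  rintro x y a ⟨e, hex, hy, rfl⟩
  have hey : e ∈ y.1.1 := by rw [hy]; exact Set.mem_insert _ _
  have hec : e ∉ c.1 := fun h => hex (x.2 h)
  let e₁ : (E.residual c).Event :=
    ⟨e, hec, fun ⟨e₀, h₀, h'⟩ => y.1.2.2.1 _ (y.2 h₀) _ hey h'⟩
  refine ⟨(f.toEquiv e₁).1, ?_, ?_, hf e₁⟩
  · rw [hF]
    rintro (h | ⟨_, ⟨e₂, h, rfl⟩, h'⟩)
    · exact (f.toEquiv e₁).2.1 h
    · have := f.toEquiv.injective (Subtype.ext h')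
      exact hex (by rw [this] at h; exact h)
  · rw [hF, hF]
    have : {e : (E.residual c).Event | e.1 ∈ y.1.1} =
        insert e₁ {e : (E.residual c).Event | e.1 ∈ x.1.1} := by
      ext e'
      simp only [Set.mem_ofPred_eq, hy, Set.mem_insert_iff]
      exact or_congr ⟨fun h => Subtype.ext h, fun h => by rw [h]⟩ Iff.rfl
    rw [this]
    ext z
    constructor
    · rintro (h | ⟨_, ⟨d, rfl | hd, rfl⟩, rfl⟩)
      · exact Or.inr (Or.inl h)
      · exact Or.inl rfl
      · exact Or.inr (Or.inr ⟨_, ⟨d, hd, rfl⟩, rfl⟩)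
    · rintro (rfl | h | ⟨_, ⟨d, hd, rfl⟩, rfl⟩)
      · exact Or.inr ⟨_, ⟨_, Or.inl rfl, rfl⟩, rfl⟩
      · exact Or.inl h
      · exact Or.inr ⟨_, ⟨d, Or.inr hd, rfl⟩, rfl⟩

lemma labeledFutureEquiv_equivalence {A : Type} (lab : E.Event → A) :
    Equivalence (E.LabeledFutureEquiv lab) where
  refl c := ⟨Iso.refl _, fun _ => rfl⟩
  symm := by
    rintro c c' ⟨f, hf⟩
    refine ⟨f.symm, fun e => ?_⟩
    have h := hf (f.toEquiv.symm e)
    change lab (f.toEquiv (f.toEquiv.symm e)).1 = _ at h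
    rw [Equiv.apply_symm_apply] at h
    exact h.symm
  trans := by
    rintro c c' c'' ⟨f, hf⟩ ⟨g, hg⟩
    exact ⟨f.trans g, fun e => (hg (f.toFun e)).trans (hf e)⟩

/-- A minimal event of `y \ x` has all its strict predecessors in `x`. -/
lemma exists_mem_enabled_of_lt {x y : E.Domain} (h : x < y) :
    ∃ e, e ∈ E.enabled x.1 ∧ e ∈ y.1 := by
  obtain ⟨e, ⟨he, hex⟩, hmin⟩ := (y.2.1.sdiff (t := x.1)).exists_minimal
    (Set.nonempty_of_ssubset (show x.1 ⊂ y.1 from h))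
  refine ⟨e, ⟨hex, y.2.subset ?_ (Set.insert_subset he h.le)⟩, he⟩
  rintro a b hba (rfl | ha)
  · by_cases hb : b ∈ x.1
    · exact Or.inr hb
    · exact Or.inl (le_antisymm hba (hmin ⟨y.2.2.2 hba he, hb⟩ hba))
  · exact Or.inr (x.2.2.2 hba ha)

lemma exists_insert_of_covBy {x y : E.Domain} (h : x ⋖ y) : ∃ e, e ∉ x.1 ∧ y.1 = insert e x.1 := by
  obtain ⟨e, ⟨hex, hc⟩, he⟩ := exists_mem_enabled_of_lt h.lt
  refine ⟨e, hex, ?_⟩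
  have hlt : x < (⟨_, hc⟩ : E.Domain) := lt_of_le_of_ne (Set.subset_insert _ _)
    fun h => hex (by rw [congrArg Subtype.val h]; exact Set.mem_insert _ _)
  have hle : (⟨_, hc⟩ : E.Domain) ≤ y := Set.insert_subset he h.le
  by_contra hne
  exact h.2 hlt (lt_of_le_of_ne hle fun h => hne (congrArg Subtype.val h).symm)

/-- Strict predecessors of an event enabled at `c` lie in `c`, hence are compatible with any other
event enabled at `c`. So a conflict between co-initial events is minimal, and (1) applies. Without
conflict, equal labels would be dependent, and (3) would make the events comparable, which
enabledness at one configuration excludes. -/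
lemma IsTraceLabeling.isNice {A : Type} {I : A → A → Prop} {lab : E.Event → A}
    (h : E.IsTraceLabeling I lab) (hI : ∀ a, ¬ I a a) : E.IsNice lab := by
  rintro e e' hne ⟨c, he, he'⟩
  have hlow : ∀ {e e' a}, e ∈ E.enabled c.1 → e' ∈ E.enabled c.1 → a ≤ e → a ≠ e →
      ¬ E.conflict a e' := fun {e e' a} he he' hae hne => by
    have : a ∈ c.1 := (he.2.2.2 hae (Set.mem_insert _ _)).resolve_left hne
    exact he'.2.2.1 _ (Or.inr this) _ (Or.inl rfl)
  by_cases hc : E.conflict e e'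
  · exact h.1 e e' ⟨hc, fun ⟨a, h₁, h₂, h₃⟩ => h₃.elim
      (fun h => hlow he he' h.1 h₁ h.2) (fun h => hlow he' he h.1 h₂ h.2)⟩
  · intro hlab
    rcases h.2.2 e e' (by rw [hlab]; exact hI _) with h' | h' | h'
    · exact he.1 ((he'.2.2.2 h' (Set.mem_insert _ _)).resolve_left hne)
    · exact he'.1 ((he.2.2.2 h' (Set.mem_insert _ _)).resolve_left hne.symm)
    · exact hc h'

/-! ### Event structures of ordered sets -/

/-- The event structure of an ordered set `P` with a set `J` of distinguished elements: the events
are the distinguished elements, and two events are in conflict if they have no upper bound. -/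
abbrev ofPoset (P : Type) [PartialOrder P] (J : P → Prop) (hfin : ∀ x : P, (Set.Iic x).Finite) :
    EventStructure where
  Event := {x : P // J x}
  conflict e e' := ¬ ∃ z, e.1 ≤ z ∧ e'.1 ≤ z
  conflict_irrefl e h := h ⟨e.1, le_rfl, le_rfl⟩
  conflict_symm _ _ h := fun ⟨z, h₁, h₂⟩ => h ⟨z, h₂, h₁⟩
  finite_down e := ((hfin e.1).preimage Subtype.val_injective.injOn).subset (fun _ h => h)
  conflict_inherit _ _ e h h' := fun ⟨z, h₁, h₂⟩ => h ⟨z, h₁, le_trans (b := e.1) h' h₂⟩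

/-- If configurations can be represented by elements of a poset, step by step, then the domain is
the poset. -/
theorem domain_orderIso_of_representation {P : Type} [PartialOrder P] (b : P) (hb : ∀ x, b ≤ x)
    (J : P → Prop) (hfin : ∀ x : P, (Set.Iic x).Finite) (hJb : ¬ J b)
    (hJ : ∀ x y, (∀ e, J e → e ≤ x → e ≤ y) → x ≤ y)
    (hstep : ∀ x e, J e → (∀ d, J d → d < e → d ≤ x) →
      (∀ d, J d → d ≤ x → ∃ z, d ≤ z ∧ e ≤ z) → ∃ y, ∀ d, J d → (d ≤ y ↔ d ≤ x ∨ d = e)) :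
    ∃ f : P ≃o (ofPoset P J hfin).Domain, ∀ x e, e ∈ (f x).1 ↔ e.1 ≤ x := by
  have hconf : ∀ x : P, (ofPoset P J hfin).IsConfiguration {e | e.1 ≤ x} := fun x =>
    ⟨(hfin x).preimage Subtype.val_injective.injOn, fun a ha b hb h => h ⟨x, ha, hb⟩,
      fun a b h ha => le_trans (show b.1 ≤ a.1 from h) ha⟩
  let g : P ↪o (ofPoset P J hfin).Domain := OrderEmbedding.ofMapLEIff
    (fun x => ⟨{e | e.1 ≤ x}, hconf x⟩)
    (fun x y => ⟨fun h => hJ x y fun e he hx => h (a := ⟨e, he⟩) hx, fun h e he => le_trans he h⟩)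
  -- Induction on the number of events: a maximal event is removed, the rest is represented by some
  -- `x`, and `hstep` puts the event back.
  have hsurj : ∀ (n : ℕ) (c : (ofPoset P J hfin).Domain), c.1.ncard = n → ∃ x, g x = c := by
    intro n
    induction n with
    | zero =>
      intro c hc
      refine ⟨b, Subtype.ext ?_⟩
      rw [(Set.ncard_eq_zero c.2.1).1 hc]
      refine Set.eq_empty_of_forall_notMem fun e he => hJb ?_
      rw [le_antisymm (hb e.1) he]; exact e.2
    | succ n ih =>
      intro c hc
      have hne : c.1.Nonempty := by
        rw [Set.nonempty_iff_ne_empty]; rintro h; rw [h, Set.ncard_empty] at hc; omega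
      obtain ⟨e, hmax⟩ := c.2.1.exists_maximal hne
      have hlow : IsLowerSet (c.1 \ {e}) := by
        rintro a d hda ⟨ha, hae⟩
        refine ⟨c.2.2.2 hda ha, ?_⟩
        rintro rfl
        exact hae (le_antisymm (hmax.2 ha hda) hda)
      obtain ⟨x, hx⟩ := ih ⟨c.1 \ {e}, c.2.subset hlow Set.sdiff_subset⟩ (by
        have := Set.ncard_sdiff_singleton_add_one hmax.1 c.2.1
        simp only; omega)
      have hx' : ∀ d, d.1 ≤ x ↔ d ∈ c.1 ∧ d ≠ e := fun d =>
        (Set.ext_iff.1 (congrArg Subtype.val hx) d)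
      obtain ⟨y, hy⟩ := hstep x e.1 e.2
        (fun d hd hde => (hx' ⟨d, hd⟩).2 ⟨(show IsLowerSet c.1 from c.2.2.2) (a := e) hde.le hmax.1,
          fun h => hde.ne (congrArg Subtype.val h)⟩)
        (fun d hd hdx => by
          by_contra h
          exact c.2.2.1 _ ((hx' ⟨d, hd⟩).1 hdx).1 _ hmax.1 h)
      refine ⟨y, Subtype.ext (Set.ext fun d => ?_)⟩
      change d.1 ≤ y ↔ _
      rw [hy d.1 d.2, hx', ← Subtype.ext_iff]
      by_cases hd : d = e
      · simp [hd, hmax.1]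
      · simp [hd]
  exact ⟨RelIso.ofSurjective g fun c => hsurj _ c rfl, fun x e => Iff.rfl⟩

end EventStructure

namespace DirectedSquareComplex

variable {K L : DirectedSquareComplex}

/-! ### Paths and homotopies -/

@[simp] lemma Step.start_rev (s : K.Step) : Step.start (Step.rev s) = Step.finish s := by
  rcases s with ⟨e, _ | _⟩ <;> rfl

@[simp] lemma Step.finish_rev (s : K.Step) : Step.finish (Step.rev s) = Step.start s := by
  rcases s with ⟨e, _ | _⟩ <;> rfl

@[simp] lemma Step.rev_rev (s : K.Step) : Step.rev (Step.rev s) = s := by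
  rcases s with ⟨e, _ | _⟩ <;> rfl

@[simp] lemma isPath_nil {u v : K.V} : K.IsPath u [] v ↔ u = v := Iff.rfl

@[simp] lemma isPath_cons {u v : K.V} {s : K.Step} {l : List K.Step} :
    K.IsPath u (s :: l) v ↔ Step.start s = u ∧ K.IsPath (Step.finish s) l v := Iff.rfl

lemma isPath_append {l l' : List K.Step} {u w : K.V} :
    K.IsPath u (l ++ l') w ↔ ∃ v, K.IsPath u l v ∧ K.IsPath v l' w := by
  induction l generalizing u with
  | nil => simp
  | cons s l ih => simp [ih, and_assoc]

lemma IsPath.append {l l' : List K.Step} {u v w : K.V} (h : K.IsPath u l v)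
    (h' : K.IsPath v l' w) : K.IsPath u (l ++ l') w :=
  isPath_append.2 ⟨v, h, h'⟩

lemma IsPath.unique {l : List K.Step} {u v v' : K.V} (h : K.IsPath u l v)
    (h' : K.IsPath u l v') : v = v' := by
  induction l generalizing u with
  | nil => exact h.symm.trans h'
  | cons s l ih => exact ih h.2 h'.2

/-- The reversed path. -/
def revPath (l : List K.Step) : List K.Step := (l.map Step.rev).reverse

lemma IsPath.rev {l : List K.Step} {u v : K.V} (h : K.IsPath u l v) :
    K.IsPath v (revPath l) u := by
  induction l generalizing u with
  | nil => exact h.symm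
  | cons s l ih =>
    rw [revPath, List.map_cons, List.reverse_cons]
    exact (ih h.2).append ⟨Step.start_rev s, (Step.finish_rev s).trans h.1⟩

lemma Move.append {l l' : List K.Step} (h : K.Move l l') (a b : List K.Step) :
    K.Move (a ++ l ++ b) (a ++ l' ++ b) := by
  rcases h with ⟨l₁, l₂, s, rfl, rfl⟩ | ⟨l₁, l₂, q, rfl, rfl⟩
  · exact Or.inl ⟨a ++ l₁, l₂ ++ b, s, by simp, by simp⟩
  · exact Or.inr ⟨a ++ l₁, l₂ ++ b, q, by simp, by simp⟩

namespace Homotopic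

lemma refl (u v : K.V) (l : List K.Step) : K.Homotopic u v l l := Relation.EqvGen.refl _

lemma symm {u v : K.V} {l l' : List K.Step} (h : K.Homotopic u v l l') : K.Homotopic u v l' l :=
  Relation.EqvGen.symm _ _ h

lemma trans {u v : K.V} {l l' l'' : List K.Step} (h : K.Homotopic u v l l')
    (h' : K.Homotopic u v l' l'') : K.Homotopic u v l l'' :=
  Relation.EqvGen.trans _ _ _ h h'

lemma isPath_iff {u v : K.V} {l l' : List K.Step} (h : K.Homotopic u v l l') :
    K.IsPath u l v ↔ K.IsPath u l' v := by
  induction h with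
  | rel x y h => exact ⟨fun _ => h.2.1, fun _ => h.1⟩
  | refl x => exact Iff.rfl
  | symm x y _ ih => exact ih.symm
  | trans x y z _ _ ih₁ ih₂ => exact ih₁.trans ih₂

lemma append {u v w z : K.V} {a l l' b : List K.Step} (ha : K.IsPath u a v)
    (h : K.Homotopic v w l l') (hb : K.IsPath w b z) :
    K.Homotopic u z (a ++ l ++ b) (a ++ l' ++ b) := by
  induction h with
  | rel x y h =>
    exact Relation.EqvGen.rel _ _ ⟨(ha.append h.1).append hb, (ha.append h.2.1).append hb,
      h.2.2.append a b⟩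
  | refl x => exact refl _ _ _
  | symm x y _ ih => exact ih.symm
  | trans x y z _ _ ih₁ ih₂ => exact ih₁.trans ih₂

lemma append_left {u v w : K.V} {a l l' : List K.Step} (ha : K.IsPath u a v)
    (h : K.Homotopic v w l l') : K.Homotopic u w (a ++ l) (a ++ l') := by
  simpa using h.append ha (b := []) (z := w) rfl

lemma append_right {v w z : K.V} {l l' b : List K.Step}
    (h : K.Homotopic v w l l') (hb : K.IsPath w b z) : K.Homotopic v z (l ++ b) (l' ++ b) := by
  simpa using h.append (a := []) (u := v) rfl hb

lemma append_rev {u v : K.V} {l : List K.Step} (h : K.IsPath u l v) :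
    K.Homotopic u u (l ++ revPath l) [] := by
  induction l generalizing u with
  | nil => exact refl _ _ _
  | cons s l ih =>
    have hs : K.IsPath u [s] (Step.finish s) := ⟨h.1, rfl⟩
    have hs' : K.IsPath (Step.finish s) [Step.rev s] u :=
      ⟨Step.start_rev s, (Step.finish_rev s).trans h.1⟩
    have h₁ := (ih h.2).append hs hs'
    have h₂ : K.Homotopic u u ([s] ++ [] ++ [Step.rev s]) [] :=
      Relation.EqvGen.rel _ _ ⟨hs.append hs', rfl, Or.inl ⟨[], [], s, rfl, rfl⟩⟩
    have := h₁.trans h₂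
    simpa [revPath] using this

lemma rev_append {u v : K.V} {l : List K.Step} (h : K.IsPath u l v) :
    K.Homotopic v v (revPath l ++ l) [] := by
  have := append_rev h.rev
  have hl : revPath (revPath l) = l := by
    simp [revPath, List.map_reverse, Function.comp_def]
  rwa [hl] at this

lemma of_append_rev {u v : K.V} {l l' : List K.Step} (h : K.IsPath u l v) (h' : K.IsPath u l' v)
    (hh : K.Homotopic u u (l ++ revPath l') []) : K.Homotopic u v l l' := by
  have h₁ := (rev_append h').append_left h
  have h₂ := hh.append_right h'
  rw [List.append_nil] at h₁
  rw [List.append_assoc, List.nil_append] at h₂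
  exact h₁.symm.trans h₂

/-- Left cancellation in the path groupoid. That `l` is closed follows because homotopies preserve
being a path from `u` to `v`. -/
lemma of_append_eq {u v w : K.V} {a l : List K.Step} (ha : K.IsPath u a v)
    (hl : K.IsPath v l w) (h : K.Homotopic u v (a ++ l) a) : K.Homotopic v w l [] := by
  have hw : v = w := by
    have hal := h.isPath_iff.2 ha
    obtain ⟨v', h₁, h₂⟩ := isPath_append.1 hal
    rw [← h₁.unique ha] at hl
    exact h₂.unique hl
  subst hw
  have h₁ := h.append_left ha.rev
  have h₂ := (rev_append ha).append_right hl
  rw [List.append_assoc, List.nil_append] at h₂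
  exact h₂.symm.trans (h₁.trans (rev_append ha))

end Homotopic

/-! ### Lifting along coverings -/

namespace Hom

variable (p : Hom K L)

/-- The image of a step. -/
def mapStep (s : K.Step) : L.Step := (p.onE s.1, s.2)

@[simp] lemma start_mapStep (s : K.Step) : Step.start (p.mapStep s) = p.onV (Step.start s) := by
  rcases s with ⟨e, _ | _⟩
  · exact (p.map_tgt e).symm
  · exact (p.map_src e).symm

@[simp] lemma finish_mapStep (s : K.Step) :
    Step.finish (p.mapStep s) = p.onV (Step.finish s) := by
  rcases s with ⟨e, _ | _⟩
  · exact (p.map_src e).symm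
  · exact (p.map_tgt e).symm

lemma mapStep_rev (s : K.Step) : p.mapStep (Step.rev s) = Step.rev (p.mapStep s) := rfl

variable {p}

lemma isPath_map {u v : K.V} {l : List K.Step} (h : K.IsPath u l v) :
    L.IsPath (p.onV u) (l.map p.mapStep) (p.onV v) := by
  induction l generalizing u with
  | nil => exact congrArg p.onV h
  | cons s l ih => exact ⟨by simp [h.1], by simpa using ih h.2⟩

lemma move_map {l l' : List K.Step} (h : K.Move l l') :
    L.Move (l.map p.mapStep) (l'.map p.mapStep) := by
  rcases h with ⟨l₁, l₂, s, rfl, rfl⟩ | ⟨l₁, l₂, q, rfl, rfl⟩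
  · exact Or.inl ⟨l₁.map p.mapStep, l₂.map p.mapStep, p.mapStep s, by simp [mapStep_rev], by simp⟩
  · exact Or.inr ⟨l₁.map p.mapStep, l₂.map p.mapStep, p.onQ q,
      by simp [mapStep, p.map_bot, p.map_right], by simp [mapStep, p.map_left, p.map_top]⟩

lemma homotopic_map {u v : K.V} {l l' : List K.Step} (h : K.Homotopic u v l l') :
    L.Homotopic (p.onV u) (p.onV v) (l.map p.mapStep) (l'.map p.mapStep) := by
  induction h with
  | rel x y h => exact Relation.EqvGen.rel _ _ ⟨isPath_map h.1, isPath_map h.2.1, move_map h.2.2⟩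
  | refl x => exact Homotopic.refl _ _ _
  | symm x y _ ih => exact ih.symm
  | trans x y z _ _ ih₁ ih₂ => exact ih₁.trans ih₂

namespace IsCovering

variable (hp : p.IsCovering)
include hp

lemma existsUnique_step (v : K.V) (s : L.Step) (h : Step.start s = p.onV v) :
    ∃! s' : K.Step, Step.start s' = v ∧ p.mapStep s' = s := by
  rcases s with ⟨e, _ | _⟩
  · obtain ⟨e', ⟨h₁, h₂⟩, h₃⟩ := hp.lift_in v e h
    refine ⟨(e', false), ⟨h₁, by simp [mapStep, h₂]⟩, ?_⟩
    rintro ⟨e'', _ | _⟩ ⟨h₄, h₅⟩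
    · rw [h₃ e'' ⟨h₄, congrArg Prod.fst h₅⟩]
    · exact absurd (congrArg Prod.snd h₅) (by simp [mapStep])
  · obtain ⟨e', ⟨h₁, h₂⟩, h₃⟩ := hp.lift_out v e h
    refine ⟨(e', true), ⟨h₁, by simp [mapStep, h₂]⟩, ?_⟩
    rintro ⟨e'', _ | _⟩ ⟨h₄, h₅⟩
    · exact absurd (congrArg Prod.snd h₅) (by simp [mapStep])
    · rw [h₃ e'' ⟨h₄, congrArg Prod.fst h₅⟩]

lemma step_ext {s t : K.Step} (h : Step.start s = Step.start t)
    (h' : p.mapStep s = p.mapStep t) : s = t :=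
  (hp.existsUnique_step (Step.start t) (p.mapStep t) (by simp)).unique ⟨h, h'⟩ ⟨rfl, rfl⟩

lemma exists_lift {u : K.V} {l : List L.Step} {w : L.V} (h : L.IsPath (p.onV u) l w) :
    ∃ l' u', K.IsPath u l' u' ∧ l'.map p.mapStep = l ∧ p.onV u' = w := by
  induction l generalizing u with
  | nil => exact ⟨[], u, rfl, rfl, h⟩
  | cons s l ih =>
    obtain ⟨s', ⟨h₁, rfl⟩, -⟩ := hp.existsUnique_step u s h.1
    obtain ⟨l', u', h₂, rfl, h₃⟩ := ih (u := Step.finish s') (by simpa using h.2)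
    exact ⟨s' :: l', u', ⟨h₁, h₂⟩, rfl, h₃⟩

lemma lift_unique {u v v' : K.V} {l l' : List K.Step} (h : K.IsPath u l v)
    (h' : K.IsPath u l' v') (hl : l.map p.mapStep = l'.map p.mapStep) : l = l' := by
  induction l generalizing u l' with
  | nil => simpa using hl.symm
  | cons s l ih =>
    cases l' with
    | nil => simp at hl
    | cons s' l' =>
      rw [List.map_cons, List.map_cons, List.cons.injEq] at hl
      obtain rfl : s = s' := hp.step_ext (h.1.trans h'.1.symm) hl.1
      rw [ih h.2 h'.2 hl.2]

/-- The square is lifted at its bottom left corner; unique lifting of edges then identifies its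
sides with `e₁` and `e₂`. -/
lemma exists_square_of_bot_right {e₁ e₂ : K.E} {q : L.Q} (h : K.tgt e₁ = K.src e₂)
    (h₁ : p.onE e₁ = L.bot q) (h₂ : p.onE e₂ = L.right q) :
    ∃ q', p.onQ q' = q ∧ K.bot q' = e₁ ∧ K.right q' = e₂ := by
  obtain ⟨q', ⟨h₃, rfl⟩, -⟩ := hp.lift_corner_bot_left (K.src e₁) q (by rw [← h₁, p.map_src])
  have hb : K.bot q' = e₁ := (hp.lift_out (K.src e₁) (p.onE e₁) (p.map_src _).symm).unique
    ⟨h₃, by rw [p.map_bot, h₁]⟩ ⟨rfl, rfl⟩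
  refine ⟨q', rfl, hb, ?_⟩
  exact (hp.lift_out (K.src e₂) (p.onE e₂) (p.map_src _).symm).unique
    ⟨by rw [← h, ← hb, K.tgt_bot], by rw [p.map_right, h₂]⟩ ⟨rfl, rfl⟩

lemma exists_square_of_left_top {e₁ e₂ : K.E} {q : L.Q} (h : K.tgt e₁ = K.src e₂)
    (h₁ : p.onE e₁ = L.left q) (h₂ : p.onE e₂ = L.top q) :
    ∃ q', p.onQ q' = q ∧ K.left q' = e₁ ∧ K.top q' = e₂ := by
  obtain ⟨q', ⟨h₃, rfl⟩, -⟩ := hp.lift_corner_bot_left (K.src e₁) q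
    (by rw [L.src_bot, ← h₁, p.map_src])
  have hb : K.left q' = e₁ := (hp.lift_out (K.src e₁) (p.onE e₁) (p.map_src _).symm).unique
    ⟨by rw [← K.src_bot, h₃], by rw [p.map_left, h₁]⟩ ⟨rfl, rfl⟩
  refine ⟨q', rfl, hb, ?_⟩
  exact (hp.lift_out (K.src e₂) (p.onE e₂) (p.map_src _).symm).unique
    ⟨by rw [← h, ← hb, K.tgt_left], by rw [p.map_top, h₂]⟩ ⟨rfl, rfl⟩

lemma exists_lift_move {u v : K.V} {l : List K.Step} {m : List L.Step} (h : K.IsPath u l v)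
    (hm : L.Move (l.map p.mapStep) m) :
    ∃ l', K.IsPath u l' v ∧ l'.map p.mapStep = m ∧ K.Move l l' := by
  rcases hm with ⟨m₁, m₂, s, h₁, rfl⟩ | ⟨m₁, m₂, q, h₁, rfl⟩
  · obtain ⟨l₁, l₂, rfl, rfl, h₂⟩ := List.map_eq_append_iff.1 h₁
    obtain ⟨s', l₃, rfl, rfl, h₃⟩ := List.map_eq_cons_iff.1 h₂
    obtain ⟨t, l₄, rfl, h₄, rfl⟩ := List.map_eq_cons_iff.1 h₃
    obtain ⟨x, hx₁, hx₂, hx₃, hx₄⟩ := isPath_append.1 h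
    obtain rfl : t = Step.rev s' := hp.step_ext (by rw [hx₃, Step.start_rev]) h₄
    rw [Step.finish_rev, hx₂] at hx₄
    exact ⟨l₁ ++ l₄, hx₁.append hx₄, by simp, Or.inl ⟨l₁, l₄, s', rfl, rfl⟩⟩
  · obtain ⟨l₁, l₂, rfl, rfl, h₂⟩ := List.map_eq_append_iff.1 h₁
    obtain ⟨⟨e, b⟩, l₃, rfl, h₃, h₄⟩ := List.map_eq_cons_iff.1 h₂
    obtain ⟨⟨e', b'⟩, l₄, rfl, h₅, rfl⟩ := List.map_eq_cons_iff.1 h₄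
    obtain ⟨rfl, rfl⟩ : b = true ∧ b' = true := ⟨congrArg Prod.snd h₃, congrArg Prod.snd h₅⟩
    obtain ⟨x, hx₁, hx₂, hx₃, hx₄⟩ := isPath_append.1 h
    obtain ⟨q', rfl, rfl, rfl⟩ := hp.exists_square_of_bot_right hx₃.symm
      (congrArg Prod.fst h₃) (congrArg Prod.fst h₅)
    refine ⟨l₁ ++ (K.left q', true) :: (K.top q', true) :: l₄,
      hx₁.append ⟨?_, ?_, ?_⟩, by simp [mapStep, p.map_left, p.map_top],
      Or.inr ⟨l₁, l₄, q', rfl, rfl⟩⟩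
    · exact (K.src_bot q').symm.trans hx₂
    · exact (K.tgt_left q').symm
    · change K.IsPath (K.tgt (K.top q')) l₄ v
      rw [K.tgt_top]
      exact hx₄

/-- Unlike for the forward move, `m` has to be assumed a path: an inserted backtrack is arbitrary,
and can be lifted only if it starts below the current vertex. -/
lemma exists_lift_move_symm {u v : K.V} {l : List K.Step} {m : List L.Step} {w : L.V}
    (h : K.IsPath u l v) (hmw : L.IsPath (p.onV u) m w) (hm : L.Move m (l.map p.mapStep)) :
    ∃ l', K.IsPath u l' v ∧ l'.map p.mapStep = m ∧ K.Move l' l := by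
  rcases hm with ⟨m₁, m₂, s, rfl, h₁⟩ | ⟨m₁, m₂, q, rfl, h₁⟩
  · obtain ⟨l₁, l₂, rfl, rfl, rfl⟩ := List.map_eq_append_iff.1 h₁
    obtain ⟨x, hx₁, hx₂⟩ := isPath_append.1 h
    obtain ⟨y, hy₁, hy₂⟩ := isPath_append.1 hmw
    obtain rfl := hy₁.unique (isPath_map hx₁)
    obtain ⟨s', ⟨hs₁, rfl⟩, -⟩ := hp.existsUnique_step x s hy₂.1
    refine ⟨l₁ ++ s' :: Step.rev s' :: l₂, hx₁.append ⟨hs₁, by simp, ?_⟩, by simp [mapStep_rev],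
      Or.inl ⟨l₁, l₂, s', rfl, rfl⟩⟩
    rwa [Step.finish_rev, hs₁]
  · obtain ⟨l₁, l₂, rfl, rfl, h₂⟩ := List.map_eq_append_iff.1 h₁
    obtain ⟨⟨e, b⟩, l₃, rfl, h₃, h₄⟩ := List.map_eq_cons_iff.1 h₂
    obtain ⟨⟨e', b'⟩, l₄, rfl, h₅, rfl⟩ := List.map_eq_cons_iff.1 h₄
    obtain ⟨rfl, rfl⟩ : b = true ∧ b' = true := ⟨congrArg Prod.snd h₃, congrArg Prod.snd h₅⟩
    obtain ⟨x, hx₁, hx₂, hx₃, hx₄⟩ := isPath_append.1 h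
    obtain ⟨q', rfl, rfl, rfl⟩ := hp.exists_square_of_left_top hx₃.symm
      (congrArg Prod.fst h₃) (congrArg Prod.fst h₅)
    refine ⟨l₁ ++ (K.bot q', true) :: (K.right q', true) :: l₄,
      hx₁.append ⟨?_, ?_, ?_⟩, by simp [mapStep, p.map_bot, p.map_right],
      Or.inr ⟨l₁, l₄, q', rfl, rfl⟩⟩
    · exact (K.src_bot q').trans hx₂
    · exact (K.tgt_bot q').symm
    · change K.IsPath (K.tgt (K.right q')) l₄ v
      rw [← K.tgt_top]
      exact hx₄

/-- Homotopies lift. -/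
lemma exists_lift_homotopic {u v : K.V} {l : List K.Step} {m : List L.Step} {w : L.V}
    (h : K.IsPath u l v) (hm : L.Homotopic (p.onV u) w (l.map p.mapStep) m) :
    ∃ l', K.IsPath u l' v ∧ l'.map p.mapStep = m ∧ K.Homotopic u v l l' := by
  -- Both directions are carried through the induction together, so that the symmetric case just
  -- exchanges them.
  have key : ∀ m₁ m₂, L.Homotopic (p.onV u) w m₁ m₂ → ∀ v,
      (∀ l, K.IsPath u l v → l.map p.mapStep = m₁ →
        ∃ l', K.IsPath u l' v ∧ l'.map p.mapStep = m₂ ∧ K.Homotopic u v l l') ∧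
      (∀ l, K.IsPath u l v → l.map p.mapStep = m₂ →
        ∃ l', K.IsPath u l' v ∧ l'.map p.mapStep = m₁ ∧ K.Homotopic u v l l') := by
    intro m₁ m₂ hm v
    induction hm with
    | rel x y hxy =>
      constructor
      · rintro l hl rfl
        obtain ⟨l', h₁, h₂, h₃⟩ := hp.exists_lift_move hl hxy.2.2
        exact ⟨l', h₁, h₂, Relation.EqvGen.rel _ _ ⟨hl, h₁, h₃⟩⟩
      · rintro l hl rfl
        obtain ⟨l', h₁, h₂, h₃⟩ := hp.exists_lift_move_symm hl hxy.1 hxy.2.2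
        exact ⟨l', h₁, h₂, Homotopic.symm (Relation.EqvGen.rel _ _ ⟨h₁, hl, h₃⟩)⟩
    | refl x => exact ⟨fun l h h' => ⟨l, h, h', Homotopic.refl _ _ _⟩,
        fun l h h' => ⟨l, h, h', Homotopic.refl _ _ _⟩⟩
    | symm x y _ ih => exact ih.symm
    | trans x y z _ _ ih₁ ih₂ =>
      constructor
      · intro l hl hx
        obtain ⟨l₁, h₁, h₂, h₃⟩ := ih₁.1 l hl hx
        obtain ⟨l₂, h₄, h₅, h₆⟩ := ih₂.1 l₁ h₁ h₂
        exact ⟨l₂, h₄, h₅, h₃.trans h₆⟩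
      · intro l hl hx
        obtain ⟨l₁, h₁, h₂, h₃⟩ := ih₂.2 l hl hx
        obtain ⟨l₂, h₄, h₅, h₆⟩ := ih₁.2 l₁ h₁ h₂
        exact ⟨l₂, h₄, h₅, h₃.trans h₆⟩
  exact (key _ _ hm v).1 l h rfl

end IsCovering

/-! ### Directed paths in universal covers -/

end Hom

/-- A list of edges as a directed path. -/
def directed (l : List K.E) : List K.Step := l.map fun e => (e, true)

@[simp] lemma directed_nil : directed ([] : List K.E) = [] := rfl

@[simp] lemma directed_cons (e : K.E) (l : List K.E) :
    directed (e :: l) = (e, true) :: directed l := rfl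

@[simp] lemma directed_append (l l' : List K.E) :
    directed (l ++ l') = directed l ++ directed l' := List.map_append

lemma reach_iff {u v : K.V} : K.Reach u v ↔ ∃ l, K.IsPath u (directed l) v := by
  constructor
  · intro h
    induction h with
    | refl => exact ⟨[], rfl⟩
    | tail _ h ih =>
      obtain ⟨l, hl⟩ := ih
      obtain ⟨e, rfl, rfl⟩ := h
      exact ⟨l ++ [e], by rw [directed_append]; exact hl.append ⟨rfl, rfl⟩⟩
  · rintro ⟨l, hl⟩
    induction l generalizing u with
    | nil => rw [show u = v from hl]; exact Relation.ReflTransGen.refl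
    | cons e l ih => exact Relation.ReflTransGen.head ⟨e, hl.1, rfl⟩ (ih hl.2)

namespace Hom

variable {p : Hom K L}

lemma map_directed (l : List K.E) : (directed l).map p.mapStep = directed (l.map p.onE) := by
  simp [directed, mapStep, Function.comp_def]

lemma exists_directed_of_map_eq {l : List K.Step} {m : List L.E}
    (h : l.map p.mapStep = directed m) : ∃ m', l = directed m' ∧ m'.map p.onE = m := by
  refine ⟨l.map Prod.fst, ?_, ?_⟩
  · refine (List.map_id l).symm.trans ?_
    rw [directed, List.map_map]
    refine List.map_congr_left fun s hs => ?_
    have : p.mapStep s ∈ directed m := h ▸ List.mem_map_of_mem hs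
    obtain ⟨e, -, he⟩ := List.mem_map.1 this
    exact Prod.ext rfl (congrArg Prod.snd he).symm
  · have := congrArg (List.map Prod.fst) h
    simpa [directed, mapStep, Function.comp_def] using this

/-- `p.LiftEnd u l v`: the lift from `u` of the directed path `l` ends at `v`. -/
def LiftEnd (p : Hom K L) (u : K.V) (l : List L.E) (v : K.V) : Prop :=
  ∃ l', K.IsPath u (directed l') v ∧ l'.map p.onE = l

lemma LiftEnd.isPath {u v : K.V} {l : List L.E} (h : p.LiftEnd u l v) :
    L.IsPath (p.onV u) (directed l) (p.onV v) := by
  obtain ⟨l', h, rfl⟩ := h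
  rw [← map_directed]
  exact isPath_map h

lemma LiftEnd.reach {u v : K.V} {l : List L.E} (h : p.LiftEnd u l v) : K.Reach u v :=
  reach_iff.2 ⟨_, h.choose_spec.1⟩

lemma exists_liftEnd_of_reach (p : Hom K L) {u v : K.V} (h : K.Reach u v) :
    ∃ l, p.LiftEnd u l v :=
  let ⟨l, hl⟩ := reach_iff.1 h
  ⟨_, l, hl, rfl⟩

lemma LiftEnd.append {u v w : K.V} {l l' : List L.E} (h : p.LiftEnd u l v)
    (h' : p.LiftEnd v l' w) : p.LiftEnd u (l ++ l') w := by
  obtain ⟨m, h, rfl⟩ := h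
  obtain ⟨m', h', rfl⟩ := h'
  exact ⟨m ++ m', by rw [directed_append]; exact h.append h', by simp⟩

lemma LiftEnd.of_append {u w : K.V} {l l' : List L.E} (h : p.LiftEnd u (l ++ l') w) :
    ∃ v, p.LiftEnd u l v ∧ p.LiftEnd v l' w := by
  obtain ⟨m, h, hm⟩ := h
  obtain ⟨m₁, m₂, rfl, rfl, rfl⟩ := List.map_eq_append_iff.1 hm
  rw [directed_append] at h
  obtain ⟨v, h₁, h₂⟩ := isPath_append.1 h
  exact ⟨v, ⟨_, h₁, rfl⟩, ⟨_, h₂, rfl⟩⟩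

namespace IsCovering

variable (hp : p.IsCovering)
include hp

lemma exists_liftEnd {u : K.V} {l : List L.E} {w : L.V} (h : L.IsPath (p.onV u) (directed l) w) :
    ∃ v, p.LiftEnd u l v := by
  obtain ⟨l', v, h₁, h₂, -⟩ := hp.exists_lift h
  obtain ⟨m, rfl, h₃⟩ := exists_directed_of_map_eq h₂
  exact ⟨v, m, h₁, h₃⟩

lemma liftEnd_unique {u v v' : K.V} {l : List L.E} (h : p.LiftEnd u l v)
    (h' : p.LiftEnd u l v') : v = v' := by
  obtain ⟨m, h₁, rfl⟩ := h
  obtain ⟨m', h₂, h₃⟩ := h'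
  have := hp.lift_unique h₁ h₂ (by rw [map_directed, map_directed, h₃])
  rw [this] at h₁
  exact h₁.unique h₂

lemma liftEnd_of_homotopic {u v : K.V} {l l' : List L.E} {w : L.V} (h : p.LiftEnd u l v)
    (hh : L.Homotopic (p.onV u) w (directed l) (directed l')) : p.LiftEnd u l' v := by
  obtain ⟨m, h, rfl⟩ := h
  rw [← map_directed] at hh
  obtain ⟨m', h₁, h₂, -⟩ := hp.exists_lift_homotopic h hh
  obtain ⟨m'', rfl, h₃⟩ := exists_directed_of_map_eq h₂
  exact ⟨m'', h₁, h₃⟩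

end IsCovering

/-- The two lifts form a closed path, which is null-homotopic upstairs; the homotopy is projected.
-/
lemma IsUniversalCover.homotopic_of_liftEnd (hp : p.IsUniversalCover) {u v : K.V}
    {l l' : List L.E} (h : p.LiftEnd u l v) (h' : p.LiftEnd u l' v) :
    L.Homotopic (p.onV u) (p.onV v) (directed l) (directed l') := by
  obtain ⟨m, h, rfl⟩ := h
  obtain ⟨m', h', rfl⟩ := h'
  rw [← map_directed, ← map_directed]
  exact homotopic_map (.of_append_rev h h' (hp.2.2.2 _ _ (h.append h'.rev)))

end Hom

/-- Two ordered sets parametrized by the same words with the same identifications: directed paths in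
the case of covers, firable words in the case of nets. -/
lemma exists_orderIso_of_surjective {S P P' : Type} [LE P] [LE P'] (f : S → P) (g : S → P')
    (hf : Function.Surjective f) (hg : Function.Surjective g)
    (heq : ∀ a b, f a = f b ↔ g a = g b) (hle : ∀ a b, f a ≤ f b ↔ g a ≤ g b) :
    ∃ F : P ≃o P', ∀ a, F (f a) = g a := by
  choose f' hf' using hf
  choose g' hg' using hg
  have h₁ : ∀ a, g (f' (f a)) = g a := fun a => (heq _ _).1 (hf' (f a))
  have h₂ : ∀ a, f (g' (g a)) = f a := fun a => (heq _ _).2 (hg' (g a))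
  refine ⟨{ toFun := fun x => g (f' x), invFun := fun y => f (g' y)
            left_inv := fun x => (h₂ _).trans (hf' x), right_inv := fun y => (h₁ _).trans (hg' y)
            map_rel_iff' := ?_ }, h₁⟩
  intro x y
  change g (f' x) ≤ g (f' y) ↔ _
  rw [← hle, hf', hf']

lemma nonempty_orderIso_of_surjective {S P P' : Type} [LE P] [LE P'] (f : S → P) (g : S → P')
    (hf : Function.Surjective f) (hg : Function.Surjective g)
    (heq : ∀ a b, f a = f b ↔ g a = g b) (hle : ∀ a b, f a ≤ f b ↔ g a ≤ g b) :
    Nonempty (P ≃o P') :=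
  (exists_orderIso_of_surjective f g hf hg heq hle).nonempty

lemma Reach.refl (u : K.V) : K.Reach u u := Relation.ReflTransGen.refl

/-- Directed paths that start at `x`. -/
abbrev DirectedPath (L : DirectedSquareComplex) (x : L.V) : Type :=
  {l : List L.E // ∃ w, L.IsPath x (directed l) w}

namespace Hom.IsUniversalCover

variable {p : Hom K L}

/-- Principal filters of a universal cover are parametrized by directed paths of the base, up to
homotopy. -/
lemma exists_parametrization (hp : p.IsUniversalCover) (x : L.V) {u : K.V} (hu : p.onV u = x) :
    ∃ f : L.DirectedPath x → K.PrincipalFilter u, Function.Surjective f ∧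
      (∀ a b, f a = f b ↔ ∃ w, L.IsPath x (directed a.1) w ∧
        L.Homotopic x w (directed a.1) (directed b.1)) ∧
      ∀ a b, f a ≤ f b ↔ ∃ c, f b = f c ∧ ∃ k, c.1 = a.1 ++ k := by
  have ex : ∀ l : L.DirectedPath x, ∃ v, p.LiftEnd u l.1 v := fun l =>
    let ⟨_, h⟩ := l.2
    hp.1.exists_liftEnd (by rw [hu]; exact h)
  choose f hf using ex
  refine ⟨fun a => ⟨f a, (hf a).reach⟩, ?_, fun a b => Subtype.ext_iff.trans ⟨?_, ?_⟩,
    fun a b => ⟨?_, ?_⟩⟩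
  · rintro ⟨y, hy⟩
    obtain ⟨l, hl⟩ := p.exists_liftEnd_of_reach hy
    have h₁ := hl.isPath
    rw [hu] at h₁
    exact ⟨⟨l, _, h₁⟩, Subtype.ext (hp.1.liftEnd_unique (hf ⟨l, _, h₁⟩) hl)⟩
  · intro hab
    have h₁ := hp.homotopic_of_liftEnd (hf a) (by rw [show f a = f b from hab]; exact hf b)
    have h₂ := (hf a).isPath
    rw [hu] at h₁ h₂
    exact ⟨_, h₂, h₁⟩
  · rintro ⟨w, -, h⟩
    exact hp.1.liftEnd_unique (hp.1.liftEnd_of_homotopic (hf a) (by rw [hu]; exact h)) (hf b)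
  · intro hr
    obtain ⟨k, hk⟩ := p.exists_liftEnd_of_reach (show K.Reach (f a) (f b) from hr)
    have h₁ := (hf a).append hk
    have h₂ := h₁.isPath
    rw [hu] at h₂
    exact ⟨⟨a.1 ++ k, _, h₂⟩, Subtype.ext (hp.1.liftEnd_unique h₁ (hf ⟨a.1 ++ k, _, h₂⟩)), k, rfl⟩
  · rintro ⟨c, hc, k, hk⟩
    have h₁ := hf c
    rw [hk] at h₁
    obtain ⟨y, h₂, h₃⟩ := h₁.of_append
    change K.Reach (f a) (f b)
    rw [show f b = f c from congrArg Subtype.val hc, hp.1.liftEnd_unique (hf a) h₂]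
    exact h₃.reach

/-- The principal filter of a vertex of a universal cover depends only on the image of the
vertex. -/
theorem nonempty_filter_orderIso (hp : p.IsUniversalCover) {u u' : K.V}
    (h : p.onV u = p.onV u') : Nonempty (K.PrincipalFilter u ≃o K.PrincipalFilter u') := by
  -- Equality and order of the parametrized vertices are expressed by paths of the base alone, so
  -- both filters are the same quotient.
  obtain ⟨f, hf₁, hf₂, hf₃⟩ := hp.exists_parametrization _ h
  obtain ⟨g, hg₁, hg₂, hg₃⟩ := hp.exists_parametrization _ (rfl : p.onV u' = _)
  exact nonempty_orderIso_of_surjective f g hf₁ hg₁ (fun a b => (hf₂ a b).trans (hg₂ a b).symm)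
    fun a b => by rw [hf₃, hg₃]; simp only [hf₂, hg₂]

end Hom.IsUniversalCover

end DirectedSquareComplex

namespace DirectedSquareComplex

variable {L : DirectedSquareComplex}

/-! ### Existence of universal covers -/

/-- Paths with a given starting point. -/
abbrev PathFrom (L : DirectedSquareComplex) (x : L.V) : Type :=
  {l : List L.Step // ∃ w, L.IsPath x l w}

/-- The endpoint of a path. -/
def endpoint (x : L.V) : List L.Step → L.V
  | [] => x
  | s :: l => endpoint (Step.finish s) l

lemma IsPath.endpoint_eq {x w : L.V} {l : List L.Step} (h : L.IsPath x l w) :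
    endpoint x l = w := by
  induction l generalizing x with
  | nil => exact h
  | cons s l ih => exact ih h.2

lemma PathFrom.isPath {x : L.V} (l : L.PathFrom x) : L.IsPath x l.1 (endpoint x l.1) := by
  obtain ⟨w, hw⟩ := l.2
  rwa [hw.endpoint_eq]

/-- Homotopy of paths relative to their endpoints. -/
def pathSetoid (L : DirectedSquareComplex) (x : L.V) : Setoid (L.PathFrom x) where
  r l l' := L.Homotopic x (endpoint x l.1) l.1 l'.1
  iseqv :=
    { refl := fun l => Homotopic.refl _ _ _
      symm := fun {l l'} h => by
        rw [(h.isPath_iff.1 l.isPath).endpoint_eq]; exact h.symm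
      trans := fun {l l' l''} h h' => by
        rw [(h.isPath_iff.1 l.isPath).endpoint_eq] at h'; exact h.trans h' }

/-- Homotopy classes of paths. -/
abbrev PathClass (L : DirectedSquareComplex) (x : L.V) : Type := Quotient (L.pathSetoid x)

namespace PathClass

variable {x : L.V}

/-- The class of a path. -/
def mk (l : List L.Step) (h : ∃ w, L.IsPath x l w) : L.PathClass x := Quotient.mk _ ⟨l, h⟩

lemma ind {P : L.PathClass x → Prop} (h : ∀ l hl, P (mk l hl)) (γ : L.PathClass x) : P γ :=
  Quotient.ind (fun l => h l.1 l.2) γ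

lemma mk_eq_mk {l l' : List L.Step} {w : L.V} (h : L.IsPath x l w) (h' : ∃ w, L.IsPath x l' w) :
    mk l ⟨w, h⟩ = mk l' h' ↔ L.Homotopic x w l l' := by
  refine Quotient.eq.trans ?_
  change L.Homotopic x (endpoint x l) l l' ↔ _
  rw [h.endpoint_eq]

/-- The endpoint of a class. -/
def proj (γ : L.PathClass x) : L.V :=
  Quotient.lift (s := L.pathSetoid x) (fun l : L.PathFrom x => endpoint x l.1)
    (fun l l' h => (Homotopic.isPath_iff
      (show L.Homotopic x (endpoint x l.1) l.1 l'.1 from h) |>.1 l.isPath).endpoint_eq.symm) γ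

lemma proj_mk {l : List L.Step} {w : L.V} (h : L.IsPath x l w) : proj (mk l ⟨w, h⟩) = w :=
  h.endpoint_eq

open Classical in
/-- Extension of a class by a step (if the step starts at the endpoint). -/
noncomputable def extend (γ : L.PathClass x) (s : L.Step) : L.PathClass x :=
  Quotient.map (sa := L.pathSetoid x) (sb := L.pathSetoid x)
    (fun l : L.PathFrom x => if h : endpoint x l.1 = Step.start s then
      ⟨l.1 ++ [s], Step.finish s, l.isPath.append ⟨h.symm, rfl⟩⟩ else l)
    (fun l l' (h : L.Homotopic x (endpoint x l.1) l.1 l'.1) => by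
      have he := (h.isPath_iff.1 l.isPath).endpoint_eq
      by_cases hs : endpoint x l.1 = Step.start s
      · simp only [dif_pos hs, dif_pos (he.trans hs)]
        have hp := l.isPath.append (l' := [s]) ⟨hs.symm, rfl⟩
        change L.Homotopic x (endpoint x (l.1 ++ [s])) (l.1 ++ [s]) (l'.1 ++ [s])
        rw [hp.endpoint_eq]
        exact h.append_right ⟨hs.symm, rfl⟩
      · simp only [dif_neg hs, dif_neg (fun h => hs (he.symm.trans h))]
        exact h) γ

lemma extend_mk {l : List L.Step} {s : L.Step} (h : L.IsPath x l (Step.start s)) :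
    extend (mk l ⟨_, h⟩) s = mk (l ++ [s]) ⟨_, h.append ⟨rfl, rfl⟩⟩ := by
  refine congrArg (Quotient.mk _) ?_
  simp only [dif_pos h.endpoint_eq]

variable {γ : L.PathClass x}

lemma exists_mk (γ : L.PathClass x) : ∃ l, ∃ h : L.IsPath x l (proj γ), γ = mk l ⟨_, h⟩ := by
  induction γ using ind with
  | h l hl =>
    obtain ⟨w, h⟩ := hl
    have h' := h
    rw [← proj_mk h] at h'
    exact ⟨l, h', rfl⟩

lemma proj_extend {s : L.Step} (h : Step.start s = proj γ) : proj (extend γ s) = Step.finish s := by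
  obtain ⟨l, hl, hγ⟩ := exists_mk γ
  rw [← h] at hl
  rw [hγ, extend_mk hl]
  have h₁ : L.IsPath x (l ++ [s]) (Step.finish s) := hl.append ⟨rfl, rfl⟩
  exact proj_mk h₁

lemma extend_rev {s : L.Step} (h : Step.start s = proj γ) :
    extend (extend γ s) (Step.rev s) = γ := by
  obtain ⟨l, hl, hγ⟩ := exists_mk γ
  rw [← h] at hl
  have h₁ : L.IsPath x (l ++ [s]) (Step.start (Step.rev s)) :=
    hl.append ⟨rfl, (Step.start_rev s).symm⟩
  rw [hγ, extend_mk hl, extend_mk h₁]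
  have h₂ : L.IsPath x ((l ++ [s]) ++ [Step.rev s]) (Step.start s) :=
    h₁.append ⟨rfl, Step.finish_rev s⟩
  exact (mk_eq_mk h₂ _).2 (Relation.EqvGen.rel _ _ ⟨h₂, hl, Or.inl ⟨l, [], s, by simp, by simp⟩⟩)

/-- One elementary homotopy; it makes the squares of `pathCover` close up. -/
lemma extend_square {q : L.Q} (h : L.src (L.bot q) = proj γ) :
    extend (extend γ (L.left q, true)) (L.top q, true) =
      extend (extend γ (L.bot q, true)) (L.right q, true) := by
  obtain ⟨l, hl, hγ⟩ := exists_mk γ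
  rw [← h] at hl
  have hl' := hl
  rw [L.src_bot] at hl'
  have h₁ : L.IsPath x (l ++ [(L.bot q, true)]) (L.src (L.right q)) :=
    hl.append ⟨rfl, L.tgt_bot q⟩
  have h₂ : L.IsPath x (l ++ [(L.left q, true)]) (L.src (L.top q)) :=
    hl'.append ⟨rfl, L.tgt_left q⟩
  rw [hγ, extend_mk (s := (L.bot q, true)) hl, extend_mk (s := (L.left q, true)) hl',
    extend_mk (s := (L.right q, true)) h₁, extend_mk (s := (L.top q, true)) h₂]
  have h₃ : L.IsPath x ((l ++ [(L.bot q, true)]) ++ [(L.right q, true)]) (L.tgt (L.right q)) :=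
    h₁.append ⟨rfl, rfl⟩
  have h₄ : L.IsPath x ((l ++ [(L.left q, true)]) ++ [(L.top q, true)]) (L.tgt (L.right q)) :=
    h₂.append ⟨rfl, L.tgt_top q⟩
  exact ((mk_eq_mk h₃ _).2 (Relation.EqvGen.rel _ _
    ⟨h₃, h₄, Or.inr ⟨l, [], q, by simp, by simp⟩⟩)).symm

end PathClass

open PathClass

/-- The universal cover, built from homotopy classes of paths. -/
noncomputable def pathCover (L : DirectedSquareComplex) (x : L.V) : DirectedSquareComplex where
  V := L.PathClass x
  E := {e : L.PathClass x × L.E // L.src e.2 = proj e.1}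
  Q := {q : L.PathClass x × L.Q // L.src (L.bot q.2) = proj q.1}
  src e := e.1.1
  tgt e := extend e.1.1 (e.1.2, true)
  bot q := ⟨(q.1.1, L.bot q.1.2), q.2⟩
  left q := ⟨(q.1.1, L.left q.1.2), (L.src_bot _).symm.trans q.2⟩
  right q := ⟨(extend q.1.1 (L.bot q.1.2, true), L.right q.1.2),
    (L.tgt_bot _).symm.trans (proj_extend (s := (L.bot q.1.2, true)) q.2).symm⟩
  top q := ⟨(extend q.1.1 (L.left q.1.2, true), L.top q.1.2),
    (L.tgt_left _).symm.trans
      (proj_extend (s := (L.left q.1.2, true)) ((L.src_bot _).symm.trans q.2)).symm⟩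
  src_bot _ := rfl
  tgt_bot _ := rfl
  tgt_left _ := rfl
  tgt_top q := extend_square q.2

/-- The projection of the universal cover. -/
noncomputable def pathCoverHom (L : DirectedSquareComplex) (x : L.V) : Hom (L.pathCover x) L where
  onV := proj
  onE e := e.1.2
  onQ q := q.1.2
  map_src e := e.2.symm
  map_tgt e := proj_extend (s := (e.1.2, true)) e.2
  map_bot _ := rfl
  map_right _ := rfl
  map_top _ := rfl
  map_left _ := rfl

variable {x : L.V}

lemma eq_extend_rev {γ v : L.PathClass x} {e : L.E} (h : L.src e = proj γ)
    (hv : extend γ (e, true) = v) : γ = extend v (e, false) := by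
  rw [← hv]; exact (extend_rev (s := (e, true)) h).symm

lemma extend_extend_rev {v : L.PathClass x} {e : L.E} (h : L.tgt e = proj v) :
    extend (extend v (e, false)) (e, true) = v :=
  extend_rev (s := (e, false)) h

lemma src_eq_proj_extend_rev {v : L.PathClass x} {e : L.E} (h : L.tgt e = proj v) :
    L.src e = proj (extend v (e, false)) :=
  (proj_extend (s := (e, false)) h).symm

/-- Cells of `pathCover` store the class at their source or bottom left corner. A cell with another
prescribed corner is found, and shown to be unique, by walking back from that corner with
`extend_rev`. -/
lemma pathCoverHom_isCovering (hx : ∀ w, ∃ l, L.IsPath x l w) :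
    (L.pathCoverHom x).IsCovering where
  surjective w := by
    obtain ⟨l, hl⟩ := hx w
    exact ⟨PathClass.mk l ⟨w, hl⟩, proj_mk hl⟩
  lift_out v e h := by
    refine ⟨⟨(v, e), h⟩, ⟨rfl, rfl⟩, ?_⟩
    rintro ⟨⟨γ, e'⟩, h'⟩ ⟨rfl, rfl⟩
    rfl
  lift_in v e h := by
    refine ⟨⟨(extend v (e, false), e), src_eq_proj_extend_rev h⟩,
      ⟨extend_extend_rev h, rfl⟩, ?_⟩
    rintro ⟨⟨γ, e'⟩, h'⟩ ⟨h₁, rfl⟩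
    exact Subtype.ext (Prod.ext (eq_extend_rev h' h₁) rfl)
  lift_corner_bot_left v q h := by
    refine ⟨⟨(v, q), h⟩, ⟨rfl, rfl⟩, ?_⟩
    rintro ⟨⟨γ, e'⟩, h'⟩ ⟨rfl, rfl⟩
    rfl
  lift_corner_bot_right v q h := by
    refine ⟨⟨(extend v (L.bot q, false), q), src_eq_proj_extend_rev h⟩,
      ⟨extend_extend_rev h, rfl⟩, ?_⟩
    rintro ⟨⟨γ, e'⟩, h'⟩ ⟨h₁, rfl⟩
    exact Subtype.ext (Prod.ext (eq_extend_rev h' h₁) rfl)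
  lift_corner_top_left v q h := by
    have h : L.tgt (L.left q) = proj v := (L.tgt_left q).trans h
    refine ⟨⟨(extend v (L.left q, false), q), (L.src_bot q).trans (src_eq_proj_extend_rev h)⟩,
      ⟨extend_extend_rev h, rfl⟩, ?_⟩
    rintro ⟨⟨γ, e'⟩, h'⟩ ⟨h₁, rfl⟩
    exact Subtype.ext (Prod.ext (eq_extend_rev ((L.src_bot _).symm.trans h') h₁) rfl)
  lift_corner_top_right v q h := by
    have h₁ : L.tgt (L.left q) = proj (extend v (L.top q, false)) :=
      (L.tgt_left q).trans (src_eq_proj_extend_rev h)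
    refine ⟨⟨(extend (extend v (L.top q, false)) (L.left q, false), q),
      (L.src_bot q).trans (src_eq_proj_extend_rev h₁)⟩, ⟨?_, rfl⟩, ?_⟩
    · change extend (extend (extend (extend v _) _) (L.left q, true)) (L.top q, true) = v
      rw [extend_extend_rev h₁, extend_extend_rev h]
    · rintro ⟨⟨γ, q'⟩, h'⟩ ⟨h₂, rfl⟩
      have h₃ : L.src (L.left q') = proj γ := (L.src_bot _).symm.trans h'
      have h₄ : extend γ (L.left q', true) = extend v (L.top q', false) :=
        eq_extend_rev ((L.tgt_left q').symm.trans
          (proj_extend (s := (L.left q', true)) h₃).symm) h₂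
      exact Subtype.ext (Prod.ext (eq_extend_rev h₃ h₄) rfl)

lemma pathCover_step (s : (L.pathCover x).Step) :
    Step.start ((L.pathCoverHom x).mapStep s) = proj (Step.start s) ∧
      Step.finish s = extend (Step.start s) ((L.pathCoverHom x).mapStep s) := by
  refine ⟨(L.pathCoverHom x).start_mapStep s, ?_⟩
  rcases s with ⟨e, _ | _⟩
  · exact (extend_rev (s := (e.1.2, true)) e.2).symm
  · rfl

/-- Endpoints upstairs are read off as homotopy classes downstairs. Both connectedness and simple
connectedness rest on this. -/
lemma pathCover_isPath {l : List (L.pathCover x).Step} {u v : (L.pathCover x).V}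
    (h : (L.pathCover x).IsPath u l v) {m : List L.Step} {w : L.V} (hm : L.IsPath x m w)
    (hu : u = PathClass.mk m ⟨w, hm⟩) :
    ∃ w' h, v = PathClass.mk (m ++ l.map (L.pathCoverHom x).mapStep) ⟨w', h⟩ := by
  induction l generalizing u m w with
  | nil =>
    obtain rfl : u = v := h
    exact ⟨w, by simpa using hm, by simpa using hu⟩
  | cons s l ih =>
    obtain ⟨rfl, h⟩ := h
    obtain ⟨h₁, h₂⟩ := pathCover_step s
    rw [hu, proj_mk hm] at h₁
    obtain rfl := h₁
    rw [hu, extend_mk hm] at h₂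
    have hms : L.IsPath x (m ++ [(L.pathCoverHom x).mapStep s])
        (Step.finish ((L.pathCoverHom x).mapStep s)) := hm.append ⟨rfl, rfl⟩
    obtain ⟨w', h', hv⟩ := ih h hms h₂
    refine ⟨w', by simpa using h', hv.trans ?_⟩
    congr 1
    simp

/-- Connected square complexes have universal covers. -/
theorem exists_isUniversalCover (hx : ∀ w, ∃ l, L.IsPath x l w) :
    ∃ (U : DirectedSquareComplex) (p : Hom U L), p.IsUniversalCover := by
  have hp := pathCoverHom_isCovering hx
  let b : (L.pathCover x).V := PathClass.mk [] ⟨x, rfl⟩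
  have hconn : ∀ v, ∃ l, (L.pathCover x).IsPath b l v := by
    intro v
    obtain ⟨l, hl, hv⟩ := exists_mk (x := x) v
    obtain ⟨l', v', h₁, rfl, -⟩ := hp.exists_lift (u := b) hl
    obtain ⟨w, h, rfl⟩ := pathCover_isPath h₁ (m := []) (w := x) rfl rfl
    exact ⟨l', by rw [hv]; exact h₁⟩
  refine ⟨L.pathCover x, L.pathCoverHom x, hp, ⟨b⟩, fun u v => ?_, fun u l hl => ?_⟩
  · obtain ⟨l, hl⟩ := hconn u
    obtain ⟨l', hl'⟩ := hconn v
    exact ⟨_, hl.rev.append hl'⟩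
  · obtain ⟨m, hm, hu⟩ := exists_mk (x := x) u
    obtain ⟨w, h, h'⟩ := pathCover_isPath hl hm hu
    have hml := Hom.isPath_map (p := L.pathCoverHom x) hl
    -- That the lift closes up means that `m` followed by the image of `l` is homotopic to `m`;
    -- cancelling `m` gives a null-homotopy downstairs, which lifts.
    have h₁ := (PathClass.mk_eq_mk hm _).1 (hu.symm.trans h')
    obtain ⟨l', h₂, h₃, h₄⟩ := hp.exists_lift_homotopic hl (h₁.symm.of_append_eq hm hml)
    rw [List.map_eq_nil_iff.1 h₃] at h₄
    exact h₄

/-! ### Regularity -/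

variable {K : DirectedSquareComplex} {p : Hom K L}

/-- Principal filters of a principal filter. -/
def filterIci {K : DirectedSquareComplex} {v : K.V} (u : K.PrincipalFilter v) :
    {x : K.PrincipalFilter v // u ≤ x} ≃o K.PrincipalFilter u.1 where
  toFun x := ⟨x.1.1, x.2⟩
  invFun x := ⟨⟨x.1, u.2.trans x.2⟩, x.2⟩
  left_inv _ := rfl
  right_inv _ := rfl
  map_rel_iff' := Iff.rfl

/-- Initial loops at `u` are discarded, so that the chosen edge really leaves `u`. -/
lemma Reach.exists_edge {u v : K.V} (h : K.Reach u v) (hne : u ≠ v) :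
    ∃ e, K.src e = u ∧ K.tgt e ≠ u ∧ K.Reach (K.tgt e) v := by
  induction h using Relation.ReflTransGen.head_induction_on with
  | refl => exact absurd rfl hne
  | @head a c h h' ih =>
    obtain ⟨e, rfl, rfl⟩ := h
    by_cases hc : K.tgt e = K.src e
    · rw [hc] at ih
      exact ih hne
    · exact ⟨e, rfl, hc, h'⟩

end DirectedSquareComplex

namespace EventStructure

open DirectedSquareComplex

/-- An event structure whose domain is a principal filter of a universal cover of a finite complex
is regular. -/
theorem regular_of_universalCover {K L : DirectedSquareComplex} {p : Hom K L}
    (hp : p.IsUniversalCover) [Finite L.V] [Finite L.E] {v : K.V} {E : EventStructure}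
    (hE : E.HasDomain (K.PrincipalFilter v)) : E.Regular := by
  obtain ⟨φ⟩ := hE
  constructor
  -- The domain of a residual is a filter of the domain, and that filter depends only on a vertex of
  -- the finite complex `L`.
  · have hfut : ∀ c c' : E.Domain, p.onV (φ c).1 = p.onV (φ c').1 → E.FutureEquiv c c' := by
      intro c c' h
      obtain ⟨F⟩ := hp.nonempty_filter_orderIso h
      have ici : ∀ c : E.Domain, Nonempty (Set.Ici c ≃o {x : K.PrincipalFilter v // φ c ≤ x}) :=
        fun c => ⟨{ toFun := fun x => ⟨φ x.1, φ.map_rel_iff.2 x.2⟩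
                    invFun := fun x => ⟨φ.symm x.1, by
                      have := x.2
                      rw [← φ.apply_symm_apply x.1] at this
                      exact φ.map_rel_iff.1 this⟩
                    left_inv := fun x => Subtype.ext (φ.symm_apply_apply _)
                    right_inv := fun x => Subtype.ext (φ.apply_symm_apply _)
                    map_rel_iff' := φ.map_rel_iff }⟩
      obtain ⟨f⟩ := ici c
      obtain ⟨f'⟩ := ici c'
      exact nonempty_iso_of_domain
        (((E.residualDomain c).symm.trans (f.trans ((filterIci (φ c)).trans F))).trans
          (((filterIci (φ c')).symm.trans f'.symm).trans (E.residualDomain c')))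
    refine Finite.of_injective (fun q : Quot E.FutureEquiv => p.onV (φ q.out).1) ?_
    intro q q' h
    rw [← q.out_eq, ← q'.out_eq]
    exact Quot.sound (hfut _ _ h)
  · refine ⟨Nat.card L.E, fun c => ?_⟩
    -- The first edge of a directed path from `c` to `c ∪ {e}` already ends at `c ∪ {e}`, since no
    -- configuration lies strictly between.
    have hedge : ∀ e : E.enabled c.1, ∃ d : K.E, K.src d = (φ c).1 ∧
        K.tgt d = (φ ⟨insert e.1 c.1, e.2.2⟩).1 := by
      rintro ⟨e, he, hc⟩
      have hle : c ≤ (⟨insert e c.1, hc⟩ : E.Domain) := Set.subset_insert _ _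
      have hne : c ≠ (⟨insert e c.1, hc⟩ : E.Domain) := fun h =>
        he (by rw [congrArg Subtype.val h]; exact Set.mem_insert _ _)
      obtain ⟨d, h₁, h₂, h₃⟩ := Reach.exists_edge (φ.map_rel_iff.2 hle)
        (fun h => hne (φ.injective (Subtype.ext h)))
      refine ⟨d, h₁, ?_⟩
      have hr : K.Reach (φ c).1 (K.tgt d) := Relation.ReflTransGen.single ⟨d, h₁, rfl⟩
      let z : K.PrincipalFilter v := ⟨K.tgt d, (φ c).2.trans hr⟩
      have hz₁ : c ≤ φ.symm z := φ.map_rel_iff.1 (by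
        rw [φ.apply_symm_apply]; exact hr)
      have hz₂ : φ.symm z ≤ ⟨insert e c.1, hc⟩ := φ.map_rel_iff.1 (by
        rw [φ.apply_symm_apply]; exact h₃)
      have hz₃ : c ≠ φ.symm z := fun h => h₂ (by
        rw [h, φ.apply_symm_apply])
      have hz : φ.symm z = ⟨insert e c.1, hc⟩ := by
        refine le_antisymm hz₂ (Set.insert_subset ?_ hz₁)
        obtain ⟨a, ha, hac⟩ := Set.exists_of_ssubset
          (show c.1 ⊂ (φ.symm z).1 from
            lt_of_le_of_ne hz₁ fun h => hz₃ (Subtype.ext h))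
        exact ((hz₂ ha).resolve_right hac) ▸ ha
      change z.1 = _
      rw [← hz, φ.apply_symm_apply]
    choose f hf₁ hf₂ using hedge
    -- Edges of `K` with a common source are separated by their images in `L`.
    have hinj : Function.Injective fun e => p.onE (f e) := by
      intro e e' h
      have h₁ : f e = f e' := (hp.1.lift_out (φ c).1 (p.onE (f e)) (by
        rw [← p.map_src, hf₁])).unique ⟨hf₁ e, rfl⟩ ⟨hf₁ e', h.symm⟩
      have h₂ := congrArg Subtype.val (φ.injective (Subtype.ext
        ((hf₂ e).symm.trans ((congrArg K.tgt h₁).trans (hf₂ e')))))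
      have h₃ : e.1 ∈ insert e'.1 c.1 := by
        rw [← show insert e.1 c.1 = insert e'.1 c.1 from h₂]; exact Set.mem_insert _ _
      exact Subtype.ext (h₃.resolve_right e.2.1)
    have := Finite.of_injective _ hinj
    rw [← Set.Finite.cast_ncard_eq (Set.toFinite (E.enabled c.1))]
    exact_mod_cast Nat.card_le_card_of_injective _ hinj

end EventStructure

/-! ### Products of rooted trees with tips -/

/-- Rooted trees, as ordered sets with the root as least element. -/
class IsRootedTree (T : Type) [PartialOrder T] [OrderBot T] : Prop where
  finite_Iic : ∀ x : T, (Set.Iic x).Finite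
  chain : ∀ {x y z : T}, x ≤ z → y ≤ z → x ≤ y ∨ y ≤ x

/-- The product of two rooted trees, with a path of length `len p q` attached to `(p, q)`. -/
@[ext] structure TipProduct {T₁ T₂ : Type} (len : T₁ → T₂ → ℕ) where
  fst : T₁
  snd : T₂
  height : ℕ
  height_le : height ≤ len fst snd

namespace TipProduct

variable {T₁ T₂ : Type} [PartialOrder T₁] [PartialOrder T₂] {len : T₁ → T₂ → ℕ}

instance : PartialOrder (TipProduct len) where
  le x y := (x.fst ≤ y.fst ∧ x.snd ≤ y.snd ∧ x.height = 0) ∨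
    (x.fst = y.fst ∧ x.snd = y.snd ∧ x.height ≤ y.height)
  le_refl x := Or.inr ⟨rfl, rfl, le_rfl⟩
  le_trans x y z := by
    rintro (⟨h₁, h₂, h₃⟩ | ⟨h₁, h₂, h₃⟩) (⟨h₄, h₅, h₆⟩ | ⟨h₄, h₅, h₆⟩)
    · exact Or.inl ⟨h₁.trans h₄, h₂.trans h₅, h₃⟩
    · exact Or.inl ⟨h₁.trans h₄.le, h₂.trans h₅.le, h₃⟩
    · exact Or.inl ⟨h₁.le.trans h₄, h₂.le.trans h₅, by omega⟩
    · exact Or.inr ⟨h₁.trans h₄, h₂.trans h₅, h₃.trans h₆⟩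
  le_antisymm x y := by
    rintro (⟨h₁, h₂, h₃⟩ | ⟨h₁, h₂, h₃⟩) (⟨h₄, h₅, h₆⟩ | ⟨h₄, h₅, h₆⟩)
    · exact TipProduct.ext (h₁.antisymm h₄) (h₂.antisymm h₅) (by omega)
    · exact TipProduct.ext h₄.symm h₅.symm (by omega)
    · exact TipProduct.ext h₁ h₂ (by omega)
    · exact TipProduct.ext h₁ h₂ (by omega)

lemma le_def {x y : TipProduct len} : x ≤ y ↔
    (x.fst ≤ y.fst ∧ x.snd ≤ y.snd ∧ x.height = 0) ∨
    (x.fst = y.fst ∧ x.snd = y.snd ∧ x.height ≤ y.height) := Iff.rfl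

/-- A point of the product. -/
def pt (p : T₁) (q : T₂) : TipProduct len := ⟨p, q, 0, Nat.zero_le _⟩

lemma pt_le {p : T₁} {q : T₂} {x : TipProduct len} : pt p q ≤ x ↔ p ≤ x.fst ∧ q ≤ x.snd := by
  rw [le_def]
  exact ⟨fun h => h.elim (fun h => ⟨h.1, h.2.1⟩) fun h => ⟨h.1.le, h.2.1.le⟩,
    fun h => Or.inl ⟨h.1, h.2, rfl⟩⟩

lemma pt_le_pt {p p' : T₁} {q q' : T₂} :
    (pt p q : TipProduct len) ≤ pt p' q' ↔ p ≤ p' ∧ q ≤ q' := pt_le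

omit [PartialOrder T₁] [PartialOrder T₂] in
lemma eq_pt {x : TipProduct len} (h : x.height = 0) : x = pt x.fst x.snd :=
  TipProduct.ext rfl rfl h

lemma fst_le {x y : TipProduct len} (h : x ≤ y) : x.fst ≤ y.fst :=
  h.elim (fun h => h.1) fun h => h.1.le

lemma snd_le {x y : TipProduct len} (h : x ≤ y) : x.snd ≤ y.snd :=
  h.elim (fun h => h.2.1) fun h => h.2.1.le

lemma height_le_of_le {x y : TipProduct len} (h : x ≤ y) : x.height ≤ y.height :=
  h.elim (fun h => by omega) fun h => h.2.2

lemma eq_of_le_of_height_pos {x y : TipProduct len} (h : x ≤ y) (hx : 0 < x.height) :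
    x.fst = y.fst ∧ x.snd = y.snd :=
  h.elim (fun h => by omega) fun h => ⟨h.1, h.2.1⟩

variable [OrderBot T₁] [OrderBot T₂]

/-- The elements that represent events: the points on the axes other than the root, and all
points of tips. -/
def IsEvent (x : TipProduct len) : Prop :=
  0 < x.height ∨ (x.height = 0 ∧ x.fst = ⊥ ∧ x.snd ≠ ⊥) ∨ (x.height = 0 ∧ x.snd = ⊥ ∧ x.fst ≠ ⊥)

lemma isEvent_fst {p : T₁} (h : p ≠ ⊥) : IsEvent (pt p ⊥ : TipProduct len) :=
  Or.inr (Or.inr ⟨rfl, rfl, h⟩)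

lemma isEvent_snd {q : T₂} (h : q ≠ ⊥) : IsEvent (pt ⊥ q : TipProduct len) :=
  Or.inr (Or.inl ⟨rfl, rfl, h⟩)

lemma IsEvent.cases {x : TipProduct len} (h : IsEvent x) :
    0 < x.height ∨ (∃ q, q ≠ ⊥ ∧ x = pt ⊥ q) ∨ ∃ p, p ≠ ⊥ ∧ x = pt p ⊥ := by
  rcases h with h | ⟨h₁, h₂, h₃⟩ | ⟨h₁, h₂, h₃⟩
  · exact Or.inl h
  · exact Or.inr (Or.inl ⟨x.snd, h₃, TipProduct.ext h₂ rfl h₁⟩)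
  · exact Or.inr (Or.inr ⟨x.fst, h₃, TipProduct.ext rfl h₂ h₁⟩)

lemma finite_Iic [IsRootedTree T₁] [IsRootedTree T₂] (x : TipProduct len) :
    (Set.Iic x).Finite := by
  have hinj : Function.Injective (fun y : TipProduct len => (y.fst, y.snd, y.height)) :=
    fun y z h => TipProduct.ext (congrArg (·.1) h) (congrArg (·.2.1) h) (congrArg (·.2.2) h)
  refine Set.Finite.of_finite_image (((IsRootedTree.finite_Iic x.fst).prod
    ((IsRootedTree.finite_Iic x.snd).prod (Set.finite_Iic x.height))).subset ?_) hinj.injOn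
  rintro _ ⟨y, hy, rfl⟩
  exact ⟨fst_le hy, snd_le hy, height_le_of_le hy⟩

/-- A point of the product is bounded by `y` as soon as its two projections to the axes are; a point
of a tip at positive height is itself an event. -/
lemma le_of_forall_isEvent {x y : TipProduct len} (h : ∀ e, IsEvent e → e ≤ x → e ≤ y) :
    x ≤ y := by
  rcases Nat.eq_zero_or_pos x.height with hx | hx
  · rw [eq_pt hx, pt_le]
    constructor
    · by_cases hp : x.fst = ⊥
      · rw [hp]; exact bot_le
      · exact (pt_le.1 (h (pt x.fst ⊥) (isEvent_fst hp) (pt_le.2 ⟨le_rfl, bot_le⟩))).1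
    · by_cases hp : x.snd = ⊥
      · rw [hp]; exact bot_le
      · exact (pt_le.1 (h (pt ⊥ x.snd) (isEvent_snd hp) (pt_le.2 ⟨bot_le, le_rfl⟩))).2
  · exact h x (Or.inl hx) le_rfl

/-- If `e` lies on a tip, its predecessors force `x` onto the same tip below `e`, and `e` itself is
the extension. If `e` lies on an axis, `x` is a point of the product, and the extension replaces the
corresponding coordinate of `x`. -/
lemma exists_representative [IsRootedTree T₁] [IsRootedTree T₂] {x e : TipProduct len}
    (he : IsEvent e) (hlow : ∀ d, IsEvent d → d < e → d ≤ x)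
    (hcomp : ∀ d, IsEvent d → d ≤ x → ∃ z, d ≤ z ∧ e ≤ z) :
    ∃ y, ∀ d, IsEvent d → (d ≤ y ↔ d ≤ x ∨ d = e) := by
  by_cases hex : e ≤ x
  · exact ⟨x, fun d _ => ⟨Or.inl, fun h => h.elim id fun h => h ▸ hex⟩⟩
  have hz : ∃ z, pt x.fst ⊥ ≤ z ∧ e ≤ z := by
    by_cases hp : x.fst = ⊥
    · exact ⟨e, pt_le.2 ⟨hp ▸ bot_le, bot_le⟩, le_rfl⟩
    · exact hcomp _ (isEvent_fst hp) (pt_le.2 ⟨le_rfl, bot_le⟩)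
  have hz' : ∃ z, pt ⊥ x.snd ≤ z ∧ e ≤ z := by
    by_cases hp : x.snd = ⊥
    · exact ⟨e, pt_le.2 ⟨bot_le, hp ▸ bot_le⟩, le_rfl⟩
    · exact hcomp _ (isEvent_snd hp) (pt_le.2 ⟨bot_le, le_rfl⟩)
  obtain ⟨z, hz₁, hz₂⟩ := hz
  obtain ⟨z', hz₁', hz₂'⟩ := hz'
  have hfst := (pt_le.1 hz₁).1
  have hsnd := (pt_le.1 hz₁').2
  -- If `x` were on a tip, it would be an event compatible with `e`; its upper bounds stay over the
  -- same base point, so `e` would already lie below `x`.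
  have hx₀ : e.height = 0 → x.height = 0 := by
    intro he₀
    by_contra hx
    obtain ⟨y, hy₁, hy₂⟩ := hcomp x (Or.inl (by omega)) le_rfl
    obtain ⟨h₁, h₂⟩ := eq_of_le_of_height_pos hy₁ (by omega)
    exact hex (Or.inl ⟨h₁ ▸ fst_le hy₂, h₂ ▸ snd_le hy₂, he₀⟩)
  rcases he.cases with h | ⟨q, hq, rfl⟩ | ⟨p, hp, rfl⟩
  · obtain ⟨h₁, -⟩ := eq_of_le_of_height_pos hz₂ h
    obtain ⟨-, h₂⟩ := eq_of_le_of_height_pos hz₂' h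
    have hlt : ∀ p q, p ≤ e.fst → q ≤ e.snd → pt p q < e := fun p q hp hq =>
      lt_of_le_of_ne (pt_le.2 ⟨hp, hq⟩) fun h' => by
        rw [← h'] at h; exact lt_irrefl _ h
    -- The upper bounds of a tip point have its base coordinates, which bounds those of `x` from
    -- above; the axis events below `e` bound them from below.
    have hfst' : e.fst ≤ x.fst := by
      by_cases hp : e.fst = ⊥
      · rw [hp]; exact bot_le
      · exact (pt_le.1 (hlow (pt e.fst ⊥) (isEvent_fst hp) (hlt _ _ le_rfl bot_le))).1
    have hsnd' : e.snd ≤ x.snd := by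
      by_cases hp : e.snd = ⊥
      · rw [hp]; exact bot_le
      · exact (pt_le.1 (hlow (pt ⊥ e.snd) (isEvent_snd hp) (hlt _ _ bot_le le_rfl))).2
    have hf : x.fst = e.fst := le_antisymm (h₁ ▸ hfst) hfst'
    have hs : x.snd = e.snd := le_antisymm (h₂ ▸ hsnd) hsnd'
    have hh : x.height < e.height := by
      by_contra hh
      exact hex (Or.inr ⟨hf.symm, hs.symm, by omega⟩)
    refine ⟨e, fun d hd => ⟨fun hde => ?_, ?_⟩⟩
    · rcases hde.lt_or_eq with hde | hde
      · exact Or.inl (hlow d hd hde)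
      · exact Or.inr hde
    · rintro (hde | rfl)
      · exact hde.trans (Or.inr ⟨hf, hs, hh.le⟩)
      · exact le_rfl
  -- Compatibility puts `x.snd` and `q` below a common node of the tree, hence they are comparable,
  -- and `q ≤ x.snd` would give `e ≤ x`.
  · have hle : x.snd ≤ q := (IsRootedTree.chain hsnd (snd_le hz₂')).resolve_right fun h' =>
      hex (pt_le.2 ⟨bot_le, h'⟩)
    refine ⟨pt x.fst q, fun d hd => ⟨fun h => ?_, ?_⟩⟩
    · rcases hd.cases with hd' | ⟨q', hq', rfl⟩ | ⟨p', hp', rfl⟩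
      · exact absurd (height_le_of_le h) (by simpa [pt] using hd'.ne')
      · by_cases hqq : q' = q
        · exact Or.inr (by rw [hqq])
        · refine Or.inl (hlow _ hd (lt_of_le_of_ne (pt_le_pt.2 ⟨le_rfl, (pt_le_pt.1 h).2⟩) ?_))
          exact fun h' => hqq (congrArg TipProduct.snd h')
      · exact Or.inl (pt_le.2 ⟨(pt_le_pt.1 h).1, bot_le⟩)
    · rintro (h | rfl)
      · refine h.trans ?_
        rw [eq_pt (hx₀ rfl)]
        exact pt_le_pt.2 ⟨le_rfl, hle⟩
      · exact pt_le_pt.2 ⟨bot_le, le_rfl⟩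
  · have hle : x.fst ≤ p := (IsRootedTree.chain hfst (fst_le hz₂)).resolve_right fun h' =>
      hex (pt_le.2 ⟨h', bot_le⟩)
    refine ⟨pt p x.snd, fun d hd => ⟨fun h => ?_, ?_⟩⟩
    · rcases hd.cases with hd' | ⟨q', hq', rfl⟩ | ⟨p', hp', rfl⟩
      · exact absurd (height_le_of_le h) (by simpa [pt] using hd'.ne')
      · exact Or.inl (pt_le.2 ⟨bot_le, (pt_le_pt.1 h).2⟩)
      · by_cases hpp : p' = p
        · exact Or.inr (by rw [hpp])
        · refine Or.inl (hlow _ hd (lt_of_le_of_ne (pt_le_pt.2 ⟨(pt_le_pt.1 h).1, le_rfl⟩) ?_))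
          exact fun h' => hpp (congrArg TipProduct.fst h')
    · rintro (h | rfl)
      · refine h.trans ?_
        rw [eq_pt (hx₀ rfl)]
        exact pt_le_pt.2 ⟨hle, le_rfl⟩
      · exact pt_le_pt.2 ⟨le_rfl, bot_le⟩

/-- A product of rooted trees with tips is the domain of an event structure. -/
theorem exists_hasDomain (len : T₁ → T₂ → ℕ) [IsRootedTree T₁] [IsRootedTree T₂] :
    ∃ E : EventStructure, E.HasDomain (TipProduct len) := by
  obtain ⟨f, -⟩ := EventStructure.domain_orderIso_of_representation
    (pt ⊥ ⊥ : TipProduct len) (fun x => pt_le.2 ⟨bot_le, bot_le⟩) IsEvent finite_Iic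
    (by rintro (h | ⟨-, -, h⟩ | ⟨-, -, h⟩) <;> simp [pt] at h)
    (fun x y h => le_of_forall_isEvent h) (fun x e he h h' => exists_representative he h h')
  exact ⟨_, ⟨f.symm⟩⟩

end TipProduct

/-! ### Subdivided trees of words -/

/-- Vertices of the subdivided tree of words: a word (with the last letter first), or the midpoint
of the edge from the word `w` to the word `a :: w`. -/
inductive Node (α : Type) : Type
  | full (w : List α)
  | half (a : α) (w : List α)

namespace Node

variable {α : Type}

/-- The list of nonempty nodes below a word. -/
def wordBelow : List α → List (Node α)
  | [] => []
  | a :: w => .full (a :: w) :: .half a w :: wordBelow w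

/-- The list of all nodes below a node, except the root, the largest first. -/
def below : Node α → List (Node α)
  | .full w => wordBelow w
  | .half a w => .half a w :: wordBelow w

lemma below_injective : Function.Injective (below (α := α)) := by
  have h : ∀ p : Node α, p = (p.below.head?).getD (.full []) := by
    rintro (⟨_ | ⟨a, w⟩⟩ | ⟨a, w⟩) <;> rfl
  intro p q hpq
  rw [h p, h q, hpq]

/-- `below p` is the branch from `p` down to the root, so the suffix order on branches is the tree
order; two suffixes of one list are comparable, which is the chain condition. -/
instance : PartialOrder (Node α) where
  le p q := p.below <:+ q.below
  le_refl p := List.suffix_rfl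
  le_trans p q r h h' := h.trans h'
  le_antisymm p q h h' := below_injective (h.eq_of_length (le_antisymm h.length_le h'.length_le))

lemma le_def {p q : Node α} : p ≤ q ↔ p.below <:+ q.below := Iff.rfl

instance : OrderBot (Node α) where
  bot := .full []
  bot_le _ := List.nil_suffix

instance : IsRootedTree (Node α) where
  finite_Iic x := by
    refine Set.Finite.of_finite_image
      ((List.finite_toSet x.below.tails).subset ?_) below_injective.injOn
    rintro _ ⟨y, hy, rfl⟩
    exact List.mem_tails _ _ |>.2 hy
  chain h h' := List.suffix_or_suffix_of_suffix h h'

/-- The edges of the tree. -/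
inductive Child : Node α → Node α → Prop
  | first (a : α) (w : List α) : Child (.full w) (.half a w)
  | second (a : α) (w : List α) : Child (.half a w) (.full (a :: w))

lemma Child.below_eq {p q : Node α} (h : Child p q) : q.below = q :: p.below := by
  cases h <;> rfl

lemma Child.lt {p q : Node α} (h : Child p q) : p < q := by
  refine lt_of_le_of_ne (by rw [le_def, h.below_eq]; exact List.suffix_cons _ _) ?_
  rintro rfl
  simpa using congrArg List.length h.below_eq

lemma Child.le_of_lt {p q r : Node α} (h : Child p q) (hr : r < q) : r ≤ p := by
  have := hr.le
  rw [le_def, h.below_eq, List.suffix_cons_iff] at this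
  refine this.resolve_left fun h' => hr.ne (below_injective ?_)
  rw [h', h.below_eq]

lemma Child.covBy {p q : Node α} (h : Child p q) : p ⋖ q :=
  ⟨h.lt, fun _ h₁ h₂ => (h.le_of_lt h₂).not_gt h₁⟩

lemma eq_bot_or_exists_child (q : Node α) : q = ⊥ ∨ ∃ p, Child p q := by
  rcases q with ⟨_ | ⟨a, w⟩⟩ | ⟨a, w⟩
  · exact Or.inl rfl
  · exact Or.inr ⟨_, .second a w⟩
  · exact Or.inr ⟨_, .first a w⟩

lemma child_induction_from {P : Node α → Prop} (p : Node α) (hb : P p)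
    (hs : ∀ q r, p ≤ q → Child q r → P q → P r) (q : Node α) (hq : p ≤ q) : P q := by
  induction h : q.below.length generalizing q with
  | zero =>
    have := hq.length_le
    obtain rfl : p = q := below_injective (List.IsSuffix.eq_of_length hq (by omega))
    exact hb
  | succ n ih =>
    rcases hq.eq_or_lt with rfl | hlt
    · exact hb
    · rcases q.eq_bot_or_exists_child with rfl | ⟨r, hr⟩
      · exact absurd hlt not_lt_bot
      · have hpr := hr.le_of_lt hlt
        have hl := hr.below_eq
        rw [hl, List.length_cons] at h
        exact hs r q hpr hr (ih r hpr (by omega))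

lemma child_induction {P : Node α → Prop} (hb : P ⊥) (hs : ∀ q r, Child q r → P q → P r)
    (q : Node α) : P q :=
  child_induction_from ⊥ hb (fun q r _ => hs q r) q bot_le

/-- Every node has a child. This separates the points of the product, which have infinite filters,
from those of the tips. -/
lemma infinite_Ici [Nonempty α] (p : Node α) : (Set.Ici p).Infinite := by
  have hchild : ∀ q : Node α, ∃ r, Child q r := by
    rintro (w | ⟨a, w⟩)
    · exact ⟨_, .first (Classical.arbitrary α) w⟩
    · exact ⟨_, .second a w⟩
  choose f hf using hchild
  refine Set.infinite_of_injective_forall_mem (f := fun n : ℕ => f^[n] p) ?_ ?_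
  · refine (strictMono_nat_of_lt_succ fun n => ?_).injective
    rw [Function.iterate_succ_apply']
    exact (hf _).lt
  · intro n
    induction n with
    | zero => exact Set.mem_Ici.2 le_rfl
    | succ n ih =>
      rw [Function.iterate_succ_apply']
      exact Set.mem_Ici.2 (le_trans (Set.mem_Ici.1 ih) (hf _).lt.le)

end Node

/-! ### Automata acting on free groups -/

namespace AutomatonAction

variable {S A : Type}

/-- One step of an automaton that reads the letter `a` and writes its output to the right of a
group element. -/
def stepPerm (out : S → A → A) (nxt : A → Equiv.Perm S) (a : A) :
    Equiv.Perm (S × FreeGroup A) where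
  toFun u := (nxt a u.1, u.2 * .of (out u.1 a))
  invFun u := ((nxt a).symm u.1, u.2 * (.of (out ((nxt a).symm u.1) a))⁻¹)
  left_inv u := by simp
  right_inv u := by simp

/-- The run of an automaton on an element of the free group. -/
def run (out : S → A → A) (nxt : A → Equiv.Perm S) :
    FreeGroup A →* (Equiv.Perm (S × FreeGroup A))ᵐᵒᵖ :=
  FreeGroup.lift fun a => .op (stepPerm out nxt a)

lemma run_of (out : S → A → A) (nxt : A → Equiv.Perm S) (a : A) (u : S × FreeGroup A) :
    (run out nxt (.of a)).unop u = (nxt a u.1, u.2 * .of (out u.1 a)) := by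
  rw [run, FreeGroup.lift_apply_of]; rfl

lemma run_inv_of (out : S → A → A) (nxt : A → Equiv.Perm S) (a : A) (u : S × FreeGroup A) :
    (run out nxt (.of a)⁻¹).unop u =
      ((nxt a).symm u.1, u.2 * (.of (out ((nxt a).symm u.1) a))⁻¹) := by
  rw [run, map_inv, FreeGroup.lift_apply_of]; rfl

/-- The element written by an automaton. -/
def act (out : S → A → A) (nxt : A → Equiv.Perm S) (s : S) (w : FreeGroup A) : FreeGroup A :=
  ((run out nxt w).unop (s, 1)).2

/-- The state reached by an automaton. -/
def state (out : S → A → A) (nxt : A → Equiv.Perm S) (s : S) (w : FreeGroup A) : S :=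
  ((run out nxt w).unop (s, 1)).1

variable (out : S → A → A) (nxt : A → Equiv.Perm S)

/-- Output is written on the right, so runs commute with left translation of what has been written
before. -/
lemma run_apply (w : FreeGroup A) : ∀ (s : S) (u : FreeGroup A),
    (run out nxt w).unop (s, u) = (state out nxt s w, u * act out nxt s w) := by
  have key : ∀ (s : S) (g u : FreeGroup A), (run out nxt w).unop (s, g * u) =
      (((run out nxt w).unop (s, u)).1, g * ((run out nxt w).unop (s, u)).2) := by
    induction w using FreeGroup.induction_on with
    | C1 => intro s g u; simp
    | of a => intro s g u; simp [run_of, mul_assoc]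
    | inv_of a _ => intro s g u; rw [run_inv_of, run_inv_of]; simp [mul_assoc]
    | mul w w' h h' =>
      intro s g u
      simp only [map_mul, MulOpposite.unop_mul, Equiv.Perm.mul_apply]
      rw [h, h']
  intro s u
  have := key s u 1
  rwa [mul_one] at this

lemma act_one (s : S) : act out nxt s 1 = 1 := by simp [act]

lemma state_one (s : S) : state out nxt s 1 = s := by simp [state]

lemma run_mul (s : S) (w w' : FreeGroup A) : act out nxt s (w * w') =
      act out nxt s w * act out nxt (state out nxt s w) w' ∧
    state out nxt s (w * w') = state out nxt (state out nxt s w) w' := by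
  have : (run out nxt (w * w')).unop (s, 1) =
      (run out nxt w').unop ((run out nxt w).unop (s, 1)) := by
    simp only [map_mul, MulOpposite.unop_mul, Equiv.Perm.mul_apply]
  rw [run_apply, run_apply out nxt w, run_apply out nxt w', one_mul, one_mul] at this
  rw [Prod.mk.injEq] at this
  exact ⟨this.2, this.1⟩

lemma act_of (s : S) (a : A) : act out nxt s (.of a) = .of (out s a) := by
  simp [act, run_of]

lemma state_of (s : S) (a : A) : state out nxt s (.of a) = nxt a s := by
  simp [state, run_of]

lemma act_inv_of (s : S) (a : A) :
    act out nxt s (.of a)⁻¹ = (.of (out ((nxt a).symm s) a))⁻¹ := by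
  rw [act, run_inv_of, one_mul]

lemma state_inv_of (s : S) (a : A) : state out nxt s (.of a)⁻¹ = (nxt a).symm s := by
  rw [state, run_inv_of]

lemma act_of_mul (s : S) (a : A) (w : FreeGroup A) :
    act out nxt s (.of a * w) = .of (out s a) * act out nxt (nxt a s) w := by
  rw [(run_mul out nxt s _ w).1, act_of, state_of]

/-- An automaton is inverted by exchanging input and output: `h₁` recovers the letter, and by `h₂`
both automata pass through the same states. -/
lemma act_act {out : S → A → A} {nxt : A → Equiv.Perm S} {out' : S → A → A}
    {nxt' : A → Equiv.Perm S} (h₁ : ∀ s a, out' s (out s a) = a)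
    (h₂ : ∀ s a, nxt' (out s a) s = nxt a s) (w : FreeGroup A) : ∀ s,
    act out' nxt' s (act out nxt s w) = w ∧
      state out' nxt' s (act out nxt s w) = state out nxt s w := by
  induction w using FreeGroup.induction_on with
  | C1 => intro s; simp [act_one, state_one]
  | of a => intro s; simp [act_of, state_of, h₁, h₂]
  | inv_of a _ =>
    intro s
    have h : (nxt' (out ((nxt a).symm s) a)).symm s = (nxt a).symm s := by
      rw [Equiv.symm_apply_eq, h₂, Equiv.apply_symm_apply]
    simp [act_inv_of, state_inv_of, h, h₁]
  | mul w w' h h' =>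
    intro s
    rw [(run_mul out nxt s w w').1, (run_mul out nxt s w w').2, (run_mul out' nxt' s _ _).1,
      (run_mul out' nxt' s _ _).2, (h s).1, (h s).2, (h' _).1, (h' _).2]
    exact ⟨rfl, rfl⟩

/-- The permutation of the free group defined by a state of an invertible automaton. -/
def actPerm (out : S → A → A) (nxt : A → Equiv.Perm S) (out' : S → A → A)
    (nxt' : A → Equiv.Perm S) (h₁ : ∀ s a, out' s (out s a) = a)
    (h₂ : ∀ s a, nxt' (out s a) s = nxt a s) (h₃ : ∀ s a, out s (out' s a) = a)
    (h₄ : ∀ s a, nxt (out' s a) s = nxt' a s) (s : S) : Equiv.Perm (FreeGroup A) where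
  toFun := act out nxt s
  invFun := act out' nxt' s
  left_inv w := (act_act h₁ h₂ w s).1
  right_inv w := (act_act h₃ h₄ w s).1

end AutomatonAction

/-- The element of the free group spelled by a word with the last letter first. -/
def spell {A : Type} : List A → FreeGroup A
  | [] => 1
  | a :: w => spell w * .of a

/-- Positive words are reduced. -/
lemma spell_injective {A : Type} : Function.Injective (spell (A := A)) := by
  have h : ∀ w : List A, spell w = FreeGroup.mk (w.reverse.map fun a => (a, true)) := by
    intro w
    induction w with
    | nil => rfl
    | cons a w ih =>
      rw [spell, ih, FreeGroup.of, FreeGroup.mul_mk]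
      simp
  classical
  intro w w' hw
  rw [h, h] at hw
  have hr : ∀ w : List A, FreeGroup.reduce (w.reverse.map fun a => (a, true)) =
      w.reverse.map fun a => (a, true) := by
    intro w
    apply FreeGroup.IsReduced.reduce_eq
    refine (List.isChain_map _).2 ?_
    exact List.Pairwise.isChain (List.pairwise_of_forall fun _ _ _ => rfl)
  have := FreeGroup.reduce.sound hw
  rw [hr, hr] at this
  exact List.reverse_injective (List.map_injective_iff.2 (fun a b h => congrArg Prod.fst h) this)

/-! ### Words of Wise's complex -/

/-- Vertical colours. -/
inductive Vert : Type
  | a | b | c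

/-- Horizontal colours. -/
inductive Horiz : Type
  | x | y

namespace Wise

/-- The top side of the square with given left and bottom sides. -/
def topOf : Vert → Horiz → Horiz
  | .a, .x => .y | .a, .y => .x | .b, .x => .x | .b, .y => .y | .c, .x => .y | .c, .y => .x

/-- The right side of the square with given left and bottom sides. -/
def rightOf : Vert → Horiz → Vert
  | .a, .x => .a | .a, .y => .b | .b, .x => .c | .b, .y => .c | .c, .x => .b | .c, .y => .a

/-- The left side of the square with given bottom and right sides. -/
def leftOf : Horiz → Vert → Vert
  | .x, .a => .a | .y, .b => .a | .x, .c => .b | .y, .c => .b | .x, .b => .c | .y, .a => .c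

lemma leftOf_rightOf (α : Vert) (β : Horiz) : leftOf β (rightOf α β) = α := by
  cases α <;> cases β <;> rfl

lemma rightOf_leftOf (α : Vert) (β : Horiz) : rightOf (leftOf β α) β = α := by
  cases α <;> cases β <;> rfl

lemma topOf_topOf (α : Vert) (β : Horiz) : topOf α (topOf α β) = β := by
  cases α <;> cases β <;> rfl

/-- For a fixed left side, the bottom side determines the top side. -/
def topPerm (α : Vert) : Equiv.Perm Horiz :=
  ⟨topOf α, topOf α, topOf_topOf α, topOf_topOf α⟩

/-- For a fixed bottom side, the left side determines the right side. -/
def rightPerm (β : Horiz) : Equiv.Perm Vert :=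
  ⟨fun α => rightOf α β, leftOf β, fun α => leftOf_rightOf α β, fun α => rightOf_leftOf α β⟩

/-- For a fixed right side, the bottom side determines the top side. -/
def topPermRight (α : Vert) : Equiv.Perm Horiz where
  toFun β := topOf (leftOf β α) β
  invFun β := topOf (leftOf β α) β
  left_inv β := by cases α <;> cases β <;> rfl
  right_inv β := by cases α <;> cases β <;> rfl

/-- For a fixed top side, the left side determines the right side. -/
def rightPermTop (β : Horiz) : Equiv.Perm Vert where
  toFun α := rightOf α (topOf α β)
  invFun := match β with
    | .x => fun | .a => .c | .b => .a | .c => .b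
    | .y => fun | .a => .a | .b => .c | .c => .b
  left_inv α := by cases α <;> cases β <;> rfl
  right_inv α := by cases α <;> cases β <;> rfl

/-- The action of the horizontal colours on the vertical free group. -/
def horizAct : Horiz → Equiv.Perm (FreeGroup Vert) :=
  -- In state "bottom side", the automaton reads the right side of a square, writes the left side
  -- and moves to the top side.
  AutomatonAction.actPerm leftOf topPermRight (fun β α => rightOf α β) topPerm
    (fun β α => rightOf_leftOf α β) (fun _ _ => rfl) (fun β α => leftOf_rightOf α β)
    (fun β α => congrArg (fun α => topOf α β) (leftOf_rightOf α β))

/-- The action of the vertical colours on the horizontal free group. -/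
def vertAct : Vert → Equiv.Perm (FreeGroup Horiz) :=
  -- In state "left side", the automaton reads the top side, writes the bottom side and moves to the
  -- right side.
  AutomatonAction.actPerm topOf rightPermTop topOf rightPerm
    topOf_topOf (fun _ _ => rfl) topOf_topOf
    (fun α β => congrArg (fun β => rightOf α β) (topOf_topOf α β))

lemma horizAct_one (β : Horiz) : horizAct β 1 = 1 :=
  AutomatonAction.act_one leftOf topPermRight β

/-- The relation "bottom, right = left, top" is the rule for processing a first letter. -/
lemma horizAct_square (α : Vert) (β : Horiz) :
    horizAct β * Equiv.mulLeft (.of (rightOf α β)) =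
      Equiv.mulLeft (.of α) * horizAct (topOf α β) := by
  ext1 w
  refine (AutomatonAction.act_of_mul _ _ β (rightOf α β) w).trans ?_
  change FreeGroup.of (leftOf β (rightOf α β)) *
    AutomatonAction.act _ _ (topOf (leftOf β (rightOf α β)) β) w = _
  rw [leftOf_rightOf]
  rfl

lemma vertAct_square (α : Vert) (β : Horiz) :
    Equiv.mulLeft (.of β) * vertAct (rightOf α β) =
      vertAct α * Equiv.mulLeft (.of (topOf α β)) := by
  symm
  ext1 w
  refine (AutomatonAction.act_of_mul _ _ α (topOf α β) w).trans ?_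
  change FreeGroup.of (topOf α (topOf α β)) *
    AutomatonAction.act _ _ (rightOf α (topOf α (topOf α β))) w = _
  rw [topOf_topOf]
  rfl

/-- The right side of a row of squares with given left side and bottom word (words have the last
letter first). -/
def passRight (α : Vert) : List Horiz → Vert
  | [] => α
  | β :: h => rightOf (passRight α h) β

/-- The top word of a row of squares. -/
def passTop (α : Vert) : List Horiz → List Horiz
  | [] => []
  | β :: h => topOf (passRight α h) β :: passTop α h

/-- The top word of a rectangle with given left and bottom words. -/
def row : List Vert → List Horiz → List Horiz
  | [], h => h
  | α :: w, h => passTop α (row w h)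

/-- The colour of the vertical edge `α` of the left side translated along the bottom word `h`. -/
def colV (w : List Vert) (h : List Horiz) (α : Vert) : Vert := passRight α (row w h)

/-- The colour of the horizontal edge `β` of the bottom side translated along the left word. -/
def colH : List Vert → List Horiz → Horiz → Horiz
  | [], _, β => β
  | α :: w, h, β => topOf (colV w h α) (colH w h β)

/-- `row` is defined by stacking rows; this adds a column on the right of the rectangle. -/
lemma row_cons (w : List Vert) (h : List Horiz) (β : Horiz) :
    row w (β :: h) = colH w h β :: row w h := by
  induction w with
  | nil => rfl
  | cons α w ih => rw [row, ih]; rfl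

lemma row_nil (w : List Vert) : row w [] = [] := by
  induction w with
  | nil => rfl
  | cons α w ih => rw [row, ih]; rfl

lemma colV_nil (w : List Vert) (α : Vert) : colV w [] α = α := by
  rw [colV, row_nil]; rfl

lemma colV_cons (w : List Vert) (h : List Horiz) (α : Vert) (β : Horiz) :
    colV w (β :: h) α = rightOf (colV w h α) (colH w h β) := by
  rw [colV, row_cons]; rfl

lemma passRight_surjective (h : List Horiz) : Function.Surjective fun α => passRight α h := by
  induction h with
  | nil => exact fun α => ⟨α, rfl⟩
  | cons β h ih =>
    intro α
    obtain ⟨α', hα⟩ := ih (leftOf β α)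
    exact ⟨α', by simp only [passRight, hα, rightOf_leftOf]⟩

/-- With `colH_surjective`, this makes every edge of `W` leaving the vertex below a point of the
product come from an edge of the product. -/
lemma colV_surjective (w : List Vert) (h : List Horiz) : Function.Surjective (colV w h) :=
  passRight_surjective _

lemma colH_surjective (w : List Vert) (h : List Horiz) : Function.Surjective (colH w h) := by
  induction w with
  | nil => exact fun β => ⟨β, rfl⟩
  | cons α w ih =>
    intro β
    obtain ⟨β', hβ⟩ := ih (topOf (colV w h α) β)
    exact ⟨β', by simp only [colH, hβ, topOf_topOf]⟩

lemma passTop_injective (α : Vert) : Function.Injective (passTop α) := by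
  intro h
  induction h with
  | nil => rintro (_ | ⟨β, h⟩) hh <;> simp_all [passTop]
  | cons β h ih =>
    rintro (_ | ⟨β', h'⟩) hh
    · simp [passTop] at hh
    · simp only [passTop, List.cons.injEq] at hh
      obtain rfl := ih hh.2
      have := congrArg (topOf (passRight α h)) hh.1
      rw [topOf_topOf, topOf_topOf] at this
      rw [this]

lemma row_injective (w : List Vert) : Function.Injective (row w) := by
  induction w with
  | nil => exact fun _ _ h => h
  | cons α w ih => exact (passTop_injective α).comp ih

/-! ### The automaton has infinite order -/

/-- The action of a word on the first letter. -/
def headAct : List Vert → Horiz → Horiz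
  | [], β => β
  | α :: g, β => topOf α (headAct g β)

/-- The section of a word at a letter. -/
def section' : List Vert → Horiz → List Vert
  | [], _ => []
  | α :: g, β => rightOf α (headAct g β) :: section' g β

/-- Whether a vertical colour exchanges `x` and `y`. -/
def swaps : Vert → Bool
  | .a => true | .b => false | .c => true

/-- Parity of the number of letters that exchange `x` and `y`. -/
def odd : List Vert → Bool
  | [] => false
  | α :: g => swaps α ^^ odd g

/-- Words are stored last letter first, so `β` is the first letter of the bottom word and its square
is crossed first. -/
lemma passTop_append (α : Vert) (β : Horiz) (h : List Horiz) :
    passRight α (h ++ [β]) = passRight (rightOf α β) h ∧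
      passTop α (h ++ [β]) = passTop (rightOf α β) h ++ [topOf α β] := by
  induction h with
  | nil => exact ⟨rfl, rfl⟩
  | cons β' h ih => simp [passRight, passTop, ih.1, ih.2]

lemma row_append_singleton (g : List Vert) (h : List Horiz) (β : Horiz) :
    row g (h ++ [β]) = row (section' g β) h ++ [headAct g β] := by
  induction g with
  | nil => rfl
  | cons α g ih => rw [row, ih, (passTop_append _ _ _).2]; rfl

lemma row_append (g g' : List Vert) (h : List Horiz) : row (g ++ g') h = row g (row g' h) := by
  induction g with
  | nil => rfl
  | cons α g ih => rw [List.cons_append, row, ih]; rfl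

lemma headAct_eq (g : List Vert) :
    headAct g .x = (if odd g then .y else .x) ∧ headAct g .y = (if odd g then .x else .y) := by
  induction g with
  | nil => exact ⟨rfl, rfl⟩
  | cons α g ih =>
    simp only [headAct, ih.1, ih.2, odd]
    by_cases hg : odd g = true <;> cases α <;> simp [hg, swaps, topOf]

/-- The sections of `a` and of `c` at the two letters are `a, b` in some order, exactly one of which
is odd; those of `b` are `c, c`, whose parities cancel. In a word, each vertical letter meets both
`x` and `y`, because the letters applied before it permute them. -/
lemma odd_section (g : List Vert) : (odd (section' g .x) ^^ odd (section' g .y)) = odd g := by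
  induction g with
  | nil => rfl
  | cons α g ih =>
    simp only [section', odd, (headAct_eq g).1, (headAct_eq g).2]
    rw [← ih]
    cases odd (section' g .x) <;> cases odd (section' g .y) <;> cases α <;> rfl

lemma odd_append (g g' : List Vert) : odd (g ++ g') = (odd g ^^ odd g') := by
  induction g with
  | nil => simp [odd]
  | cons α g ih => simp [odd, ih]

lemma section_append (g g' : List Vert) (β : Horiz) :
    section' (g ++ g') β = section' g (headAct g' β) ++ section' g' β ∧
      headAct (g ++ g') β = headAct g (headAct g' β) := by
  induction g with
  | nil => exact ⟨rfl, rfl⟩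
  | cons α g ih => simp [section', headAct, ih.1, ih.2]

/-- Descent on `k`. An odd `g` exchanges the two possible first letters, so an odd power is not the
identity. Its square fixes the first letter and acts behind `x` through the product of both sections
of `g`, which is odd by `odd_section`; an even `k` is thus halved. -/
lemma row_iterate_ne_id (k : ℕ) : ∀ g, odd g = true → 0 < k → (row g)^[k] ≠ id := by
  induction k using Nat.strong_induction_on with
  | _ k ih =>
    intro g hg hk hid
    have hx : headAct g .x = .y := by simp [(headAct_eq g).1, hg]
    have hy : headAct g .y = .x := by simp [(headAct_eq g).2, hg]
    obtain ⟨j, hj⟩ := Nat.even_or_odd' k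
    have hgg : ∀ h, row (g ++ g) (h ++ [.x]) =
        row (section' g .y ++ section' g .x) h ++ [.x] := by
      intro h
      rw [row_append_singleton, (section_append g g _).1, (section_append g g _).2, hx, hy]
    have hjj : ∀ h, (row g)^[2 * j] (h ++ [.x]) =
        (row (section' g .y ++ section' g .x))^[j] h ++ [.x] := by
      have : (row g)^[2] = row (g ++ g) := funext fun h => (row_append g g h).symm
      intro h
      rw [Function.iterate_mul, this]
      clear hid hj
      induction j generalizing h with
      | zero => rfl
      | succ j ih => rw [Function.iterate_succ_apply, hgg, ih, Function.iterate_succ_apply]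
    rcases hj with rfl | rfl
    · refine ih j (by omega) (section' g .y ++ section' g .x) ?_ (by omega) ?_
      · rw [odd_append, Bool.xor_comm, odd_section, hg]
      · funext h
        have := hjj h
        rw [hid] at this
        exact (List.append_cancel_right this).symm
    · have h₁ := hjj []
      have h₂ := congrFun hid ([] ++ [.x])
      rw [Function.iterate_succ_apply', h₁, row_append_singleton, hx] at h₂
      simp only [id] at h₂
      have := List.append_inj_right' h₂ rfl
      simp at this

/-- The letter `c` is odd, so it has infinite order; equal powers would contradict this after
cancelling the smaller one. This is the source of infinitely many types of filters. -/
lemma row_replicate_injective : Function.Injective fun n => row (List.replicate n .c) := by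
  have hrow : ∀ n, row (List.replicate n .c) = (row [.c])^[n] := by
    intro n
    induction n with
    | zero => rfl
    | succ n ih =>
      rw [List.replicate_succ, Function.iterate_succ', ← ih]
      rfl
  have key : ∀ m k, 0 < k → row (List.replicate m .c) ≠ row (List.replicate (m + k) .c) := by
    intro m k hk h
    refine row_iterate_ne_id k [.c] rfl hk (funext fun l => ?_)
    apply row_injective (List.replicate m .c)
    have h' := congrFun h l
    rw [hrow, hrow, Function.iterate_add_apply] at h'
    rw [hrow]
    exact h'.symm
  intro m n h
  by_contra hne
  rcases Nat.lt_or_gt_of_ne hne with hlt | hlt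
  · exact key m (n - m) (by omega) (by rw [Nat.add_sub_cancel' hlt.le]; exact h)
  · exact key n (m - n) (by omega) (by rw [Nat.add_sub_cancel' hlt.le]; exact h.symm)

end Wise

namespace DirectedSquareComplex

/-! ### Homotopy invariants -/

section Invariant

variable {K : DirectedSquareComplex} {G : Type} [Group G]

/-- The product of the group elements along a path. -/
def holonomy (ρ : K.E → G) (l : List K.Step) : G :=
  (l.map fun s => if s.2 then ρ s.1 else (ρ s.1)⁻¹).prod

lemma holonomy_directed (ρ : K.E → G) (l : List K.E) :
    holonomy ρ (directed l) = (l.map ρ).prod := by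
  simp [holonomy, directed, Function.comp_def]

lemma Homotopic.holonomy_eq {ρ : K.E → G}
    (hρ : ∀ q, ρ (K.bot q) * ρ (K.right q) = ρ (K.left q) * ρ (K.top q)) {u v : K.V}
    {l l' : List K.Step} (h : K.Homotopic u v l l') : holonomy ρ l = holonomy ρ l' := by
  induction h with
  | rel x y h =>
    rcases h.2.2 with ⟨l₁, l₂, ⟨e, b⟩, rfl, rfl⟩ | ⟨l₁, l₂, q, rfl, rfl⟩
    · cases b <;> simp [holonomy, Step.rev]
    · have := hρ q
      simp only [holonomy, List.map_append, List.map_cons, List.prod_append, List.prod_cons,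
        if_true]
      rw [← mul_assoc (ρ (K.bot q)), this, mul_assoc]
  | refl x => rfl
  | symm x y _ ih => exact ih.symm
  | trans x y z _ _ ih₁ ih₂ => exact ih₁.trans ih₂

/-- The extension of group elements to the edges of the barycentric subdivision. -/
def baryWeight (ρ : K.E → G) : K.BaryEdge → G
  -- The weight of an edge sits on its first half. An edge into a centre gets the weight of the
  -- first half parallel to it on the opposite side, so each quarter of a square commutes.
  | .first e => ρ e
  | .second _ => 1
  | .botToCentre q => ρ (K.right q)
  | .leftToCentre q => ρ (K.top q)
  | .centreToTop _ => 1
  | .centreToRight _ => 1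

lemma baryWeight_square {ρ : K.E → G}
    (hρ : ∀ q, ρ (K.bot q) * ρ (K.right q) = ρ (K.left q) * ρ (K.top q)) (q : K.bary.Q) :
    baryWeight ρ (K.bary.bot q) * baryWeight ρ (K.bary.right q) =
      baryWeight ρ (K.bary.left q) * baryWeight ρ (K.bary.top q) := by
  cases q with
  | botLeft q => exact hρ q
  | botRight q => exact (one_mul _).trans (mul_one _).symm
  | topLeft q => exact (mul_one _).trans (one_mul _).symm
  | topRight q => rfl

end Invariant

/-- The inclusion of a complex into the complex with tips. -/
def inclTips (K : DirectedSquareComplex) {ι : Type} (root : ι → K.V) (len : ι → ℕ) :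
    Hom K (K.attachTips root len) where
  onV := Sum.inl
  onE := Sum.inl
  onQ q := q
  map_src _ := rfl
  map_tgt _ := rfl
  map_bot _ := rfl
  map_right _ := rfl
  map_top _ := rfl
  map_left _ := rfl

end DirectedSquareComplex

open DirectedSquareComplex

/-- The colour of a vertical letter. -/
def Vert.color : Vert → WiseColor
  | .a => .a | .b => .b | .c => .c

/-- The colour of a horizontal letter. -/
def Horiz.color : Horiz → WiseColor
  | .x => .x | .y => .y

lemma Vert.color_injective : Function.Injective Vert.color := by
  intro α β h; cases α <;> cases β <;> first | rfl | cases h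

lemma Horiz.color_injective : Function.Injective Horiz.color := by
  intro α β h; cases α <;> cases β <;> first | rfl | cases h

lemma Vert.color_ne (α : Vert) (β : Horiz) : α.color ≠ β.color := by
  cases α <;> cases β <;> exact fun h => by cases h

namespace Wise

lemma color_cases (κ : WiseColor) : (∃ α : Vert, α.color = κ) ∨ ∃ β : Horiz, β.color = κ := by
  cases κ
  exacts [.inl ⟨.a, rfl⟩, .inl ⟨.b, rfl⟩, .inl ⟨.c, rfl⟩, .inr ⟨.x, rfl⟩, .inr ⟨.y, rfl⟩]

/-- The square with given left and bottom sides. -/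
def square : Vert → Horiz → WiseSquare
  | .a, .x => .a_x | .a, .y => .a_y | .b, .x => .b_x | .b, .y => .b_y | .c, .x => .c_x
  | .c, .y => .c_y

lemma exists_square (q : WiseSquare) : ∃ α β, square α β = q := by
  cases q
  exacts [⟨.a, .x, rfl⟩, ⟨.a, .y, rfl⟩, ⟨.b, .x, rfl⟩, ⟨.b, .y, rfl⟩, ⟨.c, .x, rfl⟩,
    ⟨.c, .y, rfl⟩]

lemma left_square (α : Vert) (β : Horiz) : wiseX.left (square α β) = α.color := by
  cases α <;> cases β <;> rfl

lemma bot_square (α : Vert) (β : Horiz) : wiseX.bot (square α β) = β.color := by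
  cases α <;> cases β <;> rfl

lemma top_square (α : Vert) (β : Horiz) : wiseX.top (square α β) = (topOf α β).color := by
  cases α <;> cases β <;> rfl

lemma right_square (α : Vert) (β : Horiz) : wiseX.right (square α β) = (rightOf α β).color := by
  cases α <;> cases β <;> rfl

/-- The vertex of the subdivision of Wise's complex below a pair of nodes. -/
def lab : Node Vert → Node Horiz → wiseX.BaryVertex
  | .full _, .full _ => .vertex ()
  | .half α w, .full h => .mid (colV w h α).color
  | .full w, .half β h => .mid (colH w h β).color
  | .half α w, .half β h => .centre (square (colV w h α) (colH w h β))

/-- The edge of the subdivision below the vertical edge that ends at a pair of nodes. -/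
def vEdge : Node Vert → Node Horiz → wiseX.bary.E
  | .half α w, .full h => BaryEdge.first (K := wiseX) (colV w h α).color
  | .full (α :: w), .full h => BaryEdge.second (K := wiseX) (colV w h α).color
  | .half α w, .half β h => BaryEdge.botToCentre (K := wiseX) (square (colV w h α) (colH w h β))
  | .full (α :: w), .half β h => BaryEdge.centreToTop (K := wiseX) (square (colV w h α) (colH w h β))
  -- A default value: no vertical edge ends at the root of the vertical tree.
  | .full [], _ => BaryEdge.first (K := wiseX) WiseColor.a

/-- The edge of the subdivision below the horizontal edge that ends at a pair of nodes. -/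
def hEdge : Node Vert → Node Horiz → wiseX.bary.E
  | .full w, .half β h => BaryEdge.first (K := wiseX) (colH w h β).color
  | .full w, .full (β :: h) => BaryEdge.second (K := wiseX) (colH w h β).color
  | .half α w, .half β h => BaryEdge.leftToCentre (K := wiseX) (square (colV w h α) (colH w h β))
  | .half α w, .full (β :: h) => BaryEdge.centreToRight (K := wiseX) (square (colV w h α) (colH w h β))
  | _, .full [] => BaryEdge.first (K := wiseX) WiseColor.a

variable {p p' : Node Vert} {q q' : Node Horiz}

lemma src_vEdge (hp : p.Child p') (q : Node Horiz) : wiseX.bary.src (vEdge p' q) = lab p q := by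
  rcases hp with ⟨α, w⟩ | ⟨α, w⟩ <;> rcases q with h | ⟨β, h⟩
  · rfl
  · exact congrArg BaryVertex.mid (bot_square _ _)
  · rfl
  · rfl

lemma tgt_vEdge (hp : p.Child p') (q : Node Horiz) : wiseX.bary.tgt (vEdge p' q) = lab p' q := by
  rcases hp with ⟨α, w⟩ | ⟨α, w⟩ <;> rcases q with h | ⟨β, h⟩
  · rfl
  · rfl
  · rfl
  · exact congrArg BaryVertex.mid (top_square _ _)

lemma src_hEdge (p : Node Vert) (hq : q.Child q') : wiseX.bary.src (hEdge p q') = lab p q := by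
  rcases hq with ⟨β, h⟩ | ⟨β, h⟩ <;> rcases p with w | ⟨α, w⟩
  · rfl
  · exact congrArg BaryVertex.mid (left_square _ _)
  · rfl
  · rfl

lemma tgt_hEdge (p : Node Vert) (hq : q.Child q') : wiseX.bary.tgt (hEdge p q') = lab p q' := by
  rcases hq with ⟨β, h⟩ | ⟨β, h⟩ <;> rcases p with w | ⟨α, w⟩
  · rfl
  · rfl
  · rfl
  · refine (congrArg BaryVertex.mid (right_square _ _)).trans ?_
    rw [← colV_cons]; rfl

lemma exists_barySquare (hp : p.Child p') (hq : q.Child q') :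
    ∃ s, wiseX.bary.bot s = hEdge p q' ∧ wiseX.bary.right s = vEdge p' q' ∧
      wiseX.bary.left s = vEdge p' q ∧ wiseX.bary.top s = hEdge p' q' := by
  rcases hp with ⟨α, w⟩ | ⟨α, w⟩ <;> rcases hq with ⟨β, h⟩ | ⟨β, h⟩
  · exact ⟨.botLeft (square (colV w h α) (colH w h β)), congrArg BaryEdge.first (bot_square _ _),
      rfl, congrArg BaryEdge.first (left_square _ _), rfl⟩
  · refine ⟨.botRight (square (colV w h α) (colH w h β)),
      congrArg BaryEdge.second (bot_square _ _),
      (congrArg BaryEdge.first (right_square _ _)).trans ?_, rfl, rfl⟩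
    rw [← colV_cons]; rfl
  · exact ⟨.topLeft (square (colV w h α) (colH w h β)), rfl, rfl,
      congrArg BaryEdge.second (left_square _ _), congrArg BaryEdge.first (top_square _ _)⟩
  · refine ⟨.topRight (square (colV w h α) (colH w h β)), rfl,
      (congrArg BaryEdge.second (right_square _ _)).trans ?_, rfl,
      congrArg BaryEdge.second (top_square _ _)⟩
    rw [← colV_cons]; rfl

/-- Directed edges never leave the product of trees. At vertices this is surjectivity of `colV` and
`colH`; at midpoints and centres the colours already met determine the edge or its square. -/
lemma exists_child_of_src (e : wiseX.bary.E) (he : wiseX.bary.src e = lab p q) :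
    (∃ p', p.Child p' ∧ vEdge p' q = e) ∨ ∃ q', q.Child q' ∧ hEdge p q' = e := by
  -- Most combinations die because the source of `e` is not the right kind of cell.
  rcases p with w | ⟨α, w⟩ <;> rcases q with h | ⟨β, h⟩ <;> rcases e with κ | κ | s | s | s | s <;>
    first
    | (exfalso; revert he; change BaryVertex.vertex _ = BaryVertex.mid _ → False; intro h; cases h)
    | (exfalso; revert he; change BaryVertex.vertex _ = BaryVertex.centre _ → False; intro h; cases h)
    | (exfalso; revert he; change BaryVertex.mid _ = BaryVertex.vertex _ → False; intro h; cases h)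
    | (exfalso; revert he; change BaryVertex.mid _ = BaryVertex.centre _ → False; intro h; cases h)
    | (exfalso; revert he; change BaryVertex.centre _ = BaryVertex.mid _ → False; intro h; cases h)
    | (exfalso; revert he; change BaryVertex.centre _ = BaryVertex.vertex _ → False; intro h; cases h)
    | skip
  · rcases color_cases κ with ⟨α, rfl⟩ | ⟨β, rfl⟩
    · obtain ⟨α, rfl⟩ := colV_surjective w h α
      exact .inl ⟨_, .first α w, rfl⟩
    · obtain ⟨β, rfl⟩ := colH_surjective w h β
      exact .inr ⟨_, .first β h, rfl⟩
  · have he : κ = (colH w h β).color := BaryVertex.mid.inj he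
    subst he
    exact .inr ⟨_, .second β h, rfl⟩
  · obtain ⟨α', β', rfl⟩ := exists_square s
    have he : wiseX.bot (square α' β') = (colH w h β).color := BaryVertex.mid.inj he
    rw [bot_square] at he
    obtain rfl := Horiz.color_injective he
    obtain ⟨α, rfl⟩ := colV_surjective w h α'
    exact .inl ⟨_, .first α w, rfl⟩
  · obtain ⟨α', β', rfl⟩ := exists_square s
    have he : wiseX.left (square α' β') = (colH w h β).color := BaryVertex.mid.inj he
    rw [left_square] at he
    exact absurd he (Vert.color_ne _ _)
  · have he : κ = (colV w h α).color := BaryVertex.mid.inj he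
    subst he
    exact .inl ⟨_, .second α w, rfl⟩
  · obtain ⟨α', β', rfl⟩ := exists_square s
    have he : wiseX.bot (square α' β') = (colV w h α).color := BaryVertex.mid.inj he
    rw [bot_square] at he
    exact absurd he.symm (Vert.color_ne _ _)
  · obtain ⟨α', β', rfl⟩ := exists_square s
    have he : wiseX.left (square α' β') = (colV w h α).color := BaryVertex.mid.inj he
    rw [left_square] at he
    obtain rfl := Vert.color_injective he
    obtain ⟨β, rfl⟩ := colH_surjective w h β'
    exact .inr ⟨_, .first β h, rfl⟩
  · have he : s = square (colV w h α) (colH w h β) := BaryVertex.centre.inj he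
    subst he
    exact .inl ⟨_, .second α w, rfl⟩
  · have he : s = square (colV w h α) (colH w h β) := BaryVertex.centre.inj he
    subst he
    exact .inr ⟨_, .second β h, rfl⟩

/-- The canonical directed path to a pair of nodes: first vertical, then horizontal. -/
def baryPath (p : Node Vert) (q : Node Horiz) : List wiseX.bary.E :=
  p.below.reverse.map (fun p' => vEdge p' ⊥) ++ q.below.reverse.map (hEdge p)

lemma baryPath_child_right (p : Node Vert) (hq : q.Child q') :
    baryPath p q' = baryPath p q ++ [hEdge p q'] := by
  simp [baryPath, hq.below_eq]

lemma baryPath_child_left_bot (hp : p.Child p') :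
    baryPath p' ⊥ = baryPath p ⊥ ++ [vEdge p' ⊥] := by
  have : (⊥ : Node Horiz).below = [] := rfl
  simp [baryPath, hp.below_eq, this]

lemma isPath_single {K : DirectedSquareComplex} {u v : K.V} {e : K.E} (h : K.src e = u)
    (h' : K.tgt e = v) : K.IsPath u (directed [e]) v := ⟨h, h'⟩

lemma isPath_baryPath (p : Node Vert) (q : Node Horiz) :
    wiseX.bary.IsPath (BaryVertex.vertex ()) (directed (baryPath p q)) (lab p q) := by
  induction q using Node.child_induction with
  | hb =>
    induction p using Node.child_induction with
    | hb => rfl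
    | hs p p' hp ih =>
      rw [baryPath_child_left_bot hp, directed_append]
      exact ih.append (isPath_single (src_vEdge hp _) (tgt_vEdge hp _))
  | hs q q' hq ih =>
    rw [baryPath_child_right p hq, directed_append]
    exact ih.append (isPath_single (src_hEdge _ hq) (tgt_hEdge _ hq))

/-- The final vertical edge is pushed back through the horizontal part, one square of
`exists_barySquare` at a time. -/
lemma baryPath_child_left (hp : p.Child p') (q : Node Horiz) :
    wiseX.bary.Homotopic (BaryVertex.vertex ()) (lab p' q)
      (directed (baryPath p q ++ [vEdge p' q])) (directed (baryPath p' q)) := by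
  induction q using Node.child_induction with
  | hb => rw [baryPath_child_left_bot hp]; exact Homotopic.refl _ _ _
  | hs q q' hq ih =>
    rw [baryPath_child_right p hq, baryPath_child_right p' hq]
    have h₁ := ih.append_right (isPath_single (src_hEdge p' hq) (tgt_hEdge p' hq))
    rw [← directed_append, ← directed_append] at h₁
    refine Homotopic.trans (Relation.EqvGen.rel _ _ ⟨?_, ?_, Or.inr ?_⟩) h₁
    · rw [directed_append, directed_append]
      exact ((isPath_baryPath p q).append (isPath_single (src_hEdge p hq) (tgt_hEdge p hq))).append
        (isPath_single (src_vEdge hp _) (tgt_vEdge hp _))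
    · rw [directed_append, directed_append]
      exact ((isPath_baryPath p q).append (isPath_single (src_vEdge hp _) (tgt_vEdge hp _))).append
        (isPath_single (src_hEdge p' hq) (tgt_hEdge p' hq))
    · obtain ⟨s, h₁, h₂, h₃, h₄⟩ := exists_barySquare hp hq
      exact ⟨directed (baryPath p q), [], s, by simp [h₁, h₂], by simp [h₃, h₄]⟩

/-! ### The invariants of canonical paths -/

/-- The word of all letters of a node. -/
def letters {α : Type} : Node α → List α
  | .full w => w
  | .half a w => a :: w

section Holonomy

variable {G : Type} [Group G] (ρ : WiseColor → G)

/-- The product along a vertical word. -/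
def vertProd : List Vert → G
  | [] => 1
  | α :: w => vertProd w * ρ α.color

/-- The product along a horizontal word. -/
def horizProd : List Horiz → G
  | [] => 1
  | β :: h => horizProd h * ρ β.color

/-- The weights of the edges of the subdivision of Wise's complex. -/
def edgeWeight : wiseX.bary.E → G := baryWeight (K := wiseX) ρ

/-- Since weights sit on first halves, a half node already carries the full weight of its letter;
hence `letters` counts that letter. -/
lemma prod_baryPath (p : Node Vert) (q : Node Horiz) :
    ((baryPath p q).map (edgeWeight ρ)).prod =
      vertProd ρ (letters p) * horizProd ρ (row (letters p) (letters q)) := by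
  induction q using Node.child_induction with
  | hb =>
    change _ = vertProd ρ (letters p) * horizProd ρ (row (letters p) [])
    rw [row_nil]
    change _ = vertProd ρ (letters p) * 1
    induction p using Node.child_induction with
    | hb => exact (mul_one _).symm
    | hs p p' hp ih =>
      rw [baryPath_child_left_bot hp, List.map_append, List.prod_append, ih, mul_one, mul_one]
      simp only [List.map_cons, List.map_nil, List.prod_singleton]
      rcases hp with ⟨α, w⟩ | ⟨α, w⟩
      · change vertProd ρ w * ρ (colV w [] α).color = vertProd ρ w * ρ α.color
        rw [colV_nil]
      · exact mul_one _
  | hs q q' hq ih =>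
    rw [baryPath_child_right p hq, List.map_append, List.prod_append, ih, mul_assoc]
    congr 1
    simp only [List.map_cons, List.map_nil, List.prod_singleton]
    rcases hq with ⟨β, h⟩ | ⟨β, h⟩
    · change _ = horizProd ρ (row (letters p) (β :: h))
      rw [row_cons]
      rcases p with w | ⟨α, w⟩
      · rfl
      · change _ * ρ (wiseX.top (square (colV w h α) (colH w h β))) = _
        rw [top_square]
        rfl
    · refine Eq.trans ?_ (mul_one _)
      rcases p with w | ⟨α, w⟩ <;> rfl

end Holonomy

/-- The action of the colours on the vertical free group. -/
def vertWeight : WiseColor → Equiv.Perm (FreeGroup Vert)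
  | .a => Equiv.mulLeft (.of .a)
  | .b => Equiv.mulLeft (.of .b)
  | .c => Equiv.mulLeft (.of .c)
  | .x => horizAct .x
  | .y => horizAct .y

/-- The action of the colours on the horizontal free group. -/
def horizWeight : WiseColor → Equiv.Perm (FreeGroup Horiz)
  | .a => vertAct .a
  | .b => vertAct .b
  | .c => vertAct .c
  | .x => Equiv.mulLeft (.of .x)
  | .y => Equiv.mulLeft (.of .y)

lemma vertWeight_vert (α : Vert) : vertWeight α.color = Equiv.mulLeft (.of α) := by
  cases α <;> rfl

lemma vertWeight_horiz (β : Horiz) : vertWeight β.color = horizAct β := by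
  cases β <;> rfl

lemma horizWeight_vert (α : Vert) : horizWeight α.color = vertAct α := by
  cases α <;> rfl

lemma horizWeight_horiz (β : Horiz) : horizWeight β.color = Equiv.mulLeft (.of β) := by
  cases β <;> rfl

lemma vertWeight_square (q : wiseX.Q) : vertWeight (wiseX.bot q) * vertWeight (wiseX.right q) =
    vertWeight (wiseX.left q) * vertWeight (wiseX.top q) := by
  obtain ⟨α, β, rfl⟩ := exists_square q
  rw [bot_square, right_square, left_square, top_square]
  simp only [vertWeight_vert, vertWeight_horiz, horizAct_square]

lemma horizWeight_square (q : wiseX.Q) :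
    horizWeight (wiseX.bot q) * horizWeight (wiseX.right q) =
      horizWeight (wiseX.left q) * horizWeight (wiseX.top q) := by
  obtain ⟨α, β, rfl⟩ := exists_square q
  rw [bot_square, right_square, left_square, top_square]
  simp only [horizWeight_vert, horizWeight_horiz, vertAct_square]

lemma vertProd_vertWeight (w : List Vert) (g : FreeGroup Vert) :
    vertProd vertWeight w g = spell w * g := by
  induction w generalizing g with
  | nil => exact (one_mul g).symm
  | cons α w ih =>
    rw [vertProd, Equiv.Perm.mul_apply, ih, vertWeight_vert, spell, mul_assoc]
    rfl

lemma horizProd_vertWeight (h : List Horiz) : horizProd vertWeight h 1 = 1 := by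
  induction h with
  | nil => rfl
  | cons β h ih => rw [horizProd, Equiv.Perm.mul_apply, vertWeight_horiz, horizAct_one, ih]

lemma horizProd_horizWeight (h : List Horiz) (g : FreeGroup Horiz) :
    horizProd horizWeight h g = spell h * g := by
  induction h generalizing g with
  | nil => exact (one_mul g).symm
  | cons β h ih =>
    rw [horizProd, Equiv.Perm.mul_apply, ih, horizWeight_horiz, spell, mul_assoc]
    rfl

/-- Products along canonical paths determine the words. -/
lemma letters_eq_of_prod_eq
    (h₁ : vertProd vertWeight (letters p) * horizProd vertWeight (row (letters p) (letters q)) =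
      vertProd vertWeight (letters p') * horizProd vertWeight (row (letters p') (letters q')))
    (h₂ : vertProd horizWeight (letters p) * horizProd horizWeight (row (letters p) (letters q)) =
      vertProd horizWeight (letters p') *
        horizProd horizWeight (row (letters p') (letters q'))) :
    letters p = letters p' ∧ letters q = letters q' := by
  -- At `1` the horizontal factors act trivially, and the vertical words are left.
  have h₃ := DFunLike.congr_fun h₁ 1
  simp only [Equiv.Perm.mul_apply, horizProd_vertWeight, vertProd_vertWeight, mul_one] at h₃
  have h₄ := spell_injective h₃
  refine ⟨h₄, ?_⟩
  -- The vertical factors are now equal and cancel; at `1` the other action spells the top words,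
  -- and `row` is injective.
  rw [h₄] at h₂
  have h₅ := DFunLike.congr_fun (mul_left_cancel h₂) 1
  simp only [horizProd_horizWeight, mul_one] at h₅
  exact row_injective _ (spell_injective h₅)

/-- `letters` does not distinguish a half node from the full node above it; the cell `lab` does. Two
midpoints of different direction are told apart by their colours. -/
lemma eq_of_letters_eq (h₁ : letters p = letters p') (h₂ : letters q = letters q')
    (h : lab p q = lab p' q') : p = p' ∧ q = q' := by
  rcases p with w | ⟨α, w⟩ <;> rcases q with h | ⟨β, h⟩ <;>
    rcases p' with w' | ⟨α', w'⟩ <;> rcases q' with h' | ⟨β', h'⟩ <;>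
    simp only [letters, List.cons.injEq] at h₁ h₂ <;>
    simp only [lab, reduceCtorEq] at h
  · exact ⟨by rw [h₁], by rw [h₂]⟩
  · exact ⟨by rw [h₁], by rw [h₂.1, h₂.2]⟩
  · exact absurd (BaryVertex.mid.inj h).symm (Vert.color_ne _ _)
  · exact absurd (BaryVertex.mid.inj h) (Vert.color_ne _ _)
  · exact ⟨by rw [h₁.1, h₁.2], by rw [h₂]⟩
  · exact ⟨by rw [h₁.1, h₁.2], by rw [h₂.1, h₂.2]⟩

end Wise

/-! ### Canonical directed paths in Wise's complex with tips -/

open DirectedSquareComplex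

namespace Wise

variable (r : WiseColor → ℕ)

/-- The length of the tip at a vertex of the subdivision. -/
def tipLen : wiseX.BaryVertex → ℕ
  | .mid κ => r κ
  | _ => 0

/-- The point at height `k` of the tip at a vertex. -/
def tipEnd : wiseX.BaryVertex → ℕ → (wiseW r).V
  -- Height `0` is the root, so height `k + 1` is the new vertex number `k`; above the tip the value
  -- is a default.
  | .mid κ, k + 1 => if h : k < r κ then Sum.inr ⟨κ, k, h⟩ else Sum.inl (BaryVertex.mid κ)
  | b, _ => Sum.inl b

variable {r} in
/-- The edge of the tip of colour `κ` that ends at height `k + 1`. -/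
def tipEdge (κ : WiseColor) (k : ℕ) (h : k < r κ) : (wiseW r).E := Sum.inr ⟨κ, k, h⟩

/-- The first `k` edges of the tip at a vertex. -/
def tipPath : wiseX.BaryVertex → ℕ → List (wiseW r).E
  | .mid κ, k => ((List.finRange (r κ)).take k).map fun j => tipEdge κ j.1 j.2
  | _, _ => []

/-- The inclusion of the subdivision of Wise's complex. -/
def incl : Hom wiseX.bary (wiseW r) := inclTips _ _ _

variable {r}

lemma tipPath_zero (b : wiseX.BaryVertex) : tipPath r b 0 = [] := by
  cases b <;> rfl

lemma tipEnd_zero (b : wiseX.BaryVertex) : tipEnd r b 0 = Sum.inl b := by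
  cases b <;> rfl

lemma tipEnd_succ {κ : WiseColor} {k : ℕ} (h : k < r κ) :
    tipEnd r (.mid κ) (k + 1) = Sum.inr ⟨κ, k, h⟩ := dif_pos h

lemma exists_mid {b : wiseX.BaryVertex} (h : 0 < tipLen r b) : ∃ κ : WiseColor, b = .mid κ := by
  rcases b with v | κ | s
  · exact absurd h (lt_irrefl _)
  · exact ⟨κ, rfl⟩
  · exact absurd h (lt_irrefl _)

lemma tipPath_succ {κ : WiseColor} {k : ℕ} (h : k < r κ) :
    tipPath r (.mid κ) (k + 1) = tipPath r (.mid κ) k ++ [tipEdge κ k h] := by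
  simp only [tipPath]
  rw [List.take_succ_eq_append_getElem (by simpa using h), List.map_append]
  simp

lemma src_tipEdge {κ : WiseColor} {k : ℕ} (h : k < r κ) :
    (wiseW r).src (tipEdge κ k h) = tipEnd r (.mid κ) k := by
  cases k with
  | zero => rfl
  | succ k => exact (tipEnd_succ (Nat.lt_of_succ_lt h)).symm

lemma tgt_tipEdge {κ : WiseColor} {k : ℕ} (h : k < r κ) :
    (wiseW r).tgt (tipEdge κ k h) = tipEnd r (.mid κ) (k + 1) :=
  (tipEnd_succ h).symm

lemma tipEnd_injective {b b' : wiseX.BaryVertex} {k k' : ℕ} (hk : k ≤ tipLen r b)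
    (hk' : k' ≤ tipLen r b') (h : tipEnd r b k = tipEnd r b' k') : b = b' ∧ k = k' := by
  have cases_ : ∀ b k, k ≤ tipLen r b → (k = 0 ∧ tipEnd r b k = Sum.inl b) ∨
      ∃ κ j, ∃ hj : j < r κ, b = .mid κ ∧ k = j + 1 ∧ tipEnd r b k = Sum.inr ⟨κ, j, hj⟩ := by
    intro b k hk
    rcases k with _ | j
    · exact .inl ⟨rfl, tipEnd_zero b⟩
    · rcases b with v | κ | s
      · exact absurd hk (Nat.not_succ_le_zero j)
      · exact .inr ⟨κ, j, hk, rfl, rfl, tipEnd_succ hk⟩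
      · exact absurd hk (Nat.not_succ_le_zero j)
  rcases cases_ b k hk with ⟨h₁, h₂⟩ | ⟨κ, j, hj, rfl, rfl, h₂⟩ <;>
    rcases cases_ b' k' hk' with ⟨h₁', h₂'⟩ | ⟨κ', j', hj', rfl, rfl, h₂'⟩ <;>
    rw [h₂, h₂'] at h
  · exact ⟨Sum.inl_injective h, h₁.trans h₁'.symm⟩
  · cases h
  · cases h
  · cases Sum.inr_injective h
    exact ⟨rfl, rfl⟩

variable (r)

/-- The ordered set of vertices above a vertex of the universal cover. -/
abbrev Tips : Type := TipProduct fun p q => tipLen r (lab p q)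

variable {r}

/-- The vertex of `W` below an element. -/
def endOf (m : Tips r) : (wiseW r).V := tipEnd r (lab m.fst m.snd) m.height

/-- The canonical directed path to an element. -/
def canon (m : Tips r) : List (wiseW r).E :=
  (baryPath m.fst m.snd).map (incl r).onE ++ tipPath r (lab m.fst m.snd) m.height

lemma canon_pt (p : Node Vert) (q : Node Horiz) :
    canon (TipProduct.pt p q : Tips r) = (baryPath p q).map (incl r).onE := by
  refine (congrArg _ (tipPath_zero _)).trans (List.append_nil _)

lemma endOf_pt (p : Node Vert) (q : Node Horiz) :
    endOf (TipProduct.pt p q : Tips r) = Sum.inl (lab p q) := tipEnd_zero _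

lemma canon_succ (p : Node Vert) (q : Node Horiz) {κ : WiseColor} (hκ : lab p q = .mid κ) {k : ℕ}
    (h : k + 1 ≤ tipLen r (lab p q)) (h' : k < r κ) :
    canon (⟨p, q, k + 1, h⟩ : Tips r) =
      canon (⟨p, q, k, (Nat.le_succ k).trans h⟩ : Tips r) ++ [tipEdge κ k h'] := by
  simp only [canon, hκ, tipPath_succ h', List.append_assoc]

lemma isPath_canon (m : Tips r) :
    (wiseW r).IsPath (wiseZero r) (directed (canon m)) (endOf m) := by
  obtain ⟨p, q, k, hk⟩ := m
  induction k with
  | zero =>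
    change (wiseW r).IsPath _ (directed (canon (TipProduct.pt p q : Tips r)))
      (endOf (TipProduct.pt p q : Tips r))
    rw [canon_pt, endOf_pt, ← Hom.map_directed]
    exact Hom.isPath_map (p := incl r) (isPath_baryPath p q)
  | succ k ih =>
    obtain ⟨κ, hκ⟩ := exists_mid (Nat.zero_lt_of_lt hk)
    have h' : k < r κ := by rw [hκ] at hk; exact hk
    rw [canon_succ p q hκ hk h', directed_append]
    refine (ih _).append (isPath_single (K := wiseW r) ?_ ?_)
    · rw [src_tipEdge]; simp only [endOf, hκ]
    · rw [tgt_tipEdge]; simp only [endOf, hκ]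

/-- `e` leads from below `m` to below `m'`. -/
structure Arrow (m : Tips r) (e : (wiseW r).E) (m' : Tips r) : Prop where
  le : m ≤ m'
  src : (wiseW r).src e = endOf m
  tgt : (wiseW r).tgt e = endOf m'
  homotopic : (wiseW r).Homotopic (wiseZero r) (endOf m') (directed (canon m ++ [e]))
    (directed (canon m'))

lemma arrow_vEdge {p p' : Node Vert} (hp : p.Child p') (q : Node Horiz) :
    Arrow (TipProduct.pt p q : Tips r) ((incl r).onE (vEdge p' q)) (TipProduct.pt p' q) where
  le := TipProduct.pt_le_pt.2 ⟨hp.lt.le, le_rfl⟩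
  src := by rw [← Hom.map_src, src_vEdge hp, endOf_pt]; rfl
  tgt := by rw [← Hom.map_tgt, tgt_vEdge hp, endOf_pt]; rfl
  homotopic := by
    have := Hom.homotopic_map (p := incl r) (baryPath_child_left hp q)
    rw [Hom.map_directed, Hom.map_directed, List.map_append] at this
    rw [canon_pt, canon_pt, endOf_pt]
    exact this

lemma arrow_hEdge (p : Node Vert) {q q' : Node Horiz} (hq : q.Child q') :
    Arrow (TipProduct.pt p q : Tips r) ((incl r).onE (hEdge p q')) (TipProduct.pt p q') where
  le := TipProduct.pt_le_pt.2 ⟨le_rfl, hq.lt.le⟩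
  src := by rw [← Hom.map_src, src_hEdge p hq, endOf_pt]; rfl
  tgt := by rw [← Hom.map_tgt, tgt_hEdge p hq, endOf_pt]; rfl
  homotopic := by
    rw [canon_pt, canon_pt, baryPath_child_right p hq, List.map_append]
    exact Homotopic.refl _ _ _

lemma arrow_tipEdge (p : Node Vert) (q : Node Horiz) {κ : WiseColor} (hκ : lab p q = .mid κ)
    {k : ℕ} (h' : k < r κ) :
    Arrow (⟨p, q, k, by rw [hκ]; exact h'.le⟩ : Tips r) (tipEdge κ k h')
      ⟨p, q, k + 1, by rw [hκ]; exact h'⟩ where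
  le := Or.inr ⟨rfl, rfl, Nat.le_succ k⟩
  src := by rw [src_tipEdge]; simp only [endOf, hκ]
  tgt := by rw [tgt_tipEdge]; simp only [endOf, hκ]
  homotopic := by
    rw [canon_succ p q hκ _ h']
    exact Homotopic.refl _ _ _

/-- Directed edges of `W` never lead out of the parameter set, so every reachable vertex of the
cover is parametrized. -/
lemma exists_arrow (m : Tips r) (e : (wiseW r).E) (he : (wiseW r).src e = endOf m) :
    ∃ m', Arrow m e m' := by
  obtain ⟨p, q, k, hk⟩ := m
  rcases e with e | ⟨κ, j, hj⟩
  · have he' : tipEnd r (wiseX.bary.src e) 0 = tipEnd r (lab p q) k := (tipEnd_zero _).trans he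
    obtain ⟨h₁, rfl⟩ := tipEnd_injective (Nat.zero_le _) hk he'
    rcases exists_child_of_src e h₁ with ⟨p', hp, rfl⟩ | ⟨q', hq, rfl⟩
    · exact ⟨_, arrow_vEdge hp q⟩
    · exact ⟨_, arrow_hEdge p hq⟩
  · have he' : tipEnd r (.mid κ) j = tipEnd r (lab p q) k := (src_tipEdge hj).symm.trans he
    obtain ⟨h₁, rfl⟩ := tipEnd_injective (show j ≤ r κ from hj.le) hk he'
    exact ⟨_, arrow_tipEdge p q h₁.symm hj⟩

/-- From height `0` one moves vertically, then horizontally, then up the tip; otherwise only along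
the tip. -/
lemma exists_arrows_of_le {m m' : Tips r} (h : m ≤ m') :
    Relation.ReflTransGen (fun m m' => ∃ e, Arrow m e m') m m' := by
  have tips : ∀ p q j k (hk : k ≤ tipLen r (lab p q)) (hj : j ≤ k),
      Relation.ReflTransGen (fun m m' : Tips r => ∃ e, Arrow m e m') ⟨p, q, j, hj.trans hk⟩
        ⟨p, q, k, hk⟩ := by
    intro p q j k hk hj
    induction k with
    | zero =>
      obtain rfl : j = 0 := by omega
      exact .refl
    | succ k ih =>
      rcases hj.eq_or_lt with rfl | hj
      · exact .refl
      · obtain ⟨κ, hκ⟩ : ∃ κ, lab p q = .mid κ := by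
          revert hk
          rcases lab p q with v | κ | s
          · exact fun h => absurd h (Nat.not_succ_le_zero k)
          · exact fun _ => ⟨κ, rfl⟩
          · exact fun h => absurd h (Nat.not_succ_le_zero k)
        have h' : k < r κ := by rw [hκ] at hk; exact hk
        exact (ih (by omega) (by omega)).tail ⟨_, arrow_tipEdge p q hκ h'⟩
  obtain ⟨p, q, j, hj⟩ := m
  obtain ⟨p', q', k, hk⟩ := m'
  rcases h with ⟨hp, hq, hj'⟩ | ⟨hp, hq, hjk⟩
  · obtain rfl : j = 0 := hj'
    have h₁ : Relation.ReflTransGen (fun m m' : Tips r => ∃ e, Arrow m e m')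
        (TipProduct.pt p q) (TipProduct.pt p' q) :=
      Node.child_induction_from (P := fun p' => Relation.ReflTransGen
        (fun m m' : Tips r => ∃ e, Arrow m e m') (TipProduct.pt p q) (TipProduct.pt p' q))
        p .refl (fun _ _ _ hp h => h.tail ⟨_, arrow_vEdge hp q⟩) p' hp
    have h₂ : Relation.ReflTransGen (fun m m' : Tips r => ∃ e, Arrow m e m')
        (TipProduct.pt p q) (TipProduct.pt p' q') :=
      Node.child_induction_from (P := fun q' => Relation.ReflTransGen
        (fun m m' : Tips r => ∃ e, Arrow m e m') (TipProduct.pt p q) (TipProduct.pt p' q'))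
        q h₁ (fun _ _ _ hq h => h.tail ⟨_, arrow_hEdge p' hq⟩) q' hq
    exact h₂.trans (tips p' q' 0 k hk (Nat.zero_le k))
  · obtain rfl : p = p' := hp
    obtain rfl : q = q' := hq
    exact tips p q j k hk hjk

section Weights

variable {G : Type} [Group G] (ρ : WiseColor → G)

/-- The weights of the edges of `W`. -/
def tipWeight : (wiseW r).E → G := Sum.elim (edgeWeight ρ) fun _ => 1

lemma prod_canon (m : Tips r) : ((canon m).map (tipWeight ρ)).prod =
    vertProd ρ (letters m.fst) * horizProd ρ (row (letters m.fst) (letters m.snd)) := by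
  have h : ∀ b k, ((tipPath r b k).map (tipWeight (r := r) ρ)).prod = 1 := by
    intro b k
    rcases b with v | κ | s
    · rfl
    · refine List.prod_eq_one fun x hx => ?_
      obtain ⟨e, he, rfl⟩ := List.mem_map.1 hx
      obtain ⟨j, -, rfl⟩ := List.mem_map.1 he
      rfl
    · rfl
  rw [canon, List.map_append, List.prod_append, h, mul_one, List.map_map, ← prod_baryPath]
  rfl

lemma prod_canon_eq_of_homotopic {ρ : WiseColor → G}
    (hρ : ∀ q, ρ (wiseX.bot q) * ρ (wiseX.right q) = ρ (wiseX.left q) * ρ (wiseX.top q))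
    {m m' : Tips r} {v : (wiseW r).V}
    (h : (wiseW r).Homotopic (wiseZero r) v (directed (canon m)) (directed (canon m'))) :
    vertProd ρ (letters m.fst) * horizProd ρ (row (letters m.fst) (letters m.snd)) =
      vertProd ρ (letters m'.fst) * horizProd ρ (row (letters m'.fst) (letters m'.snd)) := by
  have := Homotopic.holonomy_eq (ρ := tipWeight ρ)
    (fun q => baryWeight_square (K := wiseX) hρ q) h
  rwa [holonomy_directed, holonomy_directed, prod_canon, prod_canon] at this

end Weights

/-- The common endpoint gives the cell and the height; the two holonomies give the words. -/
lemma eq_of_homotopic {m m' : Tips r} (he : endOf m = endOf m')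
    (h : (wiseW r).Homotopic (wiseZero r) (endOf m) (directed (canon m)) (directed (canon m'))) :
    m = m' := by
  obtain ⟨h₁, h₂⟩ := tipEnd_injective m.height_le m'.height_le he
  obtain ⟨h₃, h₄⟩ := letters_eq_of_prod_eq (prod_canon_eq_of_homotopic vertWeight_square h)
    (prod_canon_eq_of_homotopic horizWeight_square h)
  obtain ⟨h₅, h₆⟩ := eq_of_letters_eq h₃ h₄ h₁
  exact TipProduct.ext h₅ h₆ h₂

/-- Principal filters of the universal cover of `W` are products of trees with tips. -/
theorem nonempty_tips_orderIso {U : DirectedSquareComplex} {p : Hom U (wiseW r)}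
    (hp : p.IsUniversalCover) {v : U.V} (hv : p.onV v = wiseZero r) :
    Nonempty (Tips r ≃o U.PrincipalFilter v) := by
  have ex : ∀ m : Tips r, ∃ u, p.LiftEnd v (canon m) u := fun m =>
    hp.1.exists_liftEnd (by rw [hv]; exact isPath_canon m)
  choose N hN using ex
  have hend : ∀ m, p.onV (N m) = endOf m := fun m => by
    have := (hN m).isPath
    rw [hv] at this
    exact this.unique (isPath_canon m)
  have hinj : Function.Injective N := by
    intro m m' h
    refine eq_of_homotopic (by rw [← hend, h, hend]) ?_
    have := hp.homotopic_of_liftEnd (hN m) (by rw [h]; exact hN m')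
    rwa [hv, hend] at this
  have harrow : ∀ {m e m'}, Arrow m e m' → p.LiftEnd (N m) [e] (N m') := by
    intro m e m' h
    obtain ⟨u, hu⟩ := hp.1.exists_liftEnd (u := N m) (l := [e])
      (isPath_single (h.src.trans (hend m).symm) rfl)
    have h₁ := (hN m).append hu
    rwa [hp.1.liftEnd_unique (hp.1.liftEnd_of_homotopic h₁ (by rw [hv]; exact h.homotopic))
      (hN m')] at hu
  -- Each edge upstairs is the unique lift of its image, and that image is followed by an arrow.
  have hreach : ∀ m u, U.Reach (N m) u → ∃ m', m ≤ m' ∧ N m' = u := by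
    intro m u h
    induction h with
    | refl => exact ⟨m, le_rfl, rfl⟩
    | tail _ h ih =>
      obtain ⟨m', hm, rfl⟩ := ih
      obtain ⟨e, he, rfl⟩ := h
      obtain ⟨m'', h₁⟩ := exists_arrow m' (p.onE e) (by rw [← p.map_src, he, hend])
      refine ⟨m'', hm.trans h₁.le, ?_⟩
      exact hp.1.liftEnd_unique (harrow h₁) ⟨[e], ⟨he, rfl⟩, rfl⟩
  have hle : ∀ m m', m ≤ m' → U.Reach (N m) (N m') := by
    intro m m' h
    have h' := exists_arrows_of_le h
    clear h
    induction h' with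
    | refl => exact Reach.refl _
    | tail _ h ih =>
      obtain ⟨e, he⟩ := h
      exact ih.trans (harrow he).reach
  have hroot : N (TipProduct.pt ⊥ ⊥) = v := by
    refine hp.1.liftEnd_unique (hN _) ?_
    rw [canon_pt]
    exact ⟨[], rfl, rfl⟩
  refine nonempty_orderIso_of_surjective id (fun m => (⟨N m, (hN m).reach⟩ : U.PrincipalFilter v))
    Function.surjective_id ?_ (fun m m' => ?_) (fun m m' => ⟨hle m m', ?_⟩)
  · rintro ⟨u, hu⟩
    rw [← hroot] at hu
    obtain ⟨m, -, rfl⟩ := hreach _ _ hu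
    exact ⟨m, rfl⟩
  · exact ⟨fun h => Subtype.ext (congrArg N h), fun h => hinj (congrArg Subtype.val h)⟩
  · intro h
    obtain ⟨m'', h₁, h₂⟩ := hreach m (N m') h
    rw [← hinj h₂]
    exact h₁

end Wise

/-! ### Tips are visible in the order -/

section Fan

variable {P P' : Type} [PartialOrder P] [PartialOrder P']

/-- The elements that are separated from `m` by elements with finite principal filters only. -/
def fan (m : P) : Set P := {x | m < x ∧ ∀ y, m < y → y ≤ x → (Set.Ici y).Finite}

/-- All elements that enter the definition of `fan m.1` lie above `m`, hence in the filter where `F`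
is defined. -/
lemma map_mem_fan {a : P} {b : P'} (F : Set.Ici a ≃o Set.Ici b) (m x : Set.Ici a)
    (h : x.1 ∈ fan m.1) : (F x).1 ∈ fan (F m).1 := by
  refine ⟨F.lt_iff_lt.2 (show m < x from h.1), fun y hy hyx => ?_⟩
  obtain ⟨y', hy'⟩ := F.surjective ⟨y, Set.mem_Ici.2 ((F m).2.trans hy.le)⟩
  have h₁ : m < y' := by rw [← F.lt_iff_lt, hy']; exact hy
  have h₂ : y' ≤ x := by rw [← F.le_iff_le, hy']; exact hyx
  refine ((((h.2 y'.1 h₁ h₂).preimage (f := Subtype.val)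
    Subtype.val_injective.injOn).image F).image Subtype.val).subset ?_
  intro z hz
  obtain ⟨z', hz'⟩ := F.surjective ⟨z, Set.mem_Ici.2 ((F m).2.trans (hy.le.trans hz))⟩
  refine ⟨F z', ⟨z', ?_, rfl⟩, by rw [hz']⟩
  have : y' ≤ z' := by rw [← F.le_iff_le, hy', hz']; exact hz
  exact this

lemma ncard_fan_eq {a : P} {b : P'} (F : Set.Ici a ≃o Set.Ici b) (m : Set.Ici a) :
    (fan m.1).ncard = (fan (F m).1).ncard := by
  refine Set.ncard_congr (fun x hx => (F ⟨x, m.2.trans hx.1.le⟩).1) (fun x hx => ?_) ?_ ?_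
  · exact map_mem_fan F m ⟨x, _⟩ hx
  · intro x y hx hy h
    exact congrArg Subtype.val (F.injective (Subtype.ext h))
  · intro y hy
    have h := map_mem_fan F.symm (F m) ⟨y, (F m).2.trans hy.1.le⟩ hy
    rw [F.symm_apply_apply] at h
    exact ⟨_, h, congrArg Subtype.val (F.apply_symm_apply _)⟩

/-- The restriction of an isomorphism of ordered sets to principal filters. -/
def iciCongr (φ : P ≃o P') (a : P) : Set.Ici a ≃o Set.Ici (φ a) where
  toFun x := ⟨φ x.1, φ.monotone x.2⟩
  invFun y := ⟨φ.symm y.1, by rw [Set.mem_Ici, φ.le_symm_apply]; exact y.2⟩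
  left_inv x := Subtype.ext (φ.symm_apply_apply x.1)
  right_inv y := Subtype.ext (φ.apply_symm_apply y.1)
  map_rel_iff' := φ.le_iff_le

end Fan

/-! ### Determinism of nice labelings -/

namespace EventStructure

variable {E : EventStructure} {A : Type} {lab : E.Event → A}

lemma LStep.isConfiguration {x y : E.Domain} {a : A} (h : E.LStep lab x y a) :
    ∃ e ∈ E.enabled x.1, y.1 = insert e x.1 ∧ lab e = a := by
  obtain ⟨e, h₁, h₂, h₃⟩ := h
  exact ⟨e, ⟨h₁, h₂ ▸ y.2⟩, h₂, h₃⟩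

lemma LStep.unique (hn : E.IsNice lab) {x y y' : E.Domain} {a : A} (h : E.LStep lab x y a)
    (h' : E.LStep lab x y' a) : y = y' := by
  obtain ⟨e, h₁, h₂, h₃⟩ := h.isConfiguration
  obtain ⟨e', h₁', h₂', h₃'⟩ := h'.isConfiguration
  have : e = e' := by
    by_contra hne
    exact hn e e' hne ⟨x, h₁, h₁'⟩ (h₃.trans h₃'.symm)
  exact Subtype.ext (by rw [h₂, h₂', this])

end EventStructure

/-! ### Tip lengths and parallel edges in terms of the order -/

namespace TipProduct

section

variable {T₁ T₂ : Type} [PartialOrder T₁] [PartialOrder T₂] {len : T₁ → T₂ → ℕ}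

lemma infinite_Ici_pt {p : T₁} (hp : (Set.Ici p).Infinite) (q : T₂) :
    (Set.Ici (pt p q : TipProduct len)).Infinite := by
  have hinj : Function.Injective fun p' : T₁ => (pt p' q : TipProduct len) :=
    fun _ _ h => congrArg TipProduct.fst h
  refine (hp.image (f := fun p' => (pt p' q : TipProduct len)) hinj.injOn).mono ?_
  rintro _ ⟨p', hp', rfl⟩
  exact pt_le_pt.2 ⟨hp', le_rfl⟩

/-- The fan of a point is its own tip: an element over another base point is separated from it by
that base point, whose filter is infinite, whereas filters in a tip are finite. -/
lemma ncard_fan_pt (hT : ∀ p : T₁, (Set.Ici p).Infinite) (p : T₁) (q : T₂) :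
    (fan (pt p q : TipProduct len)).ncard = len p q := by
  let f : Fin (len p q) → TipProduct len := fun j => ⟨p, q, j + 1, j.2⟩
  have hf : Function.Injective f := fun i j h => by
    have : i.1 + 1 = j.1 + 1 := congrArg TipProduct.height h
    exact Fin.ext (by omega)
  have hfan : fan (pt p q : TipProduct len) = f '' Set.univ := by
    ext x
    constructor
    · rintro ⟨hx, h⟩
      have hle := pt_le.1 hx.le
      have hx₀ : pt p q = (pt x.fst x.snd : TipProduct len) := by
        by_contra hne
        exact infinite_Ici_pt (hT _) _ (h (pt x.fst x.snd)
          (lt_of_le_of_ne (pt_le_pt.2 hle) hne) (pt_le.2 ⟨le_rfl, le_rfl⟩))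
      have h₁ : p = x.fst := congrArg TipProduct.fst hx₀
      have h₂ : q = x.snd := congrArg TipProduct.snd hx₀
      have hpos : 0 < x.height := by
        rcases Nat.eq_zero_or_pos x.height with h' | h'
        · exact absurd (hx₀.trans (eq_pt h').symm) hx.ne
        · exact h'
      have hlen := x.height_le
      rw [← h₁, ← h₂] at hlen
      exact ⟨⟨x.height - 1, by omega⟩, trivial,
        TipProduct.ext h₁ h₂ (Nat.sub_add_cancel hpos)⟩
    · rintro ⟨j, -, rfl⟩
      refine ⟨lt_of_le_of_ne (pt_le.2 ⟨le_rfl, le_rfl⟩) fun h => ?_, fun y hy hyx => ?_⟩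
      · have : 0 = j.1 + 1 := congrArg TipProduct.height h
        omega
      · have h₁ : y.fst = p := le_antisymm (fst_le hyx) (pt_le.1 hy.le).1
        have h₂ : y.snd = q := le_antisymm (snd_le hyx) (pt_le.1 hy.le).2
        have hpos : 0 < y.height := by
          rcases Nat.eq_zero_or_pos y.height with h' | h'
          · exact absurd (TipProduct.ext h₁.symm h₂.symm h'.symm) hy.ne
          · exact h'
        refine (Set.toFinite (f '' Set.univ)).subset fun z hz => ?_
        obtain ⟨h₃, h₄⟩ := eq_of_le_of_height_pos hz hpos
        have hz₀ := height_le_of_le hz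
        have hlen := z.height_le
        rw [← h₃, ← h₄, h₁, h₂] at hlen
        exact ⟨⟨z.height - 1, by omega⟩, trivial, TipProduct.ext (h₁.symm.trans h₃)
          (h₂.symm.trans h₄) (Nat.sub_add_cancel (hpos.trans_le hz₀))⟩
  rw [hfan, Set.ncard_image_of_injective _ hf, Set.ncard_univ, Nat.card_eq_fintype_card,
    Fintype.card_fin]

lemma pt_covBy_pt (p : T₁) {q q' : T₂} (h : q ⋖ q') :
    (pt p q : TipProduct len) ⋖ pt p q' := by
  refine ⟨lt_of_le_of_ne (pt_le_pt.2 ⟨le_rfl, h.le⟩)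
    fun h' => h.lt.ne (congrArg TipProduct.snd h'), fun z h₁ h₂ => ?_⟩
  have hz := eq_pt (Nat.le_zero.1 (height_le_of_le h₂.le))
  rw [hz] at h₁ h₂
  have h₃ := pt_le_pt.1 h₁.le
  have h₄ := pt_le_pt.1 h₂.le
  rcases h.eq_or_eq h₃.2 h₄.2 with h' | h'
  · exact h₁.ne (TipProduct.ext (le_antisymm h₃.1 h₄.1) h'.symm rfl)
  · exact h₂.ne (TipProduct.ext (le_antisymm h₄.1 h₃.1) h' rfl)

end

variable {T₁ T₂ : Type} [PartialOrder T₁] [PartialOrder T₂] [OrderBot T₁] {len : T₁ → T₂ → ℕ}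
  {E : EventStructure} {A : Type}

/-- Parallel edges carry the same label. -/
lemma exists_lstep (φ : TipProduct len ≃o E.Domain) (lab : E.Event → A) {q q' : T₂} (h : q ⋖ q') :
    ∃ a, ∀ p, E.LStep lab (φ (pt p q)) (φ (pt p q')) a := by
  have hcov : ∀ p, φ (pt p q) ⋖ φ (pt p q') := fun p =>
    (apply_covBy_apply_iff φ).2 (pt_covBy_pt p h)
  obtain ⟨e, -, he⟩ := EventStructure.exists_insert_of_covBy (hcov ⊥)
  refine ⟨lab e, fun p => ?_⟩
  obtain ⟨e', he', hins⟩ := EventStructure.exists_insert_of_covBy (hcov p)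
  -- The event `e` of the edge over `⊥` reappears over `p`. It is new there, for otherwise `pt ⊥ q'`
  -- would lie below `pt p q`.
  have hmem : e ∈ (φ (pt p q')).1 := by
    have : φ (pt ⊥ q') ≤ φ (pt p q') := φ.monotone (pt_le_pt.2 ⟨bot_le, le_rfl⟩)
    exact this (by rw [he]; exact Set.mem_insert _ _)
  rw [hins] at hmem
  rcases hmem with rfl | hmem
  · exact ⟨e, he', hins, rfl⟩
  · have h₁ : φ (pt ⊥ q) ≤ φ (pt p q) := φ.monotone (pt_le_pt.2 ⟨bot_le, le_rfl⟩)
    have h₂ : φ (pt ⊥ q') ≤ φ (pt p q) := by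
      change (φ (pt ⊥ q')).1 ⊆ _
      rw [he]
      exact Set.insert_subset hmem h₁
    exact absurd (pt_le_pt.1 (φ.le_iff_le.1 h₂)).2 h.lt.not_ge

end TipProduct

/-- An equivalence of filters that respects a nice labeling preserves the lengths of tips along
the second coordinate. -/
lemma TipProduct.len_eq_of_filterEquiv {α β : Type} [Nonempty α] {len : Node α → Node β → ℕ}
    {E : EventStructure} {A : Type} (φ : TipProduct len ≃o E.Domain) {lab : E.Event → A}
    (hn : E.IsNice lab) {p p' : Node α}
    (h : E.FilterEquiv lab (φ (pt p ⊥)) (φ (pt p' ⊥))) (q : Node β) : len p q = len p' q := by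
  obtain ⟨F, hF⟩ := h
  have hmem : ∀ p q, φ (pt p q) ∈ Set.Ici (φ (pt p ⊥)) := fun p q =>
    φ.monotone (pt_le_pt.2 ⟨le_rfl, bot_le⟩)
  have hbot : F ⟨φ (pt p ⊥), hmem p ⊥⟩ = ⟨φ (pt p' ⊥), hmem p' ⊥⟩ := by
    refine le_antisymm ?_ (F ⟨φ (pt p ⊥), hmem p ⊥⟩).2
    rw [← F.le_symm_apply]
    exact (F.symm ⟨φ (pt p' ⊥), hmem p' ⊥⟩).2
  -- The horizontal edges over `p` and over `p'` have the same label, `F` preserves labels, and a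
  -- label determines the step.
  have key : ∀ q, F ⟨φ (pt p q), hmem p q⟩ = ⟨φ (pt p' q), hmem p' q⟩ := by
    intro q
    induction q using Node.child_induction with
    | hb => exact hbot
    | hs q r hqr ih =>
      obtain ⟨a, ha⟩ := exists_lstep φ lab hqr.covBy
      have := hF ⟨_, hmem p q⟩ ⟨_, hmem p r⟩ a (ha p)
      rw [ih] at this
      exact Subtype.ext (this.unique hn (ha p'))
  rw [← ncard_fan_pt (len := len) Node.infinite_Ici p q, ← ncard_fan_pt (len := len) Node.infinite_Ici p' q,
    ncard_fan_eq (iciCongr φ (pt p q)) ⟨_, Set.mem_Ici.2 le_rfl⟩,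
    ncard_fan_eq (iciCongr φ (pt p' q)) ⟨_, Set.mem_Ici.2 le_rfl⟩]
  have := ncard_fan_eq F ⟨φ (pt p q), hmem p q⟩
  rw [key] at this
  exact this

/-! ### Infinitely many types of labeled filters -/

namespace Wise

variable {r : WiseColor → ℕ}

/-- A nice labeling of Wise's event structure has infinitely many types of filters. -/
theorem not_exists_finite_invariant (hr : Function.Injective r) {E : EventStructure}
    (hE : E.HasDomain (Tips r)) {A S : Type} [Finite S] {lab : E.Event → A} (hn : E.IsNice lab)
    (κ : E.Domain → S) (hκ : ∀ c c', κ c = κ c' → E.FilterEquiv lab c c') : False := by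
  obtain ⟨φ⟩ := hE
  -- Pigeonhole on the points `c^n` of the vertical axis.
  obtain ⟨m, n, hmn, h⟩ := Finite.exists_ne_map_eq_of_infinite fun n : ℕ =>
    κ (φ.symm (TipProduct.pt (.full (List.replicate n .c)) ⊥))
  refine hmn (row_replicate_injective (funext fun l => ?_))
  have : Nonempty Vert := ⟨.c⟩
  have hlen := TipProduct.len_eq_of_filterEquiv φ.symm hn (hκ _ _ h)
  change row _ l = row _ l
  induction l with
  | nil => rw [row_nil, row_nil]
  | cons β l ih =>
    rw [row_cons, row_cons, ih]
    -- The tip over this midpoint has length `r` of the colour of the next letter of the top word,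
    -- and `r` is injective.
    have := hlen (.half β l)
    rw [Horiz.color_injective (hr this)]

/-- Wise's event structure has no regular nice labeling. -/
theorem not_admitsRegularNiceLabeling (hr : Function.Injective r) {E : EventStructure}
    (hE : E.HasDomain (Tips r)) : ¬ E.AdmitsRegularNiceLabeling := by
  rintro ⟨A, lab, -, hn, hfin⟩
  have : Finite (Quot (E.LabeledFutureEquiv lab)) := hfin
  exact not_exists_finite_invariant hr hE hn (Quot.mk (E.LabeledFutureEquiv lab)) fun c c' h =>
    ((EventStructure.labeledFutureEquiv_equivalence lab).eqvGen_iff.1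
      (Quot.eqvGen_exact h)).filterEquiv

/-- Wise's event structure is not a regular trace event structure. -/
theorem not_isRegularTrace (hr : Function.Injective r) {E : EventStructure}
    (hE : E.HasDomain (Tips r)) : ¬ E.IsRegularTrace := by
  rintro ⟨A, I, E', lab, hA, -, hI, -, hlab, hfin, ⟨f⟩⟩
  exact not_admitsRegularNiceLabeling hr (hE.of_iso f) ⟨A, lab, hA, hlab.isNice hI, hfin⟩

end Wise

/-! ### Finiteness and connectedness of `W` -/

open DirectedSquareComplex

namespace Wise

variable {r : WiseColor → ℕ}

/-- An enumeration of the colours. -/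
def rank : WiseColor → ℕ
  | .a => 1 | .b => 2 | .c => 3 | .x => 4 | .y => 5

lemma bijOn_rank : Set.BijOn rank Set.univ (Set.Icc 1 5) := by
  refine ⟨fun κ _ => by cases κ <;> simp [rank], fun κ _ κ' _ h => ?_, fun n hn => ?_⟩
  · cases κ <;> cases κ' <;> first | rfl | cases h
  · obtain ⟨h₁, h₂⟩ := hn
    interval_cases n
    exacts [⟨.a, trivial, rfl⟩, ⟨.b, trivial, rfl⟩, ⟨.c, trivial, rfl⟩, ⟨.x, trivial, rfl⟩,
      ⟨.y, trivial, rfl⟩]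

lemma finite_wiseColor : Finite WiseColor :=
  Finite.of_injective (fun κ => (⟨rank κ, (bijOn_rank.mapsTo (Set.mem_univ κ))⟩ : Set.Icc 1 5))
    fun κ κ' h => bijOn_rank.injOn (Set.mem_univ κ) (Set.mem_univ κ') (congrArg Subtype.val h)

lemma finite_wiseSquare : Finite WiseSquare := by
  have := finite_wiseColor
  have : Finite Vert := Finite.of_injective _ Vert.color_injective
  have : Finite Horiz := Finite.of_injective _ Horiz.color_injective
  exact Finite.of_surjective (fun s : Vert × Horiz => square s.1 s.2) fun q =>
    let ⟨α, β, h⟩ := exists_square q; ⟨(α, β), h⟩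

lemma finite_vertices : Finite (wiseW r).V := by
  have := finite_wiseColor
  have := finite_wiseSquare
  have : Finite wiseX.BaryVertex := by
    refine Finite.of_surjective (α := Unit ⊕ WiseColor ⊕ WiseSquare)
      (Sum.elim (fun _ => BaryVertex.vertex (K := wiseX) ()) (Sum.elim (BaryVertex.mid (K := wiseX)) (BaryVertex.centre (K := wiseX)))) ?_
    rintro (v | κ | q)
    exacts [⟨.inl (), rfl⟩, ⟨.inr (.inl κ), rfl⟩, ⟨.inr (.inr q), rfl⟩]
  exact inferInstanceAs (Finite (wiseX.BaryVertex ⊕ Σ κ : WiseColor, Fin (r κ)))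

lemma finite_edges : Finite (wiseW r).E := by
  have := finite_wiseColor
  have := finite_wiseSquare
  have : Finite wiseX.BaryEdge := by
    refine Finite.of_surjective
      (α := (WiseColor ⊕ WiseColor) ⊕ (WiseSquare ⊕ WiseSquare) ⊕ (WiseSquare ⊕ WiseSquare))
      (Sum.elim (Sum.elim (BaryEdge.first (K := wiseX)) (BaryEdge.second (K := wiseX)))
        (Sum.elim (Sum.elim (BaryEdge.botToCentre (K := wiseX)) (BaryEdge.leftToCentre (K := wiseX)))
          (Sum.elim (BaryEdge.centreToTop (K := wiseX)) (BaryEdge.centreToRight (K := wiseX))))) ?_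
    rintro (e | e | q | q | q | q)
    exacts [⟨.inl (.inl e), rfl⟩, ⟨.inl (.inr e), rfl⟩, ⟨.inr (.inl (.inl q)), rfl⟩,
      ⟨.inr (.inl (.inr q)), rfl⟩, ⟨.inr (.inr (.inl q)), rfl⟩, ⟨.inr (.inr (.inr q)), rfl⟩]
  exact inferInstanceAs (Finite (wiseX.BaryEdge ⊕ Σ κ : WiseColor, Fin (r κ)))

lemma exists_path_tgt {K : DirectedSquareComplex} {u : K.V} (e : K.E)
    (h : ∃ l, K.IsPath u l (K.src e)) : ∃ l, K.IsPath u l (K.tgt e) :=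
  h.elim fun l hl => ⟨l ++ [(e, true)], hl.append ⟨rfl, rfl⟩⟩

lemma exists_path_bary (b : wiseX.BaryVertex) :
    ∃ l, (wiseW r).IsPath (wiseZero r) l (Sum.inl b) := by
  have hmid : ∀ κ : WiseColor, ∃ l, (wiseW r).IsPath (wiseZero r) l (Sum.inl (.mid κ)) := fun κ =>
    exists_path_tgt (K := wiseW r) (Sum.inl (BaryEdge.first (K := wiseX) κ)) ⟨[], rfl⟩
  rcases b with v | κ | q
  · exact ⟨[], rfl⟩
  · exact hmid κ
  · exact exists_path_tgt (K := wiseW r) (Sum.inl (BaryEdge.botToCentre (K := wiseX) q))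
      (hmid (wiseX.bot q))

lemma exists_path (w : (wiseW r).V) : ∃ l, (wiseW r).IsPath (wiseZero r) l w := by
  rcases w with b | ⟨κ, k, hk⟩
  · exact exists_path_bary b
  · induction k with
    | zero => exact exists_path_tgt (K := wiseW r) (Sum.inr ⟨κ, 0, hk⟩) (exists_path_bary (.mid κ))
    | succ k ih =>
      exact exists_path_tgt (K := wiseW r) (Sum.inr ⟨κ, k + 1, hk⟩) (ih (Nat.lt_of_succ_lt hk))

end Wise

namespace PetriNet

/-! ### Traces and projections to dependent pairs of letters -/

section Traces

variable {N : PetriNet}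

namespace TraceEquiv

lemma refl (σ : List N.Transition) : N.TraceEquiv σ σ := Relation.EqvGen.refl _

lemma symm {σ τ : List N.Transition} (h : N.TraceEquiv σ τ) : N.TraceEquiv τ σ :=
  Relation.EqvGen.symm _ _ h

lemma trans {σ τ υ : List N.Transition} (h : N.TraceEquiv σ τ) (h' : N.TraceEquiv τ υ) :
    N.TraceEquiv σ υ :=
  Relation.EqvGen.trans _ _ _ h h'

lemma append_left (ρ : List N.Transition) {σ τ : List N.Transition} (h : N.TraceEquiv σ τ) :
    N.TraceEquiv (ρ ++ σ) (ρ ++ τ) := by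
  induction h with
  | rel x y h =>
    obtain ⟨u, v, a, b, hab, rfl, rfl⟩ := h
    exact Relation.EqvGen.rel _ _ ⟨ρ ++ u, v, a, b, hab, by simp, by simp⟩
  | refl x => exact refl _
  | symm x y _ ih => exact ih.symm
  | trans x y z _ _ ih₁ ih₂ => exact ih₁.trans ih₂

lemma append_right {σ τ : List N.Transition} (h : N.TraceEquiv σ τ) (ρ : List N.Transition) :
    N.TraceEquiv (σ ++ ρ) (τ ++ ρ) :=
  N.traceEquiv_append_right h ρ

end TraceEquiv

lemma Indep.symm {a b : N.Transition} (h : N.Indep a b) : N.Indep b a := ⟨h.1.symm, h.2.symm⟩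

lemma not_indep_self (a : N.Transition) : ¬ N.Indep a a := fun h => h.1 rfl

/-- A letter commutes with a word of letters independent of it. -/
lemma traceEquiv_cons {t : N.Transition} {ρ : List N.Transition} (h : ∀ x ∈ ρ, N.Indep x t) :
    N.TraceEquiv (t :: ρ) (ρ ++ [t]) := by
  induction ρ with
  | nil => exact .refl _
  | cons x ρ ih =>
    have h₁ : N.TraceEquiv (t :: x :: ρ) (x :: t :: ρ) :=
      Relation.EqvGen.rel _ _ ⟨[], ρ, t, x, (h x (by simp)).symm, rfl, rfl⟩
    exact h₁.trans ((ih fun y hy => h y (by simp [hy])).append_left [x])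

open Classical in
/-- The subword of the letters `s` and `t`. -/
noncomputable def proj (s t : N.Transition) (σ : List N.Transition) : List N.Transition :=
  σ.filter fun x => x = s ∨ x = t

lemma proj_append (s t : N.Transition) (σ τ : List N.Transition) :
    proj s t (σ ++ τ) = proj s t σ ++ proj s t τ :=
  List.filter_append ..

lemma mem_proj {s t x : N.Transition} {σ : List N.Transition} :
    x ∈ proj s t σ ↔ x ∈ σ ∧ (x = s ∨ x = t) := by
  simp [proj]

lemma proj_eq_nil {s t : N.Transition} {σ : List N.Transition} (hs : s ∉ σ) (ht : t ∉ σ) :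
    proj s t σ = [] := by
  refine List.eq_nil_iff_forall_not_mem.2 fun x hx => ?_
  obtain ⟨hxσ, rfl | rfl⟩ := mem_proj.1 hx
  exacts [hs hxσ, ht hxσ]

lemma proj_cons_left (s t : N.Transition) (σ : List N.Transition) :
    proj s t (s :: σ) = s :: proj s t σ := by
  simp [proj]

lemma proj_cons_right (s t : N.Transition) (σ : List N.Transition) :
    proj s t (t :: σ) = t :: proj s t σ := by
  simp [proj]

lemma mem_of_mem_proj {s t x : N.Transition} {σ : List N.Transition} (h : x ∈ proj s t σ) :
    x ∈ σ := (mem_proj.1 h).1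

/-- The letters of a dependent pair do not both occur in a pair of independent words. -/
lemma proj_eq_nil_or {s t : N.Transition} (hst : ¬ N.Indep s t) {σ τ : List N.Transition}
    (h : ∀ x ∈ σ, ∀ y ∈ τ, N.Indep x y) : proj s t σ = [] ∨ proj s t τ = [] := by
  by_contra! hne
  obtain ⟨x, hx⟩ := List.exists_mem_of_ne_nil _ hne.1
  obtain ⟨y, hy⟩ := List.exists_mem_of_ne_nil _ hne.2
  have h₁ := h x (mem_of_mem_proj hx) y (mem_of_mem_proj hy)
  have h₂ := (mem_proj.1 hx).2
  have h₃ := (mem_proj.1 hy).2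
  rcases h₂ with rfl | rfl <;> rcases h₃ with rfl | rfl
  exacts [not_indep_self _ h₁, hst h₁, hst h₁.symm, not_indep_self _ h₁]

lemma TraceEquiv.proj_eq {σ τ : List N.Transition} (h : N.TraceEquiv σ τ) {s t : N.Transition}
    (hst : ¬ N.Indep s t) : proj s t σ = proj s t τ := by
  induction h with
  | rel x y h =>
    obtain ⟨u, v, a, b, hab, rfl, rfl⟩ := h
    have h₁ : u ++ a :: b :: v = u ++ ([a] ++ ([b] ++ v)) := by simp
    have h₂ : u ++ b :: a :: v = u ++ ([b] ++ ([a] ++ v)) := by simp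
    rw [h₁, h₂]
    simp only [proj_append]
    rcases proj_eq_nil_or hst (σ := [a]) (τ := [b]) (by simpa using hab) with h | h <;> simp [h]
  | refl x => rfl
  | symm x y _ ih => exact ih.symm
  | trans x y z _ _ ih₁ ih₂ => exact ih₁.trans ih₂

/-- The word `σ` represents a prefix of the trace of `τ`. -/
def Below (N : PetriNet) (σ τ : List N.Transition) : Prop := ∃ ρ, N.TraceEquiv (σ ++ ρ) τ

lemma prefix_traceOf {σ τ : List N.Transition} :
    N.Prefix (N.traceOf σ) (N.traceOf τ) ↔ N.Below σ τ := by
  constructor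
  · rintro ⟨σ', ρ, h, h'⟩
    exact ⟨ρ, ((N.traceOf_eq_iff.1 h).symm.append_right ρ).trans (N.traceOf_eq_iff.1 h')⟩
  · rintro ⟨ρ, h⟩
    exact ⟨σ, ρ, rfl, N.traceOf_eq_iff.2 h⟩

namespace Below

variable {σ τ υ : List N.Transition}

lemma append (σ ρ : List N.Transition) : N.Below σ (σ ++ ρ) := ⟨ρ, .refl _⟩

lemma trans (h : N.Below σ τ) (h' : N.Below τ υ) : N.Below σ υ :=
  prefix_traceOf.1 (N.prefix_trans (prefix_traceOf.2 h) (prefix_traceOf.2 h'))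

lemma antisymm (h : N.Below σ τ) (h' : N.Below τ σ) : N.TraceEquiv σ τ :=
  N.traceOf_eq_iff.1 (N.prefix_antisymm (prefix_traceOf.2 h) (prefix_traceOf.2 h'))

lemma length_le (h : N.Below σ τ) : σ.length ≤ τ.length := by
  obtain ⟨ρ, h⟩ := h
  have := (N.traceEquiv_perm h).length_eq
  rw [List.length_append] at this
  omega

end Below

lemma TraceEquiv.below {σ τ : List N.Transition} (h : N.TraceEquiv σ τ) : N.Below σ τ :=
  ⟨[], by rwa [List.append_nil]⟩

/-- The prefix order of traces is determined by the projections to dependent pairs. -/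
lemma below_iff_proj {σ τ : List N.Transition} :
    N.Below σ τ ↔ ∀ s t, ¬ N.Indep s t → proj s t σ <+: proj s t τ := by
  constructor
  · rintro ⟨ρ, h⟩ s t hst
    rw [← h.proj_eq hst, proj_append]
    exact List.prefix_append _ _
  · intro h
    induction σ generalizing τ with
    | nil => exact ⟨τ, .refl _⟩
    | cons a σ ih =>
      have ha : a ∈ τ := by
        have := h a a (not_indep_self a)
        rw [proj_cons_left] at this
        exact mem_of_mem_proj (this.subset (List.mem_cons_self))
      obtain ⟨τ₁, τ₂, rfl, ha₁⟩ := List.eq_append_cons_of_mem ha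
      -- Before the first `a` of `τ` there is no letter `x` dependent on `a`, because the projection
      -- to `x, a` begins with `a`. So this `a` moves to the front and is cancelled.
      have hind : ∀ x ∈ τ₁, N.Indep x a := by
        intro x hx
        by_contra hxa
        have := h x a hxa
        rw [proj_cons_right, proj_append] at this
        have hne : x ∈ proj x a τ₁ := mem_proj.2 ⟨hx, Or.inl rfl⟩
        obtain ⟨y, l, hy⟩ := List.exists_cons_of_ne_nil (List.ne_nil_of_mem hne)
        rw [hy, List.cons_append, List.cons_prefix_cons] at this
        have hmem : y ∈ proj x a τ₁ := by rw [hy]; exact List.mem_cons_self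
        rw [← this.1] at hmem
        exact ha₁ (mem_of_mem_proj hmem)
      have heq : N.TraceEquiv (a :: (τ₁ ++ τ₂)) (τ₁ ++ a :: τ₂) := by
        simpa using (traceEquiv_cons hind).append_right τ₂
      obtain ⟨ρ, hρ⟩ := ih (τ := τ₁ ++ τ₂) (by
        intro s t hst
        have := h s t hst
        rw [← heq.proj_eq hst, ← List.singleton_append, ← List.singleton_append (l := τ₁ ++ τ₂),
          proj_append s t [a], proj_append s t [a]] at this
        exact (List.prefix_append_right_inj _).1 this)
      exact ⟨ρ, (hρ.append_left [a]).trans heq⟩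

lemma traceEquiv_iff_proj {σ τ : List N.Transition} :
    N.TraceEquiv σ τ ↔ ∀ s t, ¬ N.Indep s t → proj s t σ = proj s t τ :=
  ⟨fun h _ _ hst => h.proj_eq hst, fun h => Below.antisymm
    (below_iff_proj.2 fun s t hst => by rw [h s t hst])
    (below_iff_proj.2 fun s t hst => by rw [h s t hst])⟩

lemma TraceEquiv.cancel_right {σ τ ρ : List N.Transition} (h : N.TraceEquiv (σ ++ ρ) (τ ++ ρ)) :
    N.TraceEquiv σ τ :=
  traceEquiv_iff_proj.2 fun s t hst => by
    have := h.proj_eq hst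
    rw [proj_append, proj_append] at this
    exact List.append_cancel_right this

lemma below_append_left_iff {ρ σ τ : List N.Transition} :
    N.Below (ρ ++ σ) (ρ ++ τ) ↔ N.Below σ τ := by
  simp only [below_iff_proj, proj_append, List.prefix_append_right_inj]

/-- Independent extensions have joins. -/
lemma below_append_of_indep {π ρ τ : List N.Transition} {t : N.Transition}
    (h : N.Below (π ++ ρ) τ) (h' : N.Below (π ++ [t]) τ) (hρ : ∀ x ∈ ρ, N.Indep x t) :
    N.Below (π ++ ρ ++ [t]) τ := by
  rw [below_iff_proj] at *
  intro u v huv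
  have h₁ := h u v huv
  have h₂ := h' u v huv
  rw [proj_append] at *
  rcases proj_eq_nil_or huv (σ := ρ) (τ := [t]) (by simpa using hρ) with h₃ | h₃ <;>
    simp_all [proj_append]

/-- Two words with different last letters that represent the same trace. -/
lemma TraceEquiv.exists_of_ne {σ τ : List N.Transition} {a b : N.Transition}
    (h : N.TraceEquiv (σ ++ [a]) (τ ++ [b])) (hab : a ≠ b) :
    N.Indep a b ∧ ∃ π, N.TraceEquiv σ (π ++ [b]) ∧ N.TraceEquiv τ (π ++ [a]) := by
  have hind : N.Indep a b := by
    by_contra hd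
    have := h.proj_eq hd
    rw [proj_append, proj_append, proj_cons_left, proj_cons_right] at this
    have := (List.append_inj' this (by simp [proj])).2
    exact hab (List.cons.inj this).1
  refine ⟨hind, ?_⟩
  have ha : a ∈ τ := by
    have := (N.traceEquiv_perm h).subset (a := a) (by simp)
    simpa [hab] using this
  obtain ⟨τ₂, τ₁, hτ, ha₂⟩ := List.eq_append_cons_of_mem (List.mem_reverse.2 ha)
  obtain ⟨τ₁, rfl⟩ := List.reverse_surjective τ₁
  obtain ⟨τ₂, rfl⟩ := List.reverse_surjective τ₂
  rw [List.mem_reverse] at ha₂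
  obtain rfl : τ = τ₁ ++ a :: τ₂ := by
    apply List.reverse_injective
    simp [hτ]
  -- The displayed `a` is the last one in `τ`. A dependent letter after it would prevent the
  -- projection from ending in `a`.
  have hτ₂ : ∀ x ∈ τ₂, N.Indep x a := by
    intro x hx
    by_contra hd
    have hxb : x ≠ b := fun h => hd (h ▸ hind.symm)
    have := h.proj_eq hd
    rw [proj_append, proj_append, proj_eq_nil (σ := [b]) (by simpa using hxb) (by simpa using hab),
      proj_append, proj_cons_right, proj_cons_right, List.append_nil] at this
    have hne : proj x a τ₂ ≠ [] :=
      List.ne_nil_of_mem (mem_proj.2 ⟨hx, Or.inl rfl⟩)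
    have h₁ := congrArg List.getLast? this
    rw [List.getLast?_append_of_ne_nil _ (by simp), List.getLast?_append_of_ne_nil _ (by simp),
      List.getLast?_cons_of_ne_nil hne] at h₁
    have h₂ : a ∈ proj x a τ₂ := List.mem_of_getLast? (h₁.symm.trans rfl)
    exact ha₂ (mem_of_mem_proj h₂)
  have h₁ : N.TraceEquiv (τ₁ ++ a :: τ₂) (τ₁ ++ τ₂ ++ [a]) := by
    simpa using (traceEquiv_cons hτ₂).append_left τ₁
  refine ⟨τ₁ ++ τ₂, ?_, h₁⟩
  have h₂ : N.TraceEquiv (τ₁ ++ τ₂ ++ [a] ++ [b]) (τ₁ ++ τ₂ ++ [b] ++ [a]) :=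
    Relation.EqvGen.rel _ _ ⟨τ₁ ++ τ₂, [], a, b, hind, by simp, by simp⟩
  exact ((h.trans (h₁.append_right [b])).trans h₂).cancel_right

/-- Prefixes of `σ ++ [t]` that are not prefixes of `σ` end with `t`. -/
lemma below_or_exists {z ρ σ : List N.Transition} {t : N.Transition}
    (h : N.TraceEquiv (z ++ ρ) (σ ++ [t])) :
    N.Below z σ ∨ ∃ z', N.TraceEquiv z (z' ++ [t]) ∧ N.TraceEquiv (z' ++ ρ) σ ∧
      ∀ x ∈ ρ, N.Indep x t := by
  induction ρ using List.reverseRecOn generalizing σ with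
  | nil =>
    rw [List.append_nil] at h
    exact Or.inr ⟨σ, h, by rw [List.append_nil]; exact .refl _, by simp⟩
  | append_singleton ρ b ih =>
    rw [← List.append_assoc] at h
    by_cases hbt : b = t
    · subst hbt
      exact Or.inl ⟨ρ, h.cancel_right⟩
    · obtain ⟨hind, π, h₁, h₂⟩ := h.exists_of_ne hbt
      rcases ih h₁ with h₃ | ⟨z', h₃, h₄, h₅⟩
      · exact Or.inl (h₃.trans ((Below.append π [b]).trans h₂.symm.below))
      · refine Or.inr ⟨z', h₃, ?_, ?_⟩
        · rw [← List.append_assoc]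
          exact (h₄.append_right [b]).trans h₂.symm
        · intro x hx
          rcases List.mem_append.1 hx with hx | hx
          · exact h₅ x hx
          · rw [List.mem_singleton.1 hx]; exact hind

end Traces

end PetriNet

namespace PetriNet

variable {N : PetriNet}

/-! ### Primes -/

/-- Every word that represents the trace of `σ ++ [t]` ends with `t`. -/
def EndsOnlyWith (N : PetriNet) (σ : List N.Transition) (t : N.Transition) : Prop :=
  ∀ τ, N.TraceEquiv τ (σ ++ [t]) → ∃ ρ, τ = ρ ++ [t]

lemma EndsOnlyWith.isPrime {σ : List N.Transition} {t : N.Transition} (h : N.EndsOnlyWith σ t) :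
    N.IsPrime (N.traceOf (σ ++ [t])) :=
  ⟨t, fun _ hτ => h _ (N.traceOf_eq_iff.1 hτ)⟩

lemma IsPrime.exists_word {τ : N.Trace} (h : N.IsPrime τ) :
    ∃ σ t, N.EndsOnlyWith σ t ∧ τ = N.traceOf (σ ++ [t]) := by
  obtain ⟨t, h⟩ := h
  obtain ⟨σ, rfl⟩ := Quotient.exists_rep τ
  obtain ⟨σ, rfl⟩ := h σ rfl
  exact ⟨σ, t, fun τ hτ => h τ (N.traceOf_eq_iff.2 hτ), rfl⟩

lemma EndsOnlyWith.eq {σ τ : List N.Transition} {t u : N.Transition} (h : N.EndsOnlyWith σ t)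
    (h' : N.TraceEquiv (σ ++ [t]) (τ ++ [u])) : t = u := by
  obtain ⟨ρ, h⟩ := h _ h'.symm
  have := (List.append_inj' h rfl).2
  exact (List.cons.inj this).1.symm

lemma not_below_append (σ : List N.Transition) (t : N.Transition) : ¬ N.Below (σ ++ [t]) σ :=
  fun h => by simpa using h.length_le

/-- Appending a letter creates a prime. -/
lemma exists_new_prime (σ : List N.Transition) (t : N.Transition) :
    ∃ ε, N.EndsOnlyWith ε t ∧ N.Below (ε ++ [t]) (σ ++ [t]) ∧ ¬ N.Below (ε ++ [t]) σ := by
  classical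
  -- The prime is a shortest prefix of `σ ++ [t]` that is not a prefix of `σ`.
  have hex : ∃ n, ∃ z : List N.Transition, z.length = n ∧ N.Below z (σ ++ [t]) ∧ ¬ N.Below z σ :=
    ⟨_, _, rfl, TraceEquiv.below (.refl _), not_below_append σ t⟩
  obtain ⟨z, hz, ⟨ρ, h₁⟩, h₂⟩ := Nat.find_spec hex
  have hmin : ∀ y, y.length < z.length → N.Below y (σ ++ [t]) → N.Below y σ := fun y hy h => by
    by_contra h'
    exact Nat.find_min hex (hz ▸ hy) ⟨y, rfl, h, h'⟩
  obtain ⟨ε, hε, h₃, -⟩ := (below_or_exists h₁).resolve_left h₂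
  have hlen := (N.traceEquiv_perm hε).length_eq
  refine ⟨ε, fun τ hτ => ?_, hε.symm.below.trans ⟨ρ, h₁⟩, fun h => h₂ (hε.below.trans h)⟩
  rcases List.eq_nil_or_concat τ with rfl | ⟨τ, b, rfl⟩
  · simpa using (N.traceEquiv_perm hτ).length_eq
  rw [List.concat_eq_append] at hτ ⊢
  by_cases hb : b = t
  · exact ⟨τ, by rw [hb]⟩
  obtain ⟨hind, π, h₄, h₅⟩ := hτ.exists_of_ne hb
  refine absurd ?_ h₂
  -- If the prefix could also end in `b ≠ t`, then `π ++ [t]` and `π ++ [b]`, both shorter, would be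
  -- below `σ`, and so would their join, which is the prefix itself.
  have h₆ : N.Below τ σ := by
    have hlen' := (N.traceEquiv_perm (hε.trans hτ.symm)).length_eq
    refine hmin τ ?_ ((Below.append τ [b]).trans (hτ.below.trans (hε.symm.below.trans ⟨ρ, h₁⟩)))
    rw [hlen']; simp
  have h₇ : N.Below (π ++ [b] ++ [t]) σ :=
    below_append_of_indep (h₅.symm.below.trans ⟨ρ, h₃⟩) (h₄.symm.below.trans h₆)
      (by simpa using hind)
  exact (hε.trans (h₅.append_right [t])).below.trans h₇

/-- A prefix that needs the last letter `b` ends in `b`; a prime ending only in `t ≠ b` does not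
need it. -/
lemma EndsOnlyWith.below_of_append {ε z ρ : List N.Transition} {t : N.Transition}
    (h : N.EndsOnlyWith ε t) (h' : N.Below (ε ++ [t]) (z ++ ρ)) (hρ : t ∉ ρ) :
    N.Below (ε ++ [t]) z := by
  induction ρ using List.reverseRecOn with
  | nil => rwa [List.append_nil] at h'
  | append_singleton ρ b ih =>
    rw [List.mem_append, List.mem_singleton, not_or] at hρ
    rw [← List.append_assoc] at h'
    obtain ⟨κ, h'⟩ := h'
    rcases below_or_exists h' with h₁ | ⟨z', h₁, -⟩
    · exact ih h₁ hρ.1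
    · exact absurd (h.eq h₁) hρ.2

lemma EndsOnlyWith.eq_of_new {ε σ : List N.Transition} {t u : N.Transition}
    (h : N.EndsOnlyWith ε u) (h₁ : N.Below (ε ++ [u]) (σ ++ [t])) (h₂ : ¬ N.Below (ε ++ [u]) σ) :
    u = t := by
  obtain ⟨κ, h₁⟩ := h₁
  obtain ⟨z', h₃, -⟩ := (below_or_exists h₁).resolve_left h₂
  exact h.eq h₃

/-- The complement of `z` in `σ ++ [t]` consists of letters independent of `t`, so it can be
stripped off above a prime ending in `t`. Applied both ways, this shows that only one new prime
appears. -/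
lemma EndsOnlyWith.below_of_new {ε σ z : List N.Transition} {t u : N.Transition}
    (h : N.EndsOnlyWith ε u) (h₁ : N.Below (ε ++ [u]) (σ ++ [t])) (h₂ : ¬ N.Below (ε ++ [u]) σ)
    (h₃ : N.Below z (σ ++ [t])) (h₄ : ¬ N.Below z σ) : N.Below (ε ++ [u]) z := by
  obtain rfl := h.eq_of_new h₁ h₂
  obtain ⟨ρ, h₃⟩ := h₃
  obtain ⟨z', -, -, hρ⟩ := (below_or_exists h₃).resolve_left h₄
  exact h.below_of_append (h₁.trans h₃.symm.below) fun hu => not_indep_self _ (hρ _ hu)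

/-- A trace is the join of the primes below it: `σ ++ [t]` is the join of `σ` and the new prime,
since `t` commutes with the rest of `σ`. -/
lemma below_of_forall_prime {σ τ : List N.Transition}
    (h : ∀ ε t, N.EndsOnlyWith ε t → N.Below (ε ++ [t]) σ → N.Below (ε ++ [t]) τ) :
    N.Below σ τ := by
  induction σ using List.reverseRecOn with
  | nil => exact ⟨τ, .refl _⟩
  | append_singleton σ t ih =>
    have hσ := ih fun ε u hε hσ => h ε u hε (hσ.trans (Below.append σ [t]))
    obtain ⟨ε, hε, ⟨ρ, h₁⟩, h₂⟩ := exists_new_prime σ t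
    obtain ⟨ε', h₃, h₄, hρ⟩ := (below_or_exists h₁).resolve_left h₂
    have h₅ := h ε t hε ⟨ρ, h₁⟩
    exact (h₄.symm.append_right [t]).below.trans (below_append_of_indep (h₄.below.trans hσ)
      (h₃.symm.below.trans h₅) hρ)

/-- A prime that is compatible with all primes below a trace, and whose proper prefixes are below
it, commutes with the rest of the trace. -/
lemma indep_of_compatible {π ρ σ : List N.Transition} {t : N.Transition}
    (hne : ¬ N.Below (π ++ [t]) σ) (hρ : N.Below (π ++ ρ) σ)
    (hcomp : ∀ ε u, N.EndsOnlyWith ε u → N.Below (ε ++ [u]) σ →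
      ∃ z, N.Below (ε ++ [u]) z ∧ N.Below (π ++ [t]) z) : ∀ x ∈ ρ, N.Indep x t := by
  induction ρ using List.reverseRecOn with
  | nil => simp
  | append_singleton ρ s ih =>
    rw [← List.append_assoc] at hρ
    have ih := ih ((Below.append _ [s]).trans hρ)
    intro x hx
    rcases List.mem_append.1 hx with hx | hx
    · exact ih x hx
    rw [List.mem_singleton.1 hx]
    by_contra hst
    by_cases hs : s = t
    · subst hs
      refine hne (Below.trans ⟨ρ, ?_⟩ hρ)
      simpa using (traceEquiv_cons ih).append_left π
    · obtain ⟨ε, hε, ⟨κ, h₁⟩, h₂⟩ := exists_new_prime (π ++ ρ) s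
      obtain ⟨-, -, -, hκ⟩ := (below_or_exists h₁).resolve_left h₂
      obtain ⟨z, hz, hz'⟩ := hcomp ε s hε (Below.trans ⟨κ, h₁⟩ hρ)
      -- On the dependent pair `s, t`, the common extension `z` would have to continue the
      -- projection of `π` both with `s` and with `t`.
      have h₃ := below_iff_proj.1 hz s t hst
      have h₄ := below_iff_proj.1 hz' s t hst
      have h₅ := h₁.proj_eq hst
      have h₆ : proj s t κ = [] :=
        proj_eq_nil (fun h => not_indep_self _ (hκ _ h)) fun h => hst (hκ _ h).symm
      have h₇ : proj s t ρ = [] :=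
        proj_eq_nil (fun h => hst (ih _ h)) fun h => not_indep_self _ (ih _ h)
      rw [proj_append _ _ (ε ++ [s]), h₆, proj_append _ _ (π ++ ρ), proj_append _ _ π, h₇,
        List.append_nil, List.append_nil, proj_cons_left] at h₅
      rw [h₅] at h₃
      rw [proj_append, proj_cons_right] at h₄
      have := List.prefix_of_prefix_length_le h₃ h₄ (by simp [proj])
      rw [List.prefix_append_right_inj, List.cons_prefix_cons] at this
      exact hs this.1

/-! ### Firing -/

lemma Fire.unique {M M₁ M₂ : N.Place → ℕ} {t : N.Transition} (h : N.Fire M t M₁)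
    (h' : N.Fire M t M₂) : M₁ = M₂ := by
  funext s
  have h₁ := (h s).2
  have h₂ := (h' s).2
  omega

lemma fireSeq_append {M M' : N.Place → ℕ} {σ ρ : List N.Transition} :
    N.FireSeq M (σ ++ ρ) M' ↔ ∃ M₁, N.FireSeq M σ M₁ ∧ N.FireSeq M₁ ρ M' := by
  induction σ generalizing M with
  | nil => exact ⟨fun h => ⟨M, rfl, h⟩, by rintro ⟨_, rfl, h⟩; exact h⟩
  | cons t σ ih =>
    constructor
    · rintro ⟨M₁, h₁, h₂⟩
      obtain ⟨M₂, h₃, h₄⟩ := ih.1 h₂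
      exact ⟨M₂, ⟨M₁, h₁, h₃⟩, h₄⟩
    · rintro ⟨M₂, ⟨M₁, h₁, h₃⟩, h₄⟩
      exact ⟨M₁, h₁, ih.2 ⟨M₂, h₃, h₄⟩⟩

lemma FireSeq.unique {M M₁ M₂ : N.Place → ℕ} {σ : List N.Transition} (h : N.FireSeq M σ M₁)
    (h' : N.FireSeq M σ M₂) : M₁ = M₂ := by
  induction σ generalizing M with
  | nil => exact (show M₁ = M from h).trans (show M₂ = M from h').symm
  | cons t σ ih =>
    obtain ⟨M₃, h₁, h₂⟩ := h
    obtain ⟨M₄, h₃, h₄⟩ := h'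
    rw [h₁.unique h₃] at h₂
    exact ih h₂ h₄

/-- Each place is touched by at most one of the two transitions, so their firings do not interact
there. -/
lemma Indep.indicator_eq_zero {a b : N.Transition} (h : N.Indep a b) (s : N.Place) :
    ((N.pre a).indicator (1 : N.Place → ℕ) s = 0 ∧ (N.post a).indicator (1 : N.Place → ℕ) s = 0) ∨
    ((N.pre b).indicator (1 : N.Place → ℕ) s = 0 ∧
      (N.post b).indicator (1 : N.Place → ℕ) s = 0) := by
  by_cases hs : s ∈ N.pre a ∪ N.post a
  · have := Set.disjoint_left.1 h.2 hs
    rw [Set.mem_union, not_or] at this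
    exact Or.inr ⟨Set.indicator_of_notMem this.1 _, Set.indicator_of_notMem this.2 _⟩
  · rw [Set.mem_union, not_or] at hs
    exact Or.inl ⟨Set.indicator_of_notMem hs.1 _, Set.indicator_of_notMem hs.2 _⟩

/-- Independent transitions that are both enabled can be fired one after the other. -/
lemma Fire.diamond {M M₁ M₂ : N.Place → ℕ} {a b : N.Transition} (hab : N.Indep a b)
    (h₁ : N.Fire M a M₁) (h₂ : N.Fire M b M₂) : ∃ M₃, N.Fire M₁ b M₃ := by
  refine ⟨fun s => M₁ s + (N.post b).indicator 1 s - (N.pre b).indicator 1 s, fun s => ?_⟩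
  have h₁ := h₁ s
  have h₂ := h₂ s
  rcases hab.indicator_eq_zero s with h | h <;> constructor <;> (try dsimp only) <;> omega

lemma Fire.swap {M M₁ M₂ : N.Place → ℕ} {a b : N.Transition} (hab : N.Indep a b)
    (h₁ : N.Fire M a M₁) (h₂ : N.Fire M₁ b M₂) : ∃ M₃, N.Fire M b M₃ ∧ N.Fire M₃ a M₂ := by
  refine ⟨fun s => M s + (N.post b).indicator 1 s - (N.pre b).indicator 1 s, fun s => ?_,
    fun s => ?_⟩ <;> have h₁ := h₁ s <;> have h₂ := h₂ s <;>
    rcases hab.indicator_eq_zero s with h | h <;> constructor <;> (try dsimp only) <;> omega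

lemma FireSeq.of_traceEquiv {M M' : N.Place → ℕ} {σ τ : List N.Transition}
    (h : N.TraceEquiv σ τ) : N.FireSeq M σ M' ↔ N.FireSeq M τ M' := by
  have key : ∀ {u v : List N.Transition} {a b}, N.Indep a b →
      N.FireSeq M (u ++ a :: b :: v) M' → N.FireSeq M (u ++ b :: a :: v) M' := by
    intro u v a b hab hf
    obtain ⟨M₁, h₁, M₂, h₂, M₃, h₃, h₄⟩ := fireSeq_append.1 hf
    obtain ⟨M₄, h₅, h₆⟩ := h₂.swap hab h₃
    exact fireSeq_append.2 ⟨M₁, h₁, M₄, h₅, M₃, h₆, h₄⟩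
  induction h with
  | rel x y h =>
    obtain ⟨u, v, a, b, hab, rfl, rfl⟩ := h
    exact ⟨key hab, key hab.symm⟩
  | refl x => rfl
  | symm x y _ ih => exact ih.symm
  | trans x y z _ _ ih₁ ih₂ => exact ih₁.trans ih₂

lemma FireSeq.exists_append {M M₁ M₂ : N.Place → ℕ} {t : N.Transition} {ρ : List N.Transition}
    (h₁ : N.Fire M t M₁) (h₂ : N.FireSeq M ρ M₂) (hρ : ∀ x ∈ ρ, N.Indep x t) :
    ∃ M₃, N.FireSeq M (ρ ++ [t]) M₃ := by
  induction ρ generalizing M M₁ with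
  | nil => exact ⟨M₁, M₁, h₁, rfl⟩
  | cons x ρ ih =>
    obtain ⟨M₄, h₃, h₄⟩ := h₂
    obtain ⟨M₅, h₅⟩ := h₃.diamond (hρ x (by simp)) h₁
    obtain ⟨M₆, h₆⟩ := ih h₅ h₄ fun y hy => hρ y (by simp [hy])
    exact ⟨M₆, M₄, h₃, h₆⟩

lemma IsFiringSequence.of_below {σ τ : List N.Transition} (h : N.IsFiringSequence τ)
    (h' : N.Below σ τ) : N.IsFiringSequence σ := by
  obtain ⟨M, h⟩ := h
  obtain ⟨ρ, h'⟩ := h'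
  obtain ⟨M₁, h₁, -⟩ := fireSeq_append.1 ((FireSeq.of_traceEquiv h').2 h)
  exact ⟨M₁, h₁⟩

lemma isFiringTrace_traceOf {σ : List N.Transition} :
    N.IsFiringTrace (N.traceOf σ) ↔ N.IsFiringSequence σ :=
  ⟨fun ⟨_, h, h'⟩ => h.of_below (N.traceOf_eq_iff.1 h'.symm).below, fun h => ⟨σ, h, rfl⟩⟩

lemma IsFiringSequence.append {π ρ σ : List N.Transition} {t : N.Transition}
    (hσ : N.IsFiringSequence σ) (h : N.TraceEquiv (π ++ ρ) σ) (ht : N.IsFiringSequence (π ++ [t]))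
    (hρ : ∀ x ∈ ρ, N.Indep x t) : N.IsFiringSequence (σ ++ [t]) := by
  obtain ⟨M, hM⟩ := hσ
  obtain ⟨M₁, h₁, h₂⟩ := fireSeq_append.1 ((FireSeq.of_traceEquiv h).2 hM)
  obtain ⟨M₂, M₃, h₃, M₄, h₄, -⟩ := ht.imp fun _ h => fireSeq_append.1 h
  rw [h₃.unique h₁] at h₄
  obtain ⟨M₅, h₅⟩ := h₂.exists_append h₄ hρ
  refine ⟨M₅, (FireSeq.of_traceEquiv (h.append_right [t])).1 ?_⟩
  rw [List.append_assoc]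
  exact fireSeq_append.2 ⟨M₁, h₁, h₅⟩

end PetriNet

namespace PetriNet

variable {N : PetriNet}

/-! ### The domain of the event structure of a net -/

/-- The traces of firing sequences. -/
abbrev FiringTrace (N : PetriNet) : Type := {τ : N.Trace // N.IsFiringTrace τ}

instance : PartialOrder N.FiringTrace where
  le x y := N.Prefix x.1 y.1
  le_refl x := N.prefix_refl x.1
  le_trans _ _ _ h h' := N.prefix_trans h h'
  le_antisymm _ _ h h' := Subtype.ext (N.prefix_antisymm h h')

/-- The trace of a firing sequence. -/
def firingTrace (σ : List N.Transition) (h : N.IsFiringSequence σ) : N.FiringTrace :=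
  ⟨N.traceOf σ, isFiringTrace_traceOf.2 h⟩

lemma firingTrace_le {σ τ : List N.Transition} {hσ : N.IsFiringSequence σ}
    {hτ : N.IsFiringSequence τ} : firingTrace σ hσ ≤ firingTrace τ hτ ↔ N.Below σ τ :=
  prefix_traceOf

lemma FiringTrace.exists_eq (x : N.FiringTrace) : ∃ σ h, x = firingTrace σ h := by
  obtain ⟨_, σ, h, rfl⟩ := x
  exact ⟨σ, h, rfl⟩

lemma FiringTrace.exists_of_isPrime {x : N.FiringTrace} (hx : N.IsPrime x.1) :
    ∃ σ t h, N.EndsOnlyWith σ t ∧ x = firingTrace (σ ++ [t]) h := by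
  obtain ⟨σ, t, h, hx'⟩ := hx.exists_word
  exact ⟨σ, t, isFiringTrace_traceOf.1 (hx' ▸ x.2), h, Subtype.ext hx'⟩

lemma FiringTrace.le_of_forall_isPrime {x y : N.FiringTrace}
    (h : ∀ e : N.FiringTrace, N.IsPrime e.1 → e ≤ x → e ≤ y) : x ≤ y := by
  obtain ⟨σ, hσ, rfl⟩ := x.exists_eq
  obtain ⟨τ, hτ, rfl⟩ := y.exists_eq
  exact firingTrace_le.2 (below_of_forall_prime fun ε t hε hle =>
    firingTrace_le.1 (h (firingTrace _ (hσ.of_below hle)) hε.isPrime (firingTrace_le.2 hle)))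

/-- The primes below `σ ++ [t]`. -/
lemma le_firingTrace_append {σ : List N.Transition} {t : N.Transition}
    {h : N.IsFiringSequence (σ ++ [t])} {h' : N.IsFiringSequence σ} {e d : N.FiringTrace}
    (he : N.IsPrime e.1) (h₁ : e ≤ firingTrace _ h) (h₂ : ¬ e ≤ firingTrace _ h')
    (hd : N.IsPrime d.1) : d ≤ firingTrace _ h ↔ d ≤ firingTrace _ h' ∨ d = e := by
  constructor
  · intro h₃
    by_cases h₄ : d ≤ firingTrace _ h'
    · exact Or.inl h₄
    obtain ⟨ε, u, hu, hε, rfl⟩ := FiringTrace.exists_of_isPrime he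
    obtain ⟨δ, v, hv, hδ, rfl⟩ := FiringTrace.exists_of_isPrime hd
    rw [firingTrace_le] at h₁ h₂ h₃ h₄
    exact Or.inr (le_antisymm (firingTrace_le.2 (hδ.below_of_new h₃ h₄ h₁ h₂))
      (firingTrace_le.2 (hε.below_of_new h₁ h₂ h₃ h₄)))
  · rintro (h₃ | rfl)
    · exact h₃.trans (firingTrace_le.2 (Below.append _ _))
    · exact h₁

lemma finite_Iic (x : N.FiringTrace) : (Set.Iic x).Finite :=
  ((N.finite_prefixes x.1).preimage (f := Subtype.val) Subtype.val_injective.injOn).subset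
    fun _ h => h

/-- For `e` the trace of `π ++ [t]`, all primes below `π` are below `x`, so `π` is a prefix of `x`.
Compatibility makes `t` commute with the remainder, hence `t` can still fire after `x`, and this
adds just the prime `e`. -/
lemma exists_extension {x e : N.FiringTrace} (he : N.IsPrime e.1)
    (hlow : ∀ d : N.FiringTrace, N.IsPrime d.1 → d < e → d ≤ x)
    (hcomp : ∀ d : N.FiringTrace, N.IsPrime d.1 → d ≤ x → ∃ z, d ≤ z ∧ e ≤ z) :
    ∃ y, ∀ d : N.FiringTrace, N.IsPrime d.1 → (d ≤ y ↔ d ≤ x ∨ d = e) := by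
  by_cases hex : e ≤ x
  · exact ⟨x, fun d _ => ⟨Or.inl, fun h => h.elim id fun h => h ▸ hex⟩⟩
  obtain ⟨π, t, ht, hπ, rfl⟩ := FiringTrace.exists_of_isPrime he
  obtain ⟨σ, hσ, rfl⟩ := x.exists_eq
  rw [firingTrace_le] at hex
  have h₀ : N.IsFiringSequence π := ht.of_below (Below.append _ _)
  have h₁ : firingTrace π h₀ ≤ firingTrace σ hσ := by
    refine FiringTrace.le_of_forall_isPrime fun d hd hdπ => hlow d hd ?_
    refine lt_of_le_of_ne (hdπ.trans (firingTrace_le.2 (Below.append _ _))) ?_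
    rintro rfl
    exact not_below_append π t (firingTrace_le.1 hdπ)
  obtain ⟨ρ, hρ⟩ := firingTrace_le.1 h₁
  have hind := indep_of_compatible hex hρ.below fun ε u hε hu => by
    obtain ⟨z, hz, hz'⟩ := hcomp (firingTrace _ (hσ.of_below hu)) hε.isPrime (firingTrace_le.2 hu)
    obtain ⟨τ, hτ, rfl⟩ := z.exists_eq
    exact ⟨τ, firingTrace_le.1 hz, firingTrace_le.1 hz'⟩
  refine ⟨firingTrace (σ ++ [t]) (hσ.append hρ ht hind), fun d hd =>
    le_firingTrace_append he (firingTrace_le.2 ⟨ρ, ?_⟩) (mt firingTrace_le.1 hex) hd⟩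
  have := (traceEquiv_cons hind).append_left π
  rw [← List.append_assoc] at this
  rw [List.append_assoc, List.singleton_append]
  exact this.trans (hρ.append_right [t])

lemma isFiringSequence_nil : N.IsFiringSequence [] := ⟨_, rfl⟩

/-- The configurations of the event structure of a net are the firing traces. -/
theorem exists_domain_orderIso (N : PetriNet) :
    ∃ f : N.FiringTrace ≃o N.eventStructure.Domain, ∀ x e, e ∈ (f x).1 ↔ N.Prefix e.1 x.1 := by
  obtain ⟨f, hf⟩ := EventStructure.domain_orderIso_of_representation
    (firingTrace (N := N) [] isFiringSequence_nil)
    (fun x => by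
      obtain ⟨σ, hσ, rfl⟩ := x.exists_eq
      exact firingTrace_le.2 (Below.append [] σ))
    (fun x : N.FiringTrace => N.IsPrime x.1) finite_Iic
    (fun ⟨t, h⟩ => by
      obtain ⟨ρ, h⟩ := h [] rfl
      simp at h)
    (fun _ _ => FiringTrace.le_of_forall_isPrime) fun _ _ => exists_extension
  let g : EventStructure.Iso (EventStructure.ofPoset N.FiringTrace (fun x => N.IsPrime x.1)
      finite_Iic) N.eventStructure :=
    { toFun := fun e => ⟨e.1.1, e.1.2, e.2⟩
      invFun := fun e => ⟨⟨e.1, e.2.1⟩, e.2.2⟩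
      left_inv := fun _ => rfl
      right_inv := fun _ => rfl
      map_rel_iff' := Iff.rfl
      map_conflict_iff := fun e e' => not_congr
        ⟨fun ⟨τ, h, h₁, h₂⟩ => ⟨⟨τ, h⟩, h₁, h₂⟩, fun ⟨z, h₁, h₂⟩ => ⟨z.1, z.2, h₁, h₂⟩⟩ }
  refine ⟨f.trans g.domain, fun x e => ?_⟩
  constructor
  · rintro ⟨e, he, rfl⟩
    exact (hf x e).1 he
  · intro h
    exact ⟨⟨⟨e.1, e.2.1⟩, e.2.2⟩, (hf x _).2 h, rfl⟩

end PetriNet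

namespace PetriNet

variable {N : PetriNet}

/-! ### The labeling of the event structure of a net by transitions -/

/-- The last letter of an event. -/
noncomputable def lastLetter (e : N.eventStructure.Event) : N.Transition := e.2.2.choose

lemma lastLetter_eq {e : N.eventStructure.Event} {σ : List N.Transition} {t : N.Transition}
    (h : e.1 = N.traceOf (σ ++ [t])) : lastLetter e = t := by
  obtain ⟨ρ, hρ⟩ := e.2.2.choose_spec (σ ++ [t]) h.symm
  exact (List.cons.inj (List.append_inj' hρ rfl).2).1.symm

section

variable (f : N.FiringTrace ≃o N.eventStructure.Domain)
  (hf : ∀ x e, e ∈ (f x).1 ↔ N.Prefix e.1 x.1)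

include hf

lemma mem_domain_iff {x : N.FiringTrace} {e : N.FiringTrace} (he : N.IsPrime e.1) :
    (⟨e.1, e.2, he⟩ : N.eventStructure.Event) ∈ (f x).1 ↔ e ≤ x := hf _ _

lemma lstep_append {σ : List N.Transition} {t : N.Transition} (h : N.IsFiringSequence σ)
    (h' : N.IsFiringSequence (σ ++ [t])) : N.eventStructure.LStep lastLetter
      (f (firingTrace σ h)) (f (firingTrace (σ ++ [t]) h')) t := by
  obtain ⟨ε, hε, h₁, h₂⟩ := exists_new_prime σ t
  let e : N.FiringTrace := firingTrace (ε ++ [t]) (h'.of_below h₁)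
  have he : N.IsPrime e.1 := hε.isPrime
  refine ⟨⟨e.1, e.2, he⟩, ?_, ?_, lastLetter_eq rfl⟩
  · exact fun hm => h₂ (firingTrace_le.1 ((mem_domain_iff f hf he).1 hm))
  · ext d
    have hd : d ∈ (f (firingTrace (σ ++ [t]) h')).1 ↔ _ :=
      (mem_domain_iff f hf (e := ⟨d.1, d.2.1⟩) d.2.2).trans
        (le_firingTrace_append (h' := h) he (firingTrace_le.2 h₁) (mt firingTrace_le.1 h₂) d.2.2)
    refine hd.trans (or_comm.trans (or_congr ⟨fun h => Subtype.ext ?_, fun h => Subtype.ext ?_⟩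
      (mem_domain_iff f hf (e := ⟨d.1, d.2.1⟩) d.2.2).symm))
    · exact congrArg (fun z : N.FiringTrace => z.1) h
    · exact congrArg (fun z : N.eventStructure.Event => z.1) h

/-- Adding one event is firing one transition: the first letter of the continuation creates a new
prime, which must be the added event, so all primes of `y` are already present after that letter. -/
lemma eq_of_lstep {σ : List N.Transition} {h : N.IsFiringSequence σ} {y : N.FiringTrace}
    {t : N.Transition}
    (hs : N.eventStructure.LStep lastLetter (f (firingTrace σ h)) (f y) t) :
    ∃ h', y = firingTrace (σ ++ [t]) h' := by
  obtain ⟨e, hex, hy, rfl⟩ := hs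
  have hxy : firingTrace σ h ≤ y := by
    rw [← f.le_iff_le]
    change (f (firingTrace σ h)).1 ⊆ (f y).1
    rw [hy]
    exact Set.subset_insert _ _
  obtain ⟨τ, hτ, rfl⟩ := y.exists_eq
  obtain ⟨ρ, hρ⟩ := firingTrace_le.1 hxy
  rcases ρ with _ | ⟨b, ρ⟩
  · rw [List.append_nil] at hρ
    have hle : f (firingTrace τ hτ) ≤ f (firingTrace σ h) :=
      f.le_iff_le.2 (firingTrace_le.2 hρ.symm.below)
    exact absurd (hle (by rw [hy]; exact Set.mem_insert _ _)) hex
  have hb : N.Below (σ ++ [b]) τ := ⟨ρ, by simpa using hρ⟩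
  have hmem : ∀ d, d ∈ (f (firingTrace τ hτ)).1 ↔ d = e ∨ d ∈ (f (firingTrace σ h)).1 := fun d => by
    rw [hy, Set.mem_insert_iff]
  obtain ⟨ε, hε, h₁, h₂⟩ := exists_new_prime σ b
  have hd := (hmem ⟨_, isFiringTrace_traceOf.2 (hτ.of_below (h₁.trans hb)), hε.isPrime⟩).1
    ((hf _ _).2 (prefix_traceOf.2 (h₁.trans hb)))
  have hd := hd.resolve_right fun h' => h₂ (prefix_traceOf.1 ((hf _ _).1 h'))
  have ht : lastLetter e = b := by rw [← hd]; exact lastLetter_eq rfl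
  rw [ht]
  refine ⟨hτ.of_below hb, le_antisymm ?_ (firingTrace_le.2 hb)⟩
  refine FiringTrace.le_of_forall_isPrime fun d hdp hdτ => ?_
  rcases (hmem ⟨d.1, d.2, hdp⟩).1 ((mem_domain_iff f hf hdp).2 hdτ) with h₃ | h₃
  · rw [← hd] at h₃
    have : d = firingTrace (ε ++ [b]) (hτ.of_below (h₁.trans hb)) :=
      Subtype.ext (congrArg (fun z : N.eventStructure.Event => z.1) h₃)
    rw [this]
    exact firingTrace_le.2 h₁
  · exact ((mem_domain_iff f hf hdp).1 h₃).trans (firingTrace_le.2 (Below.append _ _))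

/-- Equal last letters extend the firing trace in the same way, so they give the same configuration.
-/
lemma isNice_lastLetter : N.eventStructure.IsNice lastLetter := by
  rintro e e' hne ⟨c, ⟨he, hc⟩, he', hc'⟩ hlab
  obtain ⟨x, rfl⟩ := f.surjective c
  obtain ⟨σ, hσ, rfl⟩ := x.exists_eq
  obtain ⟨y, hy⟩ := f.surjective ⟨_, hc⟩
  obtain ⟨y', hy'⟩ := f.surjective ⟨_, hc'⟩
  obtain ⟨g₁, h₁⟩ := eq_of_lstep f hf (y := y) ⟨e, he, by rw [hy], rfl⟩
  obtain ⟨g₂, h₂⟩ := eq_of_lstep f hf (y := y') ⟨e', he', by rw [hy'], rfl⟩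
  have heq : f y = f y' := by
    rw [h₁, h₂]
    congr 1
    exact Subtype.ext (by simp only [firingTrace, hlab])
  rw [hy, hy'] at heq
  exact ((Set.ext_iff.1 (congrArg Subtype.val heq) e).1 (Set.mem_insert _ _)).elim hne he

/-- Configurations with the same marking have the same future. -/
lemma filterEquiv_of_fireSeq {σ σ' : List N.Transition} {M : N.Place → ℕ}
    (h : N.FireSeq N.init σ M) (h' : N.FireSeq N.init σ' M) :
    N.eventStructure.FilterEquiv lastLetter (f (firingTrace σ ⟨M, h⟩))
      (f (firingTrace σ' ⟨M, h'⟩)) := by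
  -- The words that can be fired after `σ` depend only on `M`, so they parametrize both filters.
  have hfire : ∀ {σ}, N.FireSeq N.init σ M → ∀ ρ, (∃ M', N.FireSeq M ρ M') ↔
      N.IsFiringSequence (σ ++ ρ) := fun {σ} h ρ => by
    refine ⟨fun ⟨M', h₁⟩ => ⟨M', fireSeq_append.2 ⟨M, h, h₁⟩⟩, fun ⟨M', h₁⟩ => ?_⟩
    obtain ⟨M₁, h₁, h₂⟩ := fireSeq_append.1 h₁
    exact ⟨M', h₁.unique h ▸ h₂⟩
  let F : ∀ σ, ∀ h : N.FireSeq N.init σ M, {ρ : List N.Transition // ∃ M', N.FireSeq M ρ M'} →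
      Set.Ici (f (firingTrace σ ⟨M, h⟩)) := fun σ h ρ =>
    ⟨f (firingTrace (σ ++ ρ.1) ((hfire h ρ.1).1 ρ.2)),
      f.le_iff_le.2 (firingTrace_le.2 (Below.append _ _))⟩
  have hsurj : ∀ σ h, Function.Surjective (F σ h) := by
    rintro σ h ⟨c, hc⟩
    obtain ⟨y, rfl⟩ := f.surjective c
    obtain ⟨τ, hτ, rfl⟩ := y.exists_eq
    obtain ⟨ρ, hρ⟩ := firingTrace_le.1 (f.le_iff_le.1 hc)
    exact ⟨⟨ρ, (hfire h ρ).2 (hτ.of_below hρ.below)⟩,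
      Subtype.ext (congrArg f (Subtype.ext (N.traceOf_eq_iff.2 hρ)))⟩
  -- Left cancellation of traces removes `σ` from the order.
  have hle : ∀ σ h a b, F σ h a ≤ F σ h b ↔ N.Below a.1 b.1 := fun σ h a b =>
    (f.le_iff_le.trans firingTrace_le).trans below_append_left_iff
  have heq : ∀ σ h a b, F σ h a = F σ h b ↔ N.Below a.1 b.1 ∧ N.Below b.1 a.1 := fun σ h a b =>
    le_antisymm_iff.trans (and_congr (hle σ h a b) (hle σ h b a))
  obtain ⟨G, hG⟩ := DirectedSquareComplex.exists_orderIso_of_surjective (F σ h) (F σ' h')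
    (hsurj σ h) (hsurj σ' h')
    (fun a b => (heq σ h a b).trans (heq σ' h' a b).symm)
    (fun a b => (hle σ h a b).trans (hle σ' h' a b).symm)
  refine ⟨G, fun x y t hst => ?_⟩
  obtain ⟨ρ, rfl⟩ := hsurj σ h x
  obtain ⟨y₀, hy₀⟩ := f.surjective y.1
  rw [← hy₀] at hst
  obtain ⟨h₁, rfl⟩ := eq_of_lstep f hf hst
  have h₂ : N.IsFiringSequence (σ ++ (ρ.1 ++ [t])) := by rwa [← List.append_assoc]
  have hy : y = F σ h ⟨ρ.1 ++ [t], (hfire h _).2 h₂⟩ := by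
    refine Subtype.ext (hy₀.symm.trans (congrArg f (Subtype.ext ?_)))
    simp only [firingTrace, List.append_assoc]
  rw [hy, hG, hG]
  have h₃ : N.IsFiringSequence (σ' ++ ρ.1 ++ [t]) := by
    rw [List.append_assoc, ← hfire h', hfire h]
    exact h₂
  have := lstep_append f hf ((hfire h' ρ.1).1 ρ.2) h₃
  convert this using 1
  refine congrArg f (Subtype.ext ?_)
  simp only [firingTrace, List.append_assoc]

end

/-- The event structure of a finite 1-safe net has a nice labeling with finitely many types of
filters. -/
theorem OneSafe.exists_finite_invariant (hN : N.IsFinite) (hs : N.OneSafe) :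
    ∃ (A : Type) (lab : N.eventStructure.Event → A) (S : Type) (κ : N.eventStructure.Domain → S),
      Finite S ∧ N.eventStructure.IsNice lab ∧
        ∀ c c', κ c = κ c' → N.eventStructure.FilterEquiv lab c c' := by
  obtain ⟨f, hf⟩ := N.exists_domain_orderIso
  have hrep : ∀ c, ∃ σ M, ∃ h : N.FireSeq N.init σ M, c = f (firingTrace σ ⟨M, h⟩) := by
    intro c
    obtain ⟨x, rfl⟩ := f.surjective c
    obtain ⟨σ, ⟨M, h⟩, rfl⟩ := x.exists_eq
    exact ⟨σ, M, h, rfl⟩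
  choose σ M h hc using hrep
  have := hN.1
  -- By 1-safety a reachable marking is a map to `{0, 1}`; the invariant is the marking reached by a
  -- chosen representative.
  refine ⟨_, lastLetter, N.Place → Fin 2,
    fun c s => ⟨M c s, Nat.lt_succ_of_le (hs _ _ (h c) s)⟩, inferInstance,
    isNice_lastLetter f hf, fun c c' hcc => ?_⟩
  have hM : M c = M c' := funext fun s => congrArg Fin.val (congrFun hcc s)
  have h' : N.FireSeq N.init (σ c') (M c) := hM ▸ h c'
  have := filterEquiv_of_fireSeq f hf (h c) h'
  rw [← hc] at this
  rw [hc c']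
  exact this

end PetriNet

/-- Wise's event structure is not the event structure of a finite 1-safe net. -/
theorem Wise.not_isOfFiniteOneSafeNet {r : WiseColor → ℕ} (hr : Function.Injective r)
    {E : EventStructure} (hE : E.HasDomain (Wise.Tips r)) : ¬ E.IsOfFiniteOneSafeNet := by
  rintro ⟨N, hN, hs, ⟨g⟩⟩
  obtain ⟨A, lab, S, κ, hS, hn, hκ⟩ := hs.exists_finite_invariant hN
  exact not_exists_finite_invariant hr (hE.of_iso g) hn κ hκ

/-! ### Assembly of the counterexample -/

open DirectedSquareComplex

namespace Wise

variable {r : WiseColor → ℕ}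

theorem exists_isUniversalCover_wiseW (r : WiseColor → ℕ) :
    ∃ (U : DirectedSquareComplex) (p : Hom U (wiseW r)), p.IsUniversalCover :=
  exists_isUniversalCover exists_path

theorem exists_hasDomain {U : DirectedSquareComplex} {p : Hom U (wiseW r)}
    (hp : p.IsUniversalCover) {v : U.V} (hv : p.onV v = wiseZero r) :
    ∃ E : EventStructure, E.HasDomain (U.PrincipalFilter v) := by
  obtain ⟨f⟩ := nonempty_tips_orderIso hp hv
  obtain ⟨E, ⟨g⟩⟩ := TipProduct.exists_hasDomain fun p q => tipLen r (lab p q)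
  exact ⟨E, ⟨g.trans f⟩⟩

theorem regular_and_not_isRegularTrace (hr : Function.Injective r) {U : DirectedSquareComplex}
    {p : Hom U (wiseW r)} (hp : p.IsUniversalCover) {v : U.V} (hv : p.onV v = wiseZero r)
    {E : EventStructure} (hE : E.HasDomain (U.PrincipalFilter v)) :
    ¬ E.AdmitsRegularNiceLabeling ∧ E.Regular ∧ ¬ E.IsRegularTrace ∧ ¬ E.IsOfFiniteOneSafeNet := by
  have := finite_vertices (r := r)
  have := finite_edges (r := r)
  have hE' : E.HasDomain (Tips r) := by
    obtain ⟨f⟩ := nonempty_tips_orderIso hp hv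
    exact hE.map fun g => g.trans f.symm
  exact ⟨not_admitsRegularNiceLabeling hr hE', EventStructure.regular_of_universalCover hp hE,
    not_isRegularTrace hr hE', not_isOfFiniteOneSafeNet hr hE'⟩

end Wise

theorem theorem5p5 :
    (∀ r : WiseColor → ℕ, Set.BijOn r Set.univ (Set.Icc 1 5) →
      (∃ (U : DirectedSquareComplex) (p : DirectedSquareComplex.Hom U (wiseW r)),
        p.IsUniversalCover) ∧
      ∀ (U : DirectedSquareComplex) (p : DirectedSquareComplex.Hom U (wiseW r)),
        p.IsUniversalCover → ∀ v : U.V, p.onV v = wiseZero r →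
          (∃ E : EventStructure, E.HasDomain (U.PrincipalFilter v)) ∧
          ∀ E : EventStructure, E.HasDomain (U.PrincipalFilter v) →
            ¬ E.AdmitsRegularNiceLabeling ∧
            E.Regular ∧ ¬ E.IsRegularTrace ∧ ¬ E.IsOfFiniteOneSafeNet) ∧
    ¬ ThiagarajanConjecturePetri ∧ ¬ ThiagarajanConjectureTrace := by
  -- For the conjectures, one numbering of the colours and any vertex over the base point suffice.
  have key : ∃ E : EventStructure, E.Regular ∧ ¬ E.IsRegularTrace ∧ ¬ E.IsOfFiniteOneSafeNet := by
    obtain ⟨U, p, hp⟩ := Wise.exists_isUniversalCover_wiseW Wise.rank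
    obtain ⟨v, hv⟩ := hp.1.surjective (wiseZero Wise.rank)
    obtain ⟨E, hE⟩ := Wise.exists_hasDomain hp hv
    exact ⟨E, (Wise.regular_and_not_isRegularTrace
      (Set.injOn_univ.1 Wise.bijOn_rank.injOn) hp hv hE).2⟩
  obtain ⟨E, hreg, htrace, hnet⟩ := key
  refine ⟨fun r hr => ⟨Wise.exists_isUniversalCover_wiseW r, fun U p hp v hv =>
    ⟨Wise.exists_hasDomain hp hv, fun E hE =>
      Wise.regular_and_not_isRegularTrace (Set.injOn_univ.1 hr.injOn) hp hv hE⟩⟩,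
    fun h => hnet ((h E).2 hreg), fun h => htrace ((h E).1 hreg)⟩
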